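/- \textbf{Theorem (Canonicity).} Fix a first-order language with countably many variables and an arity-preserving involution $P\mapsto\overline P$ on its predicate symbols with $\overline P\neq P$. Formulas are built from atoms $Pt_1\ldots t_n$ by $\otimes$, $\parr$, $\forall x$, $\exists x$. A sequent is a disjoint union of formulas, regarded as a labelled directed forest of parse trees (so occurrences are distinguished). Let $\Gamma$ be a sequent that is \emph{clean}: its quantified variables are distinct from each other and from all free variables (this can always be achieved by renaming bound variables). Then two cut-free first-order MLL proofs $\Pi,\Pi'$ of $\Gamma$ are equivalent if and only if they translate to the same unification net on $\Gamma$, that is, iff there is a cut-free unification net $\theta$ on $\Gamma$ which is the translation of $\Pi$ and of $\Pi'$. Here: \emph{Proofs.} The rules are: the axiom $P\vec t,\overline P\vec t$; from $\Gamma,A$ and $B,\Delta$ infer $\Gamma,A\otimes B,\Delta$; from $\Gamma,A,B$ infer $\Gamma,A\parr B$; from $\Gamma,A$ infer $\Gamma,\forall xA$ if $x$ is not free in $\Gamma$; from $\Gamma,A[x\mapsto t]$ infer $\Gamma,\exists xA$ (with $t$ free for $x$ in $A$; $t$ is the witness). Each leaf above a rule tracks to a leaf below it. \emph{Equivalence.}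 A rule commutation exchanges, somewhere in a proof, two consecutive rules neither of which introduces a subformula of the formula introduced by the other; it is allowed whenever the result is again a proof (so a $\forall x$ rule moves down past a $\otimes$ rule only if $x$ is not free in the other branch, and an $\exists$ rule with witness $t$ moves down past a $\forall y$ rule only if $y$ does not occur in $t$). A witness replacement replaces the witness $t$ of an $\exists x$ rule by a term $u$, in all occurrences of $t$ above the rule that track down to the bound occurrences of $x$; the result need not be a correct proof. A re-witnessing of a proof is a proof obtained from it by a sequence of witness replacements. Two proofs are equivalent if one is obtained from the other by a finite sequence of rule commutations and re-witnessings. \emph{Translation.} A linking on $\Gamma$ is a set of disjoint pairs (links) of leaves with dual predicate symbols that covers all leaves. A proof of $\Gamma$ translates to the linking obtained by tracking the two atoms of each axiom down to $\Gamma$. \emph{Unification nets.} A unifier of a linking assigns terms to the existential variables of $\Gamma$ bound by non-vacuous quantifiers such that the term sequences at the two ends of every link become equal (free and universal variables are constants); a most general unifier (mgu) yields every unifier by substitution. The graph of a unifiable linking consists of the forest $\Gamma$ (edges directed towards the roots), an undirected edge for each link, and a directed edge (leap) from $\exists x$ to $\forall y$ whenever $\exists x$ is non-vacuous and the mgu assigns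 to $x$ a term containing $y$. A switching is obtained by deleting all but one edge into each $\parr$ and each $\forall$ and forgetting directions. A cut-free unification net is a linking that is unifiable and all of whose switchings are trees. -/

import Mathlib

universe u v

namespace MLL1

/-- A duality on the predicate symbols of a first-order language: an arity-preserving
involution without fixed points. Variables are natural numbers, terms are `L.Term ℕ`. -/
structure Duality (L : FirstOrder.Language.{u, v}) where
  dual : ∀ {n : ℕ}, L.Relations n → L.Relations n
  dual_dual : ∀ {n : ℕ} (P : L.Relations n), dual (dual P) = P
  dual_ne : ∀ {n : ℕ} (P : L.Relations n), dual P ≠ P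

/-- Formulas, as parse trees. Every vertex carries its name (the first, natural number, argument),
so that different occurrences in a sequent can be told apart; `all v x A` and `ex v x A` are
`∀ x A` and `∃ x A` with root vertex `v`. -/
inductive Formula (L : FirstOrder.Language.{u, v}) : Type (max u v)
  | atom (v : ℕ) {n : ℕ} (P : L.Relations n) (ts : Fin n → L.Term ℕ) : Formula L
  | tensor (v : ℕ) (A B : Formula L) : Formula L
  | par (v : ℕ) (A B : Formula L) : Formula L
  | all (v : ℕ) (x : ℕ) (A : Formula L) : Formula L
  | ex (v : ℕ) (x : ℕ) (A : Formula L) : Formula L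

/-- The substitution sending the variable `x` to `t` and fixing all other variables. -/
def single {L : FirstOrder.Language.{u, v}} (x : ℕ) (t : L.Term ℕ) : ℕ → L.Term ℕ :=
  Function.update FirstOrder.Language.Term.var x t

namespace Formula

variable {L : FirstOrder.Language.{u, v}}

/-- The name of the root vertex. -/
def vertex : Formula L → ℕ
  | atom v _ _ => v
  | tensor v _ _ => v
  | par v _ _ => v
  | all v _ _ => v
  | ex v _ _ => v

/-- The immediate subformulas. -/
def children : Formula L → List (Formula L)
  | atom _ _ _ => []
  | tensor _ A B => [A, B]
  | par _ A B => [A, B]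
  | all _ _ A => [A]
  | ex _ _ A => [A]

/-- All subformula occurrences, including the formula itself: one for every vertex. -/
def nodes : Formula L → Multiset (Formula L)
  | atom v P ts => {atom v P ts}
  | tensor v A B => tensor v A B ::ₘ (A.nodes + B.nodes)
  | par v A B => par v A B ::ₘ (A.nodes + B.nodes)
  | all v x A => all v x A ::ₘ A.nodes
  | ex v x A => ex v x A ::ₘ A.nodes

/-- The variables bound by the quantifiers, one for every quantifier. -/
def boundVars : Formula L → Multiset ℕ
  | atom _ _ _ => 0
  | tensor _ A B => A.boundVars + B.boundVars
  | par _ A B => A.boundVars + B.boundVars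
  | all _ x A => x ::ₘ A.boundVars
  | ex _ x A => x ::ₘ A.boundVars

/-- The free variables. -/
def freeVars : Formula L → Finset ℕ
  | atom _ _ ts => Finset.univ.biUnion fun i => (ts i).varFinset
  | tensor _ A B => A.freeVars ∪ B.freeVars
  | par _ A B => A.freeVars ∪ B.freeVars
  | all _ x A => A.freeVars.erase x
  | ex _ x A => A.freeVars.erase x

/-- Replace all free occurrences of `x` by `t`. -/
def subst (x : ℕ) (t : L.Term ℕ) : Formula L → Formula L
  | atom v P ts => atom v P fun i => (ts i).subst (single x t)
  | tensor v A B => tensor v (A.subst x t) (B.subst x t)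
  | par v A B => par v (A.subst x t) (B.subst x t)
  | all v y A => if y = x then all v y A else all v y (A.subst x t)
  | ex v y A => if y = x then ex v y A else ex v y (A.subst x t)

/-- `t` is free for `x`: replacing the free occurrences of `x` by `t` captures no variable. -/
def FreeFor (x : ℕ) (t : L.Term ℕ) : Formula L → Prop
  | atom _ _ _ => True
  | tensor _ A B => A.FreeFor x t ∧ B.FreeFor x t
  | par _ A B => A.FreeFor x t ∧ B.FreeFor x t
  | all v y A => x ∈ (all v y A).freeVars → y ∉ t.varFinset ∧ A.FreeFor x t
  | ex v y A => x ∈ (ex v y A).freeVars → y ∉ t.varFinset ∧ A.FreeFor x t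

end Formula

/-- A sequent is a disjoint union of formulas (see `IsForest` for the disjointness). -/
abbrev Sequent (L : FirstOrder.Language.{u, v}) := Multiset (Formula L)

section Sequent

variable {L : FirstOrder.Language.{u, v}}

/-- All subformula occurrences of a sequent: one for every vertex. -/
def nodes (Γ : Sequent L) : Multiset (Formula L) := Γ.bind Formula.nodes

/-- `Γ` is a directed forest: distinct vertices have distinct names. -/
def IsForest (Γ : Sequent L) : Prop := ((nodes Γ).map Formula.vertex).Nodup

/-- The free variables of a sequent. -/
def freeVars (Γ : Sequent L) : Set ℕ := {z | ∃ A ∈ Γ, z ∈ A.freeVars}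

/-- `Γ` is clean: all quantified variables are distinct from each other and from all
free variables. -/
def IsClean (Γ : Sequent L) : Prop :=
  (Γ.bind Formula.boundVars).Nodup ∧ ∀ x ∈ Γ.bind Formula.boundVars, x ∉ freeVars Γ

/-- The non-vacuous existential variables. -/
def existVars (Γ : Sequent L) : Set ℕ :=
  {x | ∃ v A, Formula.ex v x A ∈ nodes Γ ∧ x ∈ A.freeVars}

/-- The universal variables. -/
def univVars (Γ : Sequent L) : Set ℕ := {y | ∃ v A, Formula.all v y A ∈ nodes Γ}

/-- The vertices. -/
def vertices (Γ : Sequent L) : Set ℕ := {w | ∃ B ∈ nodes Γ, B.vertex = w}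

/-- The leaves. -/
def leaves (Γ : Sequent L) : Set ℕ :=
  {l | ∃ (n : ℕ) (P : L.Relations n) (ts : Fin n → L.Term ℕ), Formula.atom l P ts ∈ nodes Γ}

end Sequent

/-! ### Cut-free proofs -/

/-- The one-premise rules, with the name of the vertex that they introduce and, for `∃`, the
witness. (The witness of a vacuous `∃` rule is a dummy.) -/
inductive UnaryRule (L : FirstOrder.Language.{u, v}) : Type u
  | par (v : ℕ) : UnaryRule L
  | all (v : ℕ) : UnaryRule L
  | ex (v : ℕ) (t : L.Term ℕ) : UnaryRule L

/-- Trees of cut-free rules, correct or not. An axiom records its two leaves, any other rule the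
vertex that it introduces. The sequents are not stored, as they are determined, from the
conclusion upwards, by the conclusion and the tree. -/
inductive Deriv (L : FirstOrder.Language.{u, v}) : Type u
  | ax (s : Sym2 ℕ) : Deriv L
  | unary (r : UnaryRule L) (d : Deriv L) : Deriv L
  | tensor (v : ℕ) (d e : Deriv L) : Deriv L

variable {L : FirstOrder.Language.{u, v}}

/-- `Proves D d Γ`: the tree `d` is a cut-free proof of `Γ`. The rules keep the names of
vertices, so a leaf above a rule tracks to the leaf of the same name below the rule. -/
inductive Proves (D : Duality L) : Deriv L → Sequent L → Prop
  | ax (l l' : ℕ) {n : ℕ} (P : L.Relations n) (ts : Fin n → L.Term ℕ) :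
      Proves D (.ax s(l, l')) {Formula.atom l P ts, Formula.atom l' (D.dual P) ts}
  | tensor (v : ℕ) (A B : Formula L) (Γ Δ : Sequent L) (d e : Deriv L) :
      Proves D d (A ::ₘ Γ) → Proves D e (B ::ₘ Δ) →
      Proves D (.tensor v d e) (Formula.tensor v A B ::ₘ (Γ + Δ))
  | par (v : ℕ) (A B : Formula L) (Γ : Sequent L) (d : Deriv L) :
      Proves D d (A ::ₘ B ::ₘ Γ) →
      Proves D (.unary (.par v) d) (Formula.par v A B ::ₘ Γ)
  | all (v x : ℕ) (A : Formula L) (Γ : Sequent L) (d : Deriv L) :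
      x ∉ freeVars Γ → Proves D d (A ::ₘ Γ) →
      Proves D (.unary (.all v) d) (Formula.all v x A ::ₘ Γ)
  | ex (v x : ℕ) (t : L.Term ℕ) (A : Formula L) (Γ : Sequent L) (d : Deriv L) :
      A.FreeFor x t → Proves D d (A.subst x t ::ₘ Γ) →
      Proves D (.unary (.ex v t) d) (Formula.ex v x A ::ₘ Γ)

/-- The cut-free proofs of `Γ`. -/
def CutFreeProof (D : Duality L) (Γ : Sequent L) : Type u := {d : Deriv L // Proves D d Γ}

/-! ### Equivalence of proofs -/

/-- Rule commutations, as rewrites of a subtree. They are applied to proofs with a proof of the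
same sequent as the result (see `CutFreeProof.Commutation`), which is what the side conditions of
the commutations with `∀` and the omitted passive formulas amount to. -/
inductive Commutes : Deriv L → Deriv L → Prop
  | unary_unary (r r' : UnaryRule L) (d : Deriv L) :
      Commutes (.unary r (.unary r' d)) (.unary r' (.unary r d))
  | unary_tensor_left (r : UnaryRule L) (v : ℕ) (d e : Deriv L) :
      Commutes (.unary r (.tensor v d e)) (.tensor v (.unary r d) e)
  | unary_tensor_right (r : UnaryRule L) (v : ℕ) (d e : Deriv L) :
      Commutes (.unary r (.tensor v d e)) (.tensor v d (.unary r e))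
  | tensor_left_left (v w : ℕ) (d e f : Deriv L) :
      Commutes (.tensor v (.tensor w d e) f) (.tensor w (.tensor v d f) e)
  | tensor_left_right (v w : ℕ) (d e f : Deriv L) :
      Commutes (.tensor v (.tensor w d e) f) (.tensor w d (.tensor v e f))
  | tensor_right_right (v w : ℕ) (d e f : Deriv L) :
      Commutes (.tensor v d (.tensor w e f)) (.tensor w e (.tensor v d f))
  | congr_unary (r : UnaryRule L) {d d' : Deriv L} :
      Commutes d d' → Commutes (.unary r d) (.unary r d')
  | congr_tensor_left (v : ℕ) {d d' : Deriv L} (e : Deriv L) :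
      Commutes d d' → Commutes (.tensor v d e) (.tensor v d' e)
  | congr_tensor_right (v : ℕ) (d : Deriv L) {e e' : Deriv L} :
      Commutes e e' → Commutes (.tensor v d e) (.tensor v d e')

/-- Replace the witness of the `∃` rule that introduces the vertex `v` by `t`. As sequents are
read off from the conclusion upwards, this replaces by `t` exactly the occurrences of the old
witness that descend to an occurrence of the variable bound at `v`. -/
def Deriv.replaceWitness (v : ℕ) (t : L.Term ℕ) : Deriv L → Deriv L
  | .ax s => .ax s
  | .unary (.par w) d => .unary (.par w) (d.replaceWitness v t)
  | .unary (.all w) d => .unary (.all w) (d.replaceWitness v t)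
  | .unary (.ex w u) d => .unary (.ex w (if w = v then t else u)) (d.replaceWitness v t)
  | .tensor w d e => .tensor w (d.replaceWitness v t) (e.replaceWitness v t)

/-- The links given by the axioms. -/
def Deriv.links : Deriv L → Set (Sym2 ℕ)
  | .ax s => {s}
  | .unary _ d => d.links
  | .tensor _ d e => d.links ∪ e.links

namespace CutFreeProof

variable {D : Duality L} {Γ : Sequent L}

/-- `q` results from `p` by a rule commutation. -/
def Commutation (p q : CutFreeProof D Γ) : Prop := Commutes p.1 q.1

/-- `q` results from `p` by a sequence of witness replacements; the intermediate trees need not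
be correct proofs. -/
def Rewitnessing (p q : CutFreeProof D Γ) : Prop :=
  Relation.ReflTransGen (fun d d' : Deriv L => ∃ v t, d' = d.replaceWitness v t) p.1 q.1

/-- Equivalence of proofs: rule commutations (in both directions) and re-witnessings. -/
def Equivalent : CutFreeProof D Γ → CutFreeProof D Γ → Prop :=
  Relation.EqvGen fun p q => p.Commutation q ∨ p.Rewitnessing q

/-- The linking of a proof: the pairs of leaves of its axioms, tracked down to `Γ`. -/
def linking (p : CutFreeProof D Γ) : Set (Sym2 ℕ) := p.1.links

end CutFreeProof

/-! ### Cut-free unification nets -/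

section Nets

/-- A linking on `Γ`: a set of disjoint pairs of leaves with dual predicate symbols, which
together contain every leaf. -/
def IsLinking (D : Duality L) (Γ : Sequent L) (θ : Set (Sym2 ℕ)) : Prop :=
  (∀ s ∈ θ, ∃ (l l' n : ℕ) (P : L.Relations n) (ts ts' : Fin n → L.Term ℕ),
    s = s(l, l') ∧ Formula.atom l P ts ∈ nodes Γ ∧ Formula.atom l' (D.dual P) ts' ∈ nodes Γ) ∧
  (∀ s ∈ θ, ∀ s' ∈ θ, s ≠ s' → ∀ l ∈ s, l ∉ s') ∧
  (∀ l ∈ leaves Γ, ∃ s ∈ θ, l ∈ s)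

open Classical in
/-- Apply an assignment of terms to the non-vacuous existential variables of `Γ` to a term. -/
noncomputable def assign (Γ : Sequent L) (σ : ℕ → L.Term ℕ) (t : L.Term ℕ) : L.Term ℕ :=
  t.subst fun x => if x ∈ existVars Γ then σ x else FirstOrder.Language.Term.var x

/-- `σ` (of which only the values at non-vacuous existential variables matter) equalizes the term
sequences at the two ends of every link. -/
def IsUnifier (D : Duality L) (Γ : Sequent L) (θ : Set (Sym2 ℕ)) (σ : ℕ → L.Term ℕ) : Prop :=
  ∀ (l l' n : ℕ) (P : L.Relations n) (ts ts' : Fin n → L.Term ℕ), s(l, l') ∈ θ →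
    Formula.atom l P ts ∈ nodes Γ → Formula.atom l' (D.dual P) ts' ∈ nodes Γ →
    ∀ i, assign Γ σ (ts i) = assign Γ σ (ts' i)

/-- A most general unifier yields every unifier by a substitution; the free variables and the
universal variables of `Γ` are treated as constants. -/
def IsMgu (D : Duality L) (Γ : Sequent L) (θ : Set (Sym2 ℕ)) (σ : ℕ → L.Term ℕ) : Prop :=
  IsUnifier D Γ θ σ ∧ ∀ τ, IsUnifier D Γ θ τ → ∃ ρ : ℕ → L.Term ℕ,
    (∀ z, z ∈ freeVars Γ ∨ z ∈ univVars Γ → ρ z = FirstOrder.Language.Term.var z) ∧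
    ∀ x ∈ existVars Γ, τ x = (σ x).subst ρ

/-- There is a leap from the vertex `a` to the vertex `b`: they are quantifiers `∃ x` and `∀ y`
such that the mgu assigns to `x` a term containing `y`. -/
def Leap (D : Duality L) (Γ : Sequent L) (θ : Set (Sym2 ℕ)) (a b : ℕ) : Prop :=
  ∃ x y A B, Formula.ex a x A ∈ nodes Γ ∧ Formula.all b y B ∈ nodes Γ ∧ x ∈ existVars Γ ∧
    ∃ σ, IsMgu D Γ θ σ ∧ y ∈ (σ x).varFinset

/-- The directed edges of the graph of `θ`: from a vertex down to its parent, and leaps. -/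
def DirEdge (D : Duality L) (Γ : Sequent L) (θ : Set (Sym2 ℕ)) (a b : ℕ) : Prop :=
  (∃ C ∈ nodes Γ, ∃ B ∈ C.children, B.vertex = a ∧ C.vertex = b) ∨ Leap D Γ θ a b

/-- The vertices labelled by a par or by a universal quantifier. -/
def Switched (Γ : Sequent L) (b : ℕ) : Prop :=
  (∃ A B, Formula.par b A B ∈ nodes Γ) ∨ (∃ y A, Formula.all b y A ∈ nodes Γ)

/-- A switching chooses one edge into every par and every universal quantifier. -/
def IsSwitching (D : Duality L) (Γ : Sequent L) (θ : Set (Sym2 ℕ)) (c : ℕ → ℕ) : Prop :=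
  ∀ b, Switched Γ b → DirEdge D Γ θ (c b) b

/-- The undirected graph of a switching: links, and directed edges that were not deleted. -/
def switchingGraph (D : Duality L) (Γ : Sequent L) (θ : Set (Sym2 ℕ)) (c : ℕ → ℕ) :
    SimpleGraph (vertices Γ) :=
  SimpleGraph.fromRel fun a b => s(a.1, b.1) ∈ θ ∨
    (DirEdge D Γ θ a.1 b.1 ∧ (Switched Γ b.1 → c b.1 = a.1))

/-- A linking is correct if it is unifiable and all of its switchings are trees. -/
def IsCorrect (D : Duality L) (Γ : Sequent L) (θ : Set (Sym2 ℕ)) : Prop :=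
  (∃ σ, IsUnifier D Γ θ σ) ∧
  ∀ c, IsSwitching D Γ θ c → (switchingGraph D Γ θ c).IsTree

/-- A cut-free unification net on `Γ` is a correct linking on `Γ`. -/
structure UnificationNet (D : Duality L) (Γ : Sequent L) where
  links : Set (Sym2 ℕ)
  isLinking : IsLinking D Γ links
  isCorrect : IsCorrect D Γ links

/-- The proof `p` translates to the unification net `θ`. -/
def CutFreeProof.TranslatesTo {D : Duality L} {Γ : Sequent L} (p : CutFreeProof D Γ)
    (θ : UnificationNet D Γ) : Prop := p.linking = θ.links

end Nets

end MLL1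

/-! Commutations and witness replacements leave the axioms alone, so equivalent proofs have equal
linkings. Two facts remain: the linking of a proof is a unification net, and proofs with equal
linkings are equivalent. Both come from separating the order of the rules from the terms.

A `Skeleton` is a rule tree for a sequent in which no witness is substituted. The conditions on
variables are replaced by the demand that the source of every leap, an edge of a given relation `E`,
lies above the rule of its target. From a proof, `exists_isSolution` collects the witnesses into a
single assignment `τ`, in which a bound variable is overwritten by a dummy `z₀` wherever no ∀ rule
for it lies below the ∃ rule that uses it. Then `τ` equalizes the links, and the rule tree of the
proof is a skeleton for the leaps of `τ`.

Nets: every mgu yields `τ` by a substitution fixing the universal variables, so the leaps of an mgu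
are leaps of `τ`. All switchings of a skeleton are trees by induction on the rules
(`Skeleton.isTreeOn`).

Equivalence: let `τ` and `τ'` come from two proofs with the same links. Their anti-unification `σ`,
with `z₀` where they disagree, still equalizes the links, and each leap of `σ` is a leap of both.
Hence both rule trees, with the witnesses of `σ`, are skeletons for the leaps of `σ`, and every such
skeleton is a proof (`Skeleton.proves`). So it suffices to connect two skeletons with equal links by
commutations through skeletons (`Skeleton.convertible`). The last rule of one is moved to the end of
the other, and induction applies to the premises. A one-premise rule can descend because no leap
starts at its vertex. A tensor rule can descend because neither links nor leaps cross its splitting,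
while a derivable sequent cannot be divided into two parts without a link between them. -/

namespace MLL1

variable {L : FirstOrder.Language.{u, v}}

open FirstOrder.Language (Term)

/-! ### Vertices and variables of sequents -/

/-- The vertices of a formula. -/
def Formula.vertexSet (A : Formula L) : Set ℕ := {w | ∃ B ∈ A.nodes, B.vertex = w}

/-- The variables bound by the quantifiers of a sequent. -/
def boundVars (Γ : Sequent L) : Multiset ℕ := Γ.bind Formula.boundVars

section Basic

variable {v x : ℕ} {A B C F : Formula L} {Γ Δ : Sequent L} {u : ℕ}

lemma nodes_cons : nodes (A ::ₘ Γ) = A.nodes + nodes Γ := Multiset.cons_bind _ _ _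

lemma nodes_add : nodes (Γ + Δ) = nodes Γ + nodes Δ := Multiset.add_bind _ _ _

lemma nodes_tensor_cons :
    nodes (.tensor v A B ::ₘ (Γ + Δ)) =
      .tensor v A B ::ₘ (nodes (A ::ₘ Γ) + nodes (B ::ₘ Δ)) := by
  simp only [nodes_cons, nodes_add, Formula.nodes, Multiset.cons_add]
  congr 1
  abel

lemma nodes_par_cons : nodes (.par v A B ::ₘ Γ) = .par v A B ::ₘ nodes (A ::ₘ B ::ₘ Γ) := by
  simp only [nodes_cons, Formula.nodes, Multiset.cons_add, add_assoc]

lemma nodes_all_cons : nodes (.all v x A ::ₘ Γ) = .all v x A ::ₘ nodes (A ::ₘ Γ) := by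
  simp only [nodes_cons, Formula.nodes, Multiset.cons_add]

lemma nodes_ex_cons : nodes (.ex v x A ::ₘ Γ) = .ex v x A ::ₘ nodes (A ::ₘ Γ) := by
  simp only [nodes_cons, Formula.nodes, Multiset.cons_add]

lemma boundVars_cons : boundVars (A ::ₘ Γ) = A.boundVars + boundVars Γ :=
  Multiset.cons_bind _ _ _

lemma boundVars_add : boundVars (Γ + Δ) = boundVars Γ + boundVars Δ := Multiset.add_bind _ _ _

lemma boundVars_tensor_cons :
    boundVars (.tensor v A B ::ₘ (Γ + Δ)) = boundVars (A ::ₘ Γ) + boundVars (B ::ₘ Δ) := by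
  simp only [boundVars_cons, boundVars_add, Formula.boundVars]
  abel

lemma boundVars_par_cons : boundVars (.par v A B ::ₘ Γ) = boundVars (A ::ₘ B ::ₘ Γ) := by
  simp only [boundVars_cons, Formula.boundVars, add_assoc]

lemma boundVars_all_cons : boundVars (.all v x A ::ₘ Γ) = x ::ₘ boundVars (A ::ₘ Γ) := by
  simp only [boundVars_cons, Formula.boundVars, Multiset.cons_add]

lemma boundVars_ex_cons : boundVars (.ex v x A ::ₘ Γ) = x ::ₘ boundVars (A ::ₘ Γ) := by
  simp only [boundVars_cons, Formula.boundVars, Multiset.cons_add]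

@[simp] lemma mem_freeVars_cons :
    u ∈ freeVars (A ::ₘ Γ) ↔ u ∈ A.freeVars ∨ u ∈ freeVars Γ := by
  simp [freeVars]

@[simp] lemma mem_freeVars_add :
    u ∈ freeVars (Γ + Δ) ↔ u ∈ freeVars Γ ∨ u ∈ freeVars Δ := by
  simp [freeVars, or_and_right, exists_or]

lemma Formula.self_mem_nodes (A : Formula L) : A ∈ A.nodes := by
  cases A <;> simp [Formula.nodes]

lemma Formula.vertex_mem (A : Formula L) : A.vertex ∈ A.vertexSet := ⟨A, A.self_mem_nodes, rfl⟩

@[simp] lemma mem_vertices_cons : u ∈ vertices (A ::ₘ Γ) ↔ u ∈ A.vertexSet ∨ u ∈ vertices Γ := by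
  simp [vertices, Formula.vertexSet, nodes_cons, or_and_right, exists_or]

@[simp] lemma mem_vertices_add : u ∈ vertices (Γ + Δ) ↔ u ∈ vertices Γ ∨ u ∈ vertices Δ := by
  simp [vertices, nodes_add, or_and_right, exists_or]

@[simp] lemma notMem_vertices_zero : u ∉ vertices (0 : Sequent L) := by
  simp [vertices, nodes]

@[simp] lemma mem_vertices_singleton : u ∈ vertices {A} ↔ u ∈ A.vertexSet := by
  simp [← Multiset.cons_zero]

lemma mem_vertices_of_mem (hA : A ∈ Γ) (hu : u ∈ A.vertexSet) : u ∈ vertices Γ := by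
  obtain ⟨Γ', rfl⟩ := Multiset.exists_cons_of_mem hA
  simp [hu]

lemma mem_vertices_iff : u ∈ vertices Γ ↔ ∃ A ∈ Γ, u ∈ A.vertexSet := by
  simp only [vertices, nodes, Formula.vertexSet, Multiset.mem_bind, Set.mem_ofPred_eq]
  aesop

lemma mem_vertices_of_mem_nodes (hA : A ∈ nodes Γ) : A.vertex ∈ vertices Γ := ⟨A, hA, rfl⟩

@[simp] lemma mem_vertexSet_atom {n : ℕ} {P : L.Relations n} {ts : Fin n → L.Term ℕ} :
    u ∈ (Formula.atom v P ts).vertexSet ↔ u = v := by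
  simp [Formula.vertexSet, Formula.nodes, Formula.vertex, eq_comm]

@[simp] lemma mem_vertexSet_tensor :
    u ∈ (Formula.tensor v A B).vertexSet ↔ u = v ∨ u ∈ A.vertexSet ∨ u ∈ B.vertexSet := by
  simp [Formula.vertexSet, Formula.nodes, Formula.vertex, or_and_right, exists_or, eq_comm]

@[simp] lemma mem_vertexSet_par :
    u ∈ (Formula.par v A B).vertexSet ↔ u = v ∨ u ∈ A.vertexSet ∨ u ∈ B.vertexSet := by
  simp [Formula.vertexSet, Formula.nodes, Formula.vertex, or_and_right, exists_or, eq_comm]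

@[simp] lemma mem_vertexSet_all :
    u ∈ (Formula.all v x A).vertexSet ↔ u = v ∨ u ∈ A.vertexSet := by
  simp [Formula.vertexSet, Formula.nodes, Formula.vertex, eq_comm]

@[simp] lemma mem_vertexSet_ex :
    u ∈ (Formula.ex v x A).vertexSet ↔ u = v ∨ u ∈ A.vertexSet := by
  simp [Formula.vertexSet, Formula.nodes, Formula.vertex, eq_comm]

/-! ### Forests -/

lemma IsForest.eq_of_vertex_eq (h : IsForest Γ) (hA : A ∈ nodes Γ) (hB : B ∈ nodes Γ)
    (hv : A.vertex = B.vertex) : A = B :=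
  Multiset.inj_on_of_nodup_map h A hA B hB hv

lemma IsForest.of_cons_nodes (h : IsForest Γ) (hn : nodes Γ = F ::ₘ nodes Δ) :
    F.vertex ∉ vertices Δ ∧ IsForest Δ := by
  unfold IsForest at h
  rw [hn, Multiset.map_cons, Multiset.nodup_cons] at h
  exact ⟨fun ⟨B, hB, e⟩ => h.1 (Multiset.mem_map.2 ⟨B, hB, e⟩), h.2⟩

lemma IsForest.of_par (h : IsForest (.par v A B ::ₘ Γ)) :
    v ∉ vertices (A ::ₘ B ::ₘ Γ) ∧ IsForest (A ::ₘ B ::ₘ Γ) := h.of_cons_nodes nodes_par_cons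

lemma IsForest.of_all (h : IsForest (.all v x A ::ₘ Γ)) :
    v ∉ vertices (A ::ₘ Γ) ∧ IsForest (A ::ₘ Γ) := h.of_cons_nodes nodes_all_cons

lemma IsForest.of_ex (h : IsForest (.ex v x A ::ₘ Γ)) :
    v ∉ vertices (A ::ₘ Γ) ∧ IsForest (A ::ₘ Γ) := h.of_cons_nodes nodes_ex_cons

structure TensorForest (v : ℕ) (Γ Δ : Sequent L) : Prop where
  notMem_left : v ∉ vertices Γ
  notMem_right : v ∉ vertices Δ
  left : IsForest Γ
  right : IsForest Δ
  disjoint : ∀ u ∈ vertices Γ, u ∉ vertices Δ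

lemma IsForest.of_tensor (h : IsForest (.tensor v A B ::ₘ (Γ + Δ))) :
    TensorForest v (A ::ₘ Γ) (B ::ₘ Δ) := by
  unfold IsForest at h
  rw [nodes_tensor_cons, Multiset.map_cons, Multiset.nodup_cons, Multiset.map_add,
    Multiset.nodup_add, Multiset.mem_add, not_or] at h
  obtain ⟨⟨h1, h2⟩, h3, h4, h5⟩ := h
  refine ⟨fun ⟨B, hB, e⟩ => h1 (Multiset.mem_map.2 ⟨B, hB, e⟩),
    fun ⟨B, hB, e⟩ => h2 (Multiset.mem_map.2 ⟨B, hB, e⟩), h3, h4, ?_⟩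
  rintro u ⟨B, hB, rfl⟩ ⟨C, hC, e⟩
  exact Multiset.disjoint_left.1 h5 (Multiset.mem_map_of_mem _ hB)
    (Multiset.mem_map.2 ⟨C, hC, e⟩)

/-! ### Clean sequents -/

lemma isClean_iff : IsClean Γ ↔ (boundVars Γ).Nodup ∧ ∀ x ∈ boundVars Γ, x ∉ freeVars Γ := Iff.rfl

lemma IsClean.of_par (h : IsClean (.par v A B ::ₘ Γ)) : IsClean (A ::ₘ B ::ₘ Γ) := by
  rw [isClean_iff, boundVars_par_cons] at h
  refine ⟨h.1, fun x hx => ?_⟩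
  have := h.2 x hx
  simp only [mem_freeVars_cons, Formula.freeVars, Finset.mem_union] at this ⊢
  tauto

lemma IsClean.of_all (h : IsClean (.all v x A ::ₘ Γ)) :
    IsClean (A ::ₘ Γ) ∧ x ∉ boundVars (A ::ₘ Γ) ∧ x ∉ freeVars Γ := by
  rw [isClean_iff, boundVars_all_cons, Multiset.nodup_cons] at h
  obtain ⟨⟨h1, h2⟩, h3⟩ := h
  refine ⟨⟨h2, fun z hz => ?_⟩, h1, fun hx => h3 x (Multiset.mem_cons_self _ _) (by simp [hx])⟩
  have := h3 z (Multiset.mem_cons_of_mem hz)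
  have hne : z ≠ x := fun e => h1 (e ▸ hz)
  simpa [Formula.freeVars, hne] using this

lemma IsClean.of_ex (h : IsClean (.ex v x A ::ₘ Γ)) :
    IsClean (A ::ₘ Γ) ∧ x ∉ boundVars (A ::ₘ Γ) ∧ x ∉ freeVars Γ := by
  rw [isClean_iff, boundVars_ex_cons, Multiset.nodup_cons] at h
  obtain ⟨⟨h1, h2⟩, h3⟩ := h
  refine ⟨⟨h2, fun z hz => ?_⟩, h1, fun hx => h3 x (Multiset.mem_cons_self _ _) (by simp [hx])⟩
  have := h3 z (Multiset.mem_cons_of_mem hz)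
  have hne : z ≠ x := fun e => h1 (e ▸ hz)
  simpa [Formula.freeVars, hne] using this

lemma mem_freeVars_tensor_cons : u ∈ freeVars (.tensor v A B ::ₘ (Γ + Δ)) ↔
    u ∈ freeVars (A ::ₘ Γ) ∨ u ∈ freeVars (B ::ₘ Δ) := by
  simp only [mem_freeVars_cons, mem_freeVars_add, Formula.freeVars, Finset.mem_union]
  tauto

structure TensorClean (Γ Δ : Sequent L) : Prop where
  left : IsClean Γ
  right : IsClean Δ
  boundVars : ∀ x ∈ boundVars Γ, x ∉ boundVars Δ
  left_free : ∀ x ∈ MLL1.boundVars Γ, x ∉ freeVars Δ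
  right_free : ∀ x ∈ MLL1.boundVars Δ, x ∉ freeVars Γ

lemma IsClean.of_tensor (h : IsClean (.tensor v A B ::ₘ (Γ + Δ))) :
    TensorClean (A ::ₘ Γ) (B ::ₘ Δ) := by
  simp only [isClean_iff, boundVars_tensor_cons, Multiset.nodup_add, mem_freeVars_tensor_cons,
    Multiset.mem_add] at h
  obtain ⟨⟨h1, h2, h3⟩, h4⟩ := h
  exact ⟨⟨h1, fun x hx hf => h4 x (.inl hx) (.inl hf)⟩,
    ⟨h2, fun x hx hf => h4 x (.inr hx) (.inr hf)⟩,
    fun x hx hx' => Multiset.disjoint_left.1 h3 hx hx',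
    fun x hx hf => h4 x (.inl hx) (.inr hf), fun x hx hf => h4 x (.inr hx) (.inl hf)⟩

/-! ### Quantifiers and leaves -/

lemma Formula.mem_boundVars_iff {A : Formula L} : x ∈ A.boundVars ↔
    (∃ v B, Formula.ex v x B ∈ A.nodes) ∨ ∃ v B, Formula.all v x B ∈ A.nodes := by
  induction A with
  | atom => simp [Formula.boundVars, Formula.nodes]
  | tensor v A B hA hB | par v A B hA hB =>
    simp only [Formula.boundVars, Formula.nodes, Multiset.mem_cons, Multiset.mem_add, reduceCtorEq,
      false_or, exists_or, hA, hB]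
    rw [or_or_or_comm]
  | all v y A hA =>
    simp only [Formula.boundVars, Formula.nodes, Multiset.mem_cons, reduceCtorEq, false_or,
      exists_or, hA, Formula.all.injEq]
    rw [or_left_comm]
    simp
  | ex v y A hA =>
    simp only [Formula.boundVars, Formula.nodes, Multiset.mem_cons, reduceCtorEq, false_or,
      exists_or, hA, Formula.ex.injEq]
    rw [or_assoc]
    simp

lemma mem_boundVars_iff : x ∈ boundVars Γ ↔
    (∃ v B, Formula.ex v x B ∈ nodes Γ) ∨ ∃ v B, Formula.all v x B ∈ nodes Γ := by
  simp only [boundVars, nodes, Multiset.mem_bind, Formula.mem_boundVars_iff]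
  constructor
  · rintro ⟨A, hA, ⟨v, B, h⟩ | ⟨v, B, h⟩⟩
    exacts [.inl ⟨v, B, A, hA, h⟩, .inr ⟨v, B, A, hA, h⟩]
  · rintro (⟨v, B, A, hA, h⟩ | ⟨v, B, A, hA, h⟩)
    exacts [⟨A, hA, .inl ⟨v, B, h⟩⟩, ⟨A, hA, .inr ⟨v, B, h⟩⟩]

lemma mem_boundVars_of_ex (h : Formula.ex v x A ∈ nodes Γ) : x ∈ boundVars Γ :=
  mem_boundVars_iff.2 (.inl ⟨v, A, h⟩)

lemma mem_boundVars_of_all (h : Formula.all v x A ∈ nodes Γ) : x ∈ boundVars Γ :=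
  mem_boundVars_iff.2 (.inr ⟨v, A, h⟩)

lemma mem_boundVars_of_existVars (h : x ∈ existVars Γ) : x ∈ boundVars Γ := by
  obtain ⟨v, A, h, -⟩ := h
  exact mem_boundVars_of_ex h

lemma Formula.notMem_of_nodup {A : Formula L} (h : A.boundVars.Nodup) {a b : ℕ} {B C : Formula L}
    (hB : Formula.ex a x B ∈ A.nodes) (hC : Formula.all b x C ∈ A.nodes) : False := by
  induction A with
  | atom => simp [Formula.nodes] at hB
  | tensor v A B hA hB =>
    simp only [Formula.nodes, Multiset.mem_cons, Multiset.mem_add, reduceCtorEq, false_or] at hB hC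
    simp only [Formula.boundVars, Multiset.nodup_add, Multiset.disjoint_left,
      Formula.mem_boundVars_iff] at h
    grind
  | par v A B hA hB =>
    simp only [Formula.nodes, Multiset.mem_cons, Multiset.mem_add, reduceCtorEq, false_or] at hB hC
    simp only [Formula.boundVars, Multiset.nodup_add, Multiset.disjoint_left,
      Formula.mem_boundVars_iff] at h
    grind
  | all v y A hA =>
    simp only [Formula.nodes, Multiset.mem_cons, reduceCtorEq, false_or] at hB hC
    simp only [Formula.boundVars, Multiset.nodup_cons, Formula.mem_boundVars_iff] at h
    grind
  | ex v y A hA =>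
    simp only [Formula.nodes, Multiset.mem_cons, reduceCtorEq, false_or] at hB hC
    simp only [Formula.boundVars, Multiset.nodup_cons, Formula.mem_boundVars_iff] at h
    grind

lemma IsClean.ex_ne_all (h : IsClean Γ) {a b y : ℕ}
    (hB : Formula.ex a x A ∈ nodes Γ) (hC : Formula.all b y B ∈ nodes Γ) : x ≠ y := by
  rintro rfl
  induction Γ using Multiset.induction with
  | empty => simp [nodes] at hB
  | cons F Γ ih =>
    have h1 := h.1
    have h2 : IsClean Γ := by
      rw [isClean_iff, boundVars_cons, Multiset.nodup_add] at h
      exact ⟨h.1.2.1, fun z hz hf =>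
        h.2 z (Multiset.mem_add.2 (.inr hz)) (mem_freeVars_cons.2 (.inr hf))⟩
    change (boundVars (F ::ₘ Γ)).Nodup at h1
    rw [boundVars_cons, Multiset.nodup_add, Multiset.disjoint_left] at h1
    rw [nodes_cons, Multiset.mem_add] at hB hC
    obtain ⟨h3, h4, h5⟩ := h1
    rcases hB with hB | hB <;> rcases hC with hC | hC
    · exact Formula.notMem_of_nodup h3 hB hC
    · exact h5 (Formula.mem_boundVars_iff.2 (.inl ⟨_, _, hB⟩)) (mem_boundVars_of_all hC)
    · exact h5 (Formula.mem_boundVars_iff.2 (.inr ⟨_, _, hC⟩)) (mem_boundVars_of_ex hB)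
    · exact ih h2 hB hC

/-- Non-vacuous ∃ quantifiers suffice: below a vacuous `∃ z`, an occurrence of `z` in a leaf is
bound by a quantifier further inside. -/
lemma Formula.mem_vars_of_atom {A : Formula L} {l n : ℕ} {P : L.Relations n}
    {ts : Fin n → L.Term ℕ} (h : Formula.atom l P ts ∈ A.nodes) {i : Fin n} {z : ℕ}
    (hz : z ∈ (ts i).varFinset) : z ∈ A.freeVars ∨
      (∃ v B, Formula.ex v z B ∈ A.nodes ∧ z ∈ B.freeVars) ∨
        ∃ v B, Formula.all v z B ∈ A.nodes := by
  induction A with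
  | atom v Q us =>
    simp only [Formula.nodes, Multiset.mem_singleton, Formula.atom.injEq] at h
    obtain ⟨rfl, rfl, h, h'⟩ := h
    cases h; cases h'
    exact .inl (Finset.mem_biUnion.2 ⟨i, Finset.mem_univ i, hz⟩)
  | tensor v A B hA hB =>
    simp only [Formula.nodes, Multiset.mem_cons, Multiset.mem_add, reduceCtorEq, false_or] at h ⊢
    simp only [Formula.freeVars, Finset.mem_union]
    grind
  | par v A B hA hB =>
    simp only [Formula.nodes, Multiset.mem_cons, Multiset.mem_add, reduceCtorEq, false_or] at h ⊢
    simp only [Formula.freeVars, Finset.mem_union]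
    grind
  | all v y A hA =>
    simp only [Formula.nodes, Multiset.mem_cons, reduceCtorEq, false_or] at h ⊢
    simp only [Formula.freeVars, Finset.mem_erase]
    by_cases e : z = y
    · subst e; exact .inr (.inr ⟨v, A, .inl rfl⟩)
    · grind
  | ex v y A hA =>
    simp only [Formula.nodes, Multiset.mem_cons, reduceCtorEq, false_or] at h ⊢
    simp only [Formula.freeVars, Finset.mem_erase]
    by_cases e : z = y
    · subst e
      by_cases hf : z ∈ A.freeVars
      · exact .inr (.inl ⟨v, A, .inl rfl, hf⟩)
      · grind
    · grind

lemma mem_vars_of_atom {l n : ℕ} {P : L.Relations n} {ts : Fin n → L.Term ℕ}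
    (h : Formula.atom l P ts ∈ nodes Γ) {i : Fin n} {z : ℕ} (hz : z ∈ (ts i).varFinset) :
    z ∈ freeVars Γ ∨ z ∈ existVars Γ ∨ z ∈ univVars Γ := by
  simp only [nodes, Multiset.mem_bind] at h
  obtain ⟨A, hA, h⟩ := h
  have hn : ∀ B ∈ A.nodes, B ∈ nodes Γ := fun B hB => Multiset.mem_bind.2 ⟨A, hA, hB⟩
  rcases Formula.mem_vars_of_atom h hz with h | ⟨v, B, h, h'⟩ | ⟨v, B, h⟩
  · exact .inl ⟨A, hA, h⟩
  · exact .inr (.inl ⟨v, B, hn _ h, h'⟩)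
  · exact .inr (.inr ⟨v, B, hn _ h⟩)

end Basic

/-! ### Substitution in terms -/

section Terms

variable {σ τ : ℕ → L.Term ℕ} {t : L.Term ℕ} {x y : ℕ}

lemma subst_congr (h : ∀ z ∈ t.varFinset, σ z = τ z) : t.subst σ = t.subst τ := by
  induction t with
  | var z => exact h z (by simp)
  | func f ts ih =>
    simp only [Term.subst, Term.func.injEq, heq_eq_eq, true_and]
    exact funext fun i => ih i fun z hz => h z (Finset.mem_biUnion.2 ⟨i, Finset.mem_univ i, hz⟩)

lemma subst_var (t : L.Term ℕ) : t.subst Term.var = t := by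
  induction t with
  | var z => rfl
  | func f ts ih => simp [Term.subst, ih]

lemma subst_subst (t : L.Term ℕ) (σ τ : ℕ → L.Term ℕ) :
    (t.subst σ).subst τ = t.subst fun z => (σ z).subst τ := by
  induction t with
  | var z => rfl
  | func f ts ih => simp [Term.subst, ih]

lemma mem_varFinset_subst :
    y ∈ (t.subst σ).varFinset ↔ ∃ z ∈ t.varFinset, y ∈ (σ z).varFinset := by
  induction t with
  | var z => simp [Term.subst]
  | func f ts ih =>
    simp only [Term.subst, Term.varFinset, Finset.mem_biUnion, Finset.mem_univ, true_and, ih]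
    grind

lemma subst_single_of_notMem {s : L.Term ℕ} (h : x ∉ s.varFinset) :
    s.subst (single x t) = s := by
  conv_rhs => rw [← subst_var s]
  refine subst_congr fun z hz => ?_
  have : z ≠ x := fun e => h (e ▸ hz)
  simp [single, this]

open Classical in
/-- Rename all variables of `U` to `z₀`. -/
noncomputable def blank (z₀ : ℕ) (U : Set ℕ) (t : L.Term ℕ) : L.Term ℕ :=
  t.subst fun z => if z ∈ U then Term.var z₀ else Term.var z

lemma notMem_blank {z₀ : ℕ} {U : Set ℕ} (hz : z₀ ∉ U) (hy : y ∈ U) :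
    y ∉ (blank z₀ U t).varFinset := by
  intro h
  obtain ⟨z, -, h⟩ := mem_varFinset_subst.1 h
  split_ifs at h with hU
  · rw [Term.varFinset, Finset.mem_singleton] at h
    exact hz (h ▸ hy)
  · rw [Term.varFinset, Finset.mem_singleton] at h
    exact hU (h ▸ hy)

lemma blank_var {z₀ : ℕ} {U : Set ℕ} (hy : y ∉ U) :
    blank z₀ U (Term.var y : L.Term ℕ) = Term.var y := by
  simp [blank, Term.subst, hy]

lemma blank_subst {z₀ : ℕ} {U : Set ℕ} :
    blank z₀ U (t.subst σ) = t.subst fun z => blank z₀ U (σ z) := subst_subst _ _ _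

lemma blank_diff {z₀ : ℕ} {U : Set ℕ} (hy : y ∉ t.varFinset) :
    blank z₀ (U \ {y}) t = blank z₀ U t := by
  unfold blank
  refine subst_congr fun z hz => ?_
  have : z ≠ y := fun e => hy (e ▸ hz)
  split_ifs with h h' h'
  exacts [rfl, absurd h.1 h', absurd ⟨h', this⟩ h, rfl]

open Classical in
/-- The greatest common structure of two terms, with `z₀` at the places where they differ. -/
noncomputable def antiUnify (z₀ : ℕ) : L.Term ℕ → L.Term ℕ → L.Term ℕ
  | .var a, .var b => if a = b then .var a else .var z₀
  | .var _, .func _ _ => .var z₀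
  | .func _ _, .var _ => .var z₀
  | @Term.func _ _ n f ts, @Term.func _ _ m g us =>
    if h : ∃ e : n = m, e ▸ f = g then
      .func f fun i => antiUnify z₀ (ts i) (us (Fin.cast h.1 i))
    else .var z₀

/-- Two instances of one term share its function symbols, so they can differ only inside the
substituted terms. Consequently the anti-unification of two unifiers is again a unifier. -/
lemma antiUnify_subst (z₀ : ℕ) (t : L.Term ℕ) (σ τ : ℕ → L.Term ℕ) :
    antiUnify z₀ (t.subst σ) (t.subst τ) = t.subst fun z => antiUnify z₀ (σ z) (τ z) := by
  induction t with
  | var z => rfl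
  | func f ts ih =>
    simp only [Term.subst, antiUnify, exists_const, Fin.cast_eq_self]
    rw [dif_pos trivial]
    simp [ih]

/-- A variable other than `z₀` survives only where both terms carry it. This makes every leap of the
anti-unified assignment a leap of both given ones. -/
lemma mem_of_mem_antiUnify {z₀ : ℕ} (hy : y ≠ z₀) (s t : L.Term ℕ) :
    y ∈ (antiUnify z₀ s t).varFinset → y ∈ s.varFinset ∧ y ∈ t.varFinset := by
  induction s generalizing t with
  | var a =>
    cases t with
    | var b =>
      simp only [antiUnify]
      split_ifs with e
      · subst e; simp
      · simp [hy]
    | func g us => simp [antiUnify, hy]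
  | @func n f ts ih =>
    cases t with
    | var b => simp [antiUnify, hy]
    | @func m g us =>
      simp only [antiUnify]
      split_ifs with e
      · obtain ⟨rfl, rfl⟩ := e
        simp only [Fin.cast_eq_self, Term.varFinset, Finset.mem_biUnion, Finset.mem_univ, true_and]
        rintro ⟨i, hi⟩
        exact ⟨⟨i, (ih i _ hi).1⟩, ⟨i, (ih i _ hi).2⟩⟩
      · simp [hy]

end Terms

/-! ### Simultaneous substitution in formulas -/

namespace Formula

/-- Apply `τ` to all free variables. -/
def inst : (ℕ → L.Term ℕ) → Formula L → Formula L
  | τ, atom v P ts => atom v P fun i => (ts i).subst τ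
  | τ, tensor v A B => tensor v (A.inst τ) (B.inst τ)
  | τ, par v A B => par v (A.inst τ) (B.inst τ)
  | τ, all v y A => all v y (A.inst (Function.update τ y (Term.var y)))
  | τ, ex v y A => ex v y (A.inst (Function.update τ y (Term.var y)))

/-- Applying `τ` to all free variables captures no variable. -/
def NoCapture : (ℕ → L.Term ℕ) → Formula L → Prop
  | _, atom _ _ _ => True
  | τ, tensor _ A B => A.NoCapture τ ∧ B.NoCapture τ
  | τ, par _ A B => A.NoCapture τ ∧ B.NoCapture τ
  | τ, all _ y A => (∀ z ∈ A.freeVars, z ≠ y → y ∉ (τ z).varFinset) ∧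
      A.NoCapture (Function.update τ y (Term.var y))
  | τ, ex _ y A => (∀ z ∈ A.freeVars, z ≠ y → y ∉ (τ z).varFinset) ∧
      A.NoCapture (Function.update τ y (Term.var y))

variable {σ τ : ℕ → L.Term ℕ} {t : L.Term ℕ} {x y : ℕ} {A : Formula L}

lemma inst_congr (h : ∀ z ∈ A.freeVars, σ z = τ z) : A.inst σ = A.inst τ := by
  induction A generalizing σ τ with
  | atom v P ts =>
    simp only [inst, atom.injEq, heq_eq_eq, true_and]
    exact funext fun i => subst_congr fun z hz =>
      h z (Finset.mem_biUnion.2 ⟨i, Finset.mem_univ i, hz⟩)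
  | tensor v A B hA hB | par v A B hA hB =>
    simp only [freeVars, Finset.mem_union] at h
    simp only [inst]
    rw [hA fun z hz => h z (.inl hz), hB fun z hz => h z (.inr hz)]
  | all v y A hA | ex v y A hA =>
    simp only [freeVars, Finset.mem_erase] at h
    simp only [inst]
    rw [hA]
    intro z hz
    by_cases e : z = y
    · simp [e]
    · simpa [e] using h z ⟨e, hz⟩

lemma inst_var (A : Formula L) : A.inst Term.var = A := by
  induction A with
  | atom v P ts => simp [inst, subst_var]
  | tensor v A B hA hB | par v A B hA hB => simp [inst, hA, hB]
  | all v y A hA | ex v y A hA => simp [inst, hA]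

lemma noCapture_congr (h : ∀ z ∈ A.freeVars, σ z = τ z) (hN : A.NoCapture σ) :
    A.NoCapture τ := by
  induction A generalizing σ τ with
  | atom v P ts => trivial
  | tensor v A B hA hB | par v A B hA hB =>
    simp only [freeVars, Finset.mem_union] at h
    exact ⟨hA (fun z hz => h z (.inl hz)) hN.1, hB (fun z hz => h z (.inr hz)) hN.2⟩
  | all v y A hA | ex v y A hA =>
    simp only [freeVars, Finset.mem_erase] at h
    refine ⟨fun z hz e => h z ⟨e, hz⟩ ▸ hN.1 z hz e, hA (fun z hz => ?_) hN.2⟩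
    by_cases e : z = y
    · simp [e]
    · simpa [e] using h z ⟨e, hz⟩

lemma noCapture_var (A : Formula L) : A.NoCapture Term.var := by
  induction A with
  | atom v P ts => trivial
  | tensor v A B hA hB | par v A B hA hB => exact ⟨hA, hB⟩
  | all v y A hA | ex v y A hA =>
    refine ⟨fun z _ e => by simpa using e.symm, by simpa using hA⟩

lemma boundVars_inst : (A.inst τ).boundVars = A.boundVars := by
  induction A generalizing τ with
  | atom v P ts => rfl
  | tensor v A B hA hB | par v A B hA hB => simp [inst, boundVars, hA, hB]
  | all v y A hA | ex v y A hA => simp [inst, boundVars, hA]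

lemma exists_of_mem_freeVars_inst (hy : y ∈ (A.inst τ).freeVars) :
    ∃ z ∈ A.freeVars, y ∈ (τ z).varFinset := by
  induction A generalizing τ with
  | atom v P ts =>
    simp only [inst, freeVars, Finset.mem_biUnion, Finset.mem_univ, true_and,
      mem_varFinset_subst] at hy ⊢
    grind
  | tensor v A B hA hB | par v A B hA hB =>
    simp only [inst, freeVars, Finset.mem_union] at hy ⊢
    grind
  | all v x A hA | ex v x A hA =>
    simp only [inst, freeVars, Finset.mem_erase] at hy ⊢
    obtain ⟨z, hz, h⟩ := hA hy.2
    by_cases e : z = x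
    · subst e
      simp [hy.1] at h
    · exact ⟨z, ⟨e, hz⟩, by simpa [e] using h⟩

/-- Without `NoCapture`, a quantifier between the root and the occurrence of `z` could bind `y`. -/
lemma mem_freeVars_inst (hN : A.NoCapture τ) {z : ℕ} (hz : z ∈ A.freeVars)
    (hy : y ∈ (τ z).varFinset) : y ∈ (A.inst τ).freeVars := by
  induction A generalizing τ with
  | atom v P ts =>
    simp only [inst, freeVars, Finset.mem_biUnion, Finset.mem_univ, true_and,
      mem_varFinset_subst] at hz ⊢
    obtain ⟨i, hi⟩ := hz
    exact ⟨i, z, hi, hy⟩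
  | tensor v A B hA hB | par v A B hA hB =>
    simp only [inst, freeVars, Finset.mem_union] at hz ⊢
    exact hz.imp (hA hN.1 · hy) (hB hN.2 · hy)
  | all v x A hA | ex v x A hA =>
    simp only [inst, freeVars, Finset.mem_erase] at hz ⊢
    refine ⟨fun e => hN.1 z hz.2 hz.1 (e ▸ hy), hA hN.2 hz.2 (by simpa [hz.1] using hy)⟩

/-- The premise of an ∃ rule substitutes a witness into an instance that has been built up so far;
this absorbs it into the accumulated substitution. Since no quantifier rebinds `x`, the shadowing
test in `Formula.subst` never applies. -/
lemma subst_inst (hx : x ∉ A.boundVars)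
    (h : ∀ z ∈ A.freeVars, (σ z).subst (single x t) = τ z) :
    (A.inst σ).subst x t = A.inst τ := by
  induction A generalizing σ τ with
  | atom v P ts =>
    simp only [inst, subst, atom.injEq, heq_eq_eq, true_and, subst_subst]
    exact funext fun i => subst_congr fun z hz =>
      h z (Finset.mem_biUnion.2 ⟨i, Finset.mem_univ i, hz⟩)
  | tensor v A B hA hB | par v A B hA hB =>
    simp only [boundVars, Multiset.mem_add, not_or] at hx
    simp only [freeVars, Finset.mem_union] at h
    simp only [inst, subst]
    rw [hA hx.1 fun z hz => h z (.inl hz), hB hx.2 fun z hz => h z (.inr hz)]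
  | all v y A hA | ex v y A hA =>
    simp only [boundVars, Multiset.mem_cons, not_or] at hx
    simp only [freeVars, Finset.mem_erase] at h
    simp only [inst, subst, if_neg (Ne.symm hx.1)]
    rw [hA hx.2]
    intro z hz
    by_cases e : z = y
    · subst e
      simp [Term.subst, single, Ne.symm hx.1]
    · simpa [e] using h z ⟨e, hz⟩

lemma noCapture_update (hx : x ∉ A.boundVars) (hτ : τ x = Term.var x) (hN : A.NoCapture τ)
    (h : (A.inst τ).FreeFor x t) : A.NoCapture (Function.update τ x t) := by
  induction A generalizing τ with
  | atom v P ts => trivial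
  | tensor v A B hA hB | par v A B hA hB =>
    simp only [boundVars, Multiset.mem_add, not_or] at hx
    exact ⟨hA hx.1 hτ hN.1 h.1, hB hx.2 hτ hN.2 h.2⟩
  | all v y A hA | ex v y A hA =>
    simp only [boundVars, Multiset.mem_cons, not_or] at hx
    have hτ' : Function.update τ y (Term.var y) x = Term.var x := by simp [hx.1, hτ]
    -- `FreeFor` constrains a quantifier only if `x` is free below it. Otherwise changing the value
    -- at `x` is invisible and the old `NoCapture` carries over.
    by_cases hf : x ∈ A.freeVars
    · have h1 := h (Finset.mem_erase.2 ⟨hx.1, mem_freeVars_inst hN.2 hf (by simp [hτ'])⟩)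
      refine ⟨fun z hz e => ?_, ?_⟩
      · by_cases e' : z = x
        · subst e'
          simpa using h1.1
        · simpa [e'] using hN.1 z hz e
      · rw [Function.update_comm hx.1]
        exact hA hx.2 hτ' hN.2 h1.2
    · refine noCapture_congr (σ := τ) (fun z hz => ?_) hN
      have : z ≠ x := by
        rintro rfl
        exact hf (Finset.mem_of_mem_erase hz)
      simp [this]

lemma freeFor_of_disjoint (h : ∀ y ∈ A.boundVars, y ∉ t.varFinset) : A.FreeFor x t := by
  induction A with
  | atom v P ts => trivial
  | tensor v A B hA hB | par v A B hA hB =>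
    simp only [boundVars, Multiset.mem_add] at h
    exact ⟨hA fun y hy => h y (.inl hy), hB fun y hy => h y (.inr hy)⟩
  | all v y A hA | ex v y A hA =>
    simp only [boundVars, Multiset.mem_cons] at h
    exact fun _ => ⟨h y (.inl rfl), hA fun y hy => h y (.inr hy)⟩

lemma freeFor_of_notMem (hN : x ∉ A.freeVars) (hx : x ∉ A.boundVars) : A.FreeFor x t := by
  induction A with
  | atom v P ts => trivial
  | tensor v A B hA hB | par v A B hA hB =>
    simp only [boundVars, Multiset.mem_add, not_or] at hx
    simp only [freeVars, Finset.mem_union, not_or] at hN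
    exact ⟨hA hN.1 hx.1, hB hN.2 hx.2⟩
  | all v y A _ | ex v y A _ => exact fun h => absurd h hN

end Formula

/-! ### Proof skeletons -/

/-- The one-premise rule `r` infers `F, Γ` from `P, Γ`; the witness at the vertex `v` is `w v`. -/
inductive Introduces (w : ℕ → L.Term ℕ) : UnaryRule L → Formula L → Sequent L → Prop
  | par (v : ℕ) (A B : Formula L) : Introduces w (.par v) (.par v A B) (A ::ₘ B ::ₘ 0)
  | all (v x : ℕ) (A : Formula L) : Introduces w (.all v) (.all v x A) (A ::ₘ 0)
  | ex (v x : ℕ) (A : Formula L) : Introduces w (.ex v (w v)) (.ex v x A) (A ::ₘ 0)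

/-- `d` is a derivation of `Γ` up to the terms in the leaves: the witnesses, which are given
by `w`, are not substituted, and in place of the conditions on the variables of the `∀` rules
it is required that every source of an edge of `E` into `b` is above the rule of `b`. -/
inductive Skeleton (D : Duality L) (E : ℕ → ℕ → Prop) (w : ℕ → L.Term ℕ) :
    Deriv L → Sequent L → Prop
  | ax (l l' : ℕ) {n : ℕ} (P : L.Relations n) (ts ts' : Fin n → L.Term ℕ) :
      (∀ a, ¬ E a l) → (∀ a, ¬ E a l') →
      Skeleton D E w (.ax s(l, l')) {Formula.atom l P ts, Formula.atom l' (D.dual P) ts'}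
  | tensor (v : ℕ) (A B : Formula L) (Γ Δ : Sequent L) (d e : Deriv L) :
      (∀ a, ¬ E a v) → Skeleton D E w d (A ::ₘ Γ) → Skeleton D E w e (B ::ₘ Δ) →
      Skeleton D E w (.tensor v d e) (Formula.tensor v A B ::ₘ (Γ + Δ))
  | unary (r : UnaryRule L) (F : Formula L) (P Γ : Sequent L) (d : Deriv L) :
      Introduces w r F P → (∀ a, E a F.vertex → a ∈ vertices (P + Γ)) →
      Skeleton D E w d (P + Γ) → Skeleton D E w (.unary r d) (F ::ₘ Γ)

section Skeleton

variable {D : Duality L} {E : ℕ → ℕ → Prop} {w : ℕ → L.Term ℕ} {r r' : UnaryRule L}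
  {F G A B C : Formula L} {P P' Γ Δ : Sequent L} {d e : Deriv L} {u v : ℕ} {S T : Set ℕ}

namespace Introduces

lemma unique (h : Introduces w r F P) (h' : Introduces w r' F P') : r = r' ∧ P = P' := by
  cases h <;> cases h' <;> exact ⟨rfl, rfl⟩

lemma nodes_cons (h : Introduces w r F P) : nodes (F ::ₘ Γ) = F ::ₘ nodes (P + Γ) := by
  cases h <;> simp only [nodes_par_cons, nodes_all_cons, nodes_ex_cons, Multiset.cons_add, zero_add]

lemma mem_vertexSet (h : Introduces w r F P) :
    u ∈ F.vertexSet ↔ u = F.vertex ∨ u ∈ vertices P := by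
  cases h <;> simp [Formula.vertex]

lemma mem_vertices_cons (h : Introduces w r F P) :
    u ∈ vertices (F ::ₘ Γ) ↔ u = F.vertex ∨ u ∈ vertices (P + Γ) := by
  rw [MLL1.mem_vertices_cons, h.mem_vertexSet, mem_vertices_add, or_assoc]

lemma isForest (h : Introduces w r F P) (hF : IsForest (F ::ₘ Γ)) :
    F.vertex ∉ vertices (P + Γ) ∧ IsForest (P + Γ) := hF.of_cons_nodes h.nodes_cons

lemma ne_atom (h : Introduces w r F P) {l n : ℕ} {Q : L.Relations n} {ts : Fin n → L.Term ℕ} :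
    F ≠ .atom l Q ts := by
  cases h <;> simp

lemma ne_tensor (h : Introduces w r F P) : F ≠ .tensor v A B := by
  cases h <;> simp

lemma vertexSet_subset (h : Introduces w r F P) (hC : C ∈ P) : C.vertexSet ⊆ F.vertexSet :=
  fun _ hu => h.mem_vertexSet.2 (.inr (mem_vertices_of_mem hC hu))

lemma exists_mem (h : Introduces w r F P) : ∃ C, C ∈ P := by
  cases h <;> exact ⟨_, Multiset.mem_cons_self _ _⟩

end Introduces

namespace Skeleton

lemma tensor_of_eq (h : Γ = .tensor v A B ::ₘ (P + P')) (hv : ∀ a, ¬ E a v)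
    (hd : Skeleton D E w d (A ::ₘ P)) (he : Skeleton D E w e (B ::ₘ P')) :
    Skeleton D E w (.tensor v d e) Γ := h ▸ .tensor v A B P P' d e hv hd he

lemma mem_vertices_of_links (h : Skeleton D E w d Γ) {s : Sym2 ℕ} (hs : s ∈ d.links) {l : ℕ}
    (hl : l ∈ s) : l ∈ vertices Γ := by
  induction h with
  | ax l₁ l₂ Q ts ts' =>
    simp only [Deriv.links, Set.mem_singleton_iff] at hs
    subst hs
    simpa [vertices, nodes, Formula.nodes, Formula.vertex, eq_comm] using hl
  | tensor v A B Γ Δ d e _ _ _ ihd ihe =>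
    have := hs.imp ihd ihe
    simp only [mem_vertices_cons, mem_vertices_add, mem_vertexSet_tensor] at this ⊢
    tauto
  | unary r F P Γ d hr _ _ ih => exact hr.mem_vertices_cons.2 (.inr (ih hs))

/-- Since the source of an edge lies above the rule of its target, each sequent of a skeleton is
closed under passing from targets to sources. In particular no edge crosses between the premises of
a tensor rule. -/
lemma mem_vertices_of_leap (h : Skeleton D E w d Γ) {a b : ℕ} (hE : E a b)
    (hb : b ∈ vertices Γ) : a ∈ vertices Γ := by
  induction h with
  | ax l₁ l₂ Q ts ts' h₁ h₂ =>
    obtain rfl | rfl : b = l₁ ∨ b = l₂ := by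
      simpa [vertices, nodes, Formula.nodes, Formula.vertex, eq_comm] using hb
    exacts [absurd hE (h₁ a), absurd hE (h₂ a)]
  | tensor v A B Γ Δ d e hv _ _ ihd ihe =>
    have hne : b ≠ v := fun e => hv a (e ▸ hE)
    simp only [mem_vertices_cons, mem_vertices_add, mem_vertexSet_tensor] at hb ihd ihe ⊢
    tauto
  | unary r F P Γ d hr ha _ ih =>
    refine hr.mem_vertices_cons.2 (.inr ?_)
    obtain rfl | hb := hr.mem_vertices_cons.1 hb
    exacts [ha a hE, ih hb]

/-- The formulas of a derivable sequent are connected by the links. -/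
lemma forall_subset_or (h : Skeleton D E w d Γ) (hST : ∀ u ∈ S, u ∉ T)
    (hlinks : ∀ s ∈ d.links, (∀ l ∈ s, l ∈ S) ∨ ∀ l ∈ s, l ∈ T)
    (hΓ : ∀ F ∈ Γ, F.vertexSet ⊆ S ∨ F.vertexSet ⊆ T) :
    (∀ F ∈ Γ, F.vertexSet ⊆ S) ∨ ∀ F ∈ Γ, F.vertexSet ⊆ T := by
  induction h with
  | ax l₁ l₂ Q ts ts' =>
    simp only [Deriv.links, Set.mem_singleton_iff, forall_eq, Sym2.mem_iff, forall_eq_or_imp]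
      at hlinks
    simp only [Multiset.insert_eq_cons, Multiset.mem_cons, Multiset.mem_singleton,
      forall_eq_or_imp, forall_eq, Set.subset_def, mem_vertexSet_atom]
    exact hlinks
  | tensor v A B Γ Δ d e _ _ _ ihd ihe =>
    simp only [Multiset.mem_cons, Multiset.mem_add, forall_eq_or_imp] at hΓ ihd ihe ⊢
    obtain ⟨hF, hΓ⟩ := hΓ
    have hA : A.vertexSet ⊆ (Formula.tensor v A B).vertexSet := fun u hu => by simp [hu]
    have hB : B.vertexSet ⊆ (Formula.tensor v A B).vertexSet := fun u hu => by simp [hu]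
    have ihd := ihd (fun s hs => hlinks s (.inl hs))
      ⟨hF.imp hA.trans hA.trans, fun F hF => hΓ F (.inl hF)⟩
    have ihe := ihe (fun s hs => hlinks s (.inr hs))
      ⟨hF.imp hB.trans hB.trans, fun F hF => hΓ F (.inr hF)⟩
    -- The side containing the tensor contains `A` and `B`, which drag the contexts of both premises
    -- along; the opposite side would then meet it in the root of `A` or of `B`.
    rcases hF with hF | hF
    · refine .inl ⟨hF, ?_⟩
      rcases ihd with ihd | ihd
      · rcases ihe with ihe | ihe
        · rintro C (hC | hC)
          exacts [ihd.2 C hC, ihe.2 C hC]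
        · exact absurd (ihe.1 B.vertex_mem) (hST _ (hF (hB B.vertex_mem)))
      · exact absurd (ihd.1 A.vertex_mem) (hST _ (hF (hA A.vertex_mem)))
    · refine .inr ⟨hF, ?_⟩
      rcases ihd with ihd | ihd
      · exact absurd (hF (hA A.vertex_mem)) (hST _ (ihd.1 A.vertex_mem))
      · rcases ihe with ihe | ihe
        · exact absurd (hF (hB B.vertex_mem)) (hST _ (ihe.1 B.vertex_mem))
        · rintro C (hC | hC)
          exacts [ihd.2 C hC, ihe.2 C hC]
  | unary r F P Γ d hr _ _ ih =>
    simp only [Multiset.mem_cons, Multiset.mem_add, forall_eq_or_imp] at hΓ ih ⊢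
    obtain ⟨hF, hΓ⟩ := hΓ
    have ih := ih hlinks (by
      rintro C (hC | hC)
      exacts [hF.imp (hr.vertexSet_subset hC).trans (hr.vertexSet_subset hC).trans, hΓ C hC])
    obtain ⟨C, hC⟩ := hr.exists_mem
    have hCF := hr.vertexSet_subset hC C.vertex_mem
    rcases hF with hF | hF
    · refine .inl ⟨hF, ?_⟩
      rcases ih with ih | ih
      · exact fun G hG => ih G (.inr hG)
      · exact absurd (ih C (.inl hC) C.vertex_mem) (hST _ (hF hCF))
    · refine .inr ⟨hF, ?_⟩
      rcases ih with ih | ih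
      · exact absurd (hF hCF) (hST _ (ih C (.inl hC) C.vertex_mem))
      · exact fun G hG => ih G (.inr hG)

end Skeleton

/-! ### Commutations of skeletons -/

lemma Commutes.links_eq {d e : Deriv L} (h : Commutes d e) : d.links = e.links := by
  induction h with
  | unary_unary | unary_tensor_left | unary_tensor_right => rfl
  | tensor_left_left => exact Set.union_right_comm _ _ _
  | tensor_left_right => exact Set.union_assoc _ _ _
  | tensor_right_right => exact Set.union_left_comm _ _ _
  | congr_unary r _ ih => exact ih
  | congr_tensor_left v e _ ih => simp only [Deriv.links, ih]
  | congr_tensor_right v d _ ih => simp only [Deriv.links, ih]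

/-- The equivalence relation on the skeletons over `Γ` generated by the rule commutations. -/
def Convertible (D : Duality L) (E : ℕ → ℕ → Prop) (w : ℕ → L.Term ℕ) (Γ : Sequent L) :
    Deriv L → Deriv L → Prop :=
  Relation.EqvGen fun d e => Skeleton D E w d Γ ∧ Skeleton D E w e Γ ∧ Commutes d e

namespace Convertible

variable {d' d₁ d₂ : Deriv L}

lemma refl (d : Deriv L) : Convertible D E w Γ d d := Relation.EqvGen.refl d

lemma symm (h : Convertible D E w Γ d e) : Convertible D E w Γ e d := Relation.EqvGen.symm _ _ h

lemma trans (h : Convertible D E w Γ d d') (h' : Convertible D E w Γ d' e) :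
    Convertible D E w Γ d e := Relation.EqvGen.trans _ _ _ h h'

lemma of_commutes (hd : Skeleton D E w d Γ) (he : Skeleton D E w e Γ) (h : Commutes d e) :
    Convertible D E w Γ d e := Relation.EqvGen.rel _ _ ⟨hd, he, h⟩

lemma links_eq (h : Convertible D E w Γ d e) : d.links = e.links := by
  induction h with
  | rel _ _ h => exact h.2.2.links_eq
  | refl => rfl
  | symm _ _ _ ih => exact ih.symm
  | trans _ _ _ _ _ ih ih' => exact ih.trans ih'

lemma skeleton_iff (h : Convertible D E w Γ d e) :
    Skeleton D E w d Γ ↔ Skeleton D E w e Γ := by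
  induction h with
  | rel _ _ h => exact iff_of_true h.1 h.2.1
  | refl => rfl
  | symm _ _ _ ih => exact ih.symm
  | trans _ _ _ _ _ ih ih' => exact ih.trans ih'

lemma map {f : Deriv L → Deriv L} (hf : ∀ d, Skeleton D E w d Γ → Skeleton D E w (f d) Δ)
    (hc : ∀ d e, Commutes d e → Commutes (f d) (f e)) (h : Convertible D E w Γ d e) :
    Convertible D E w Δ (f d) (f e) := by
  induction h with
  | rel _ _ h => exact of_commutes (hf _ h.1) (hf _ h.2.1) (hc _ _ h.2.2)
  | refl => exact refl _
  | symm _ _ _ ih => exact ih.symm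
  | trans _ _ _ _ _ ih ih' => exact ih.trans ih'

end Convertible

/-- Used to recover how a context was divided: formulas that cannot lie in `Δ` for reasons of
vertices are removed from `Γ` one at a time. -/
lemma exists_of_add_eq_add {α : Type*} {P Θ Γ Δ : Multiset α} (h : P + Θ = Γ + Δ)
    (hP : ∀ a ∈ P, a ∉ Δ) : ∃ Γ', Γ = P + Γ' ∧ Θ = Γ' + Δ := by
  induction P using Multiset.induction generalizing Γ with
  | empty => exact ⟨Γ, by simp, by simpa using h⟩
  | cons a P ih =>
    have ha : a ∈ Γ + Δ := h ▸ by simp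
    obtain ⟨Γ₁, rfl⟩ := Multiset.exists_cons_of_mem
      ((Multiset.mem_add.1 ha).resolve_right (hP a (Multiset.mem_cons_self _ _)))
    rw [Multiset.cons_add, Multiset.cons_add, Multiset.cons_inj_right] at h
    obtain ⟨Γ', rfl, h'⟩ := ih h fun b hb => hP b (Multiset.mem_cons_of_mem hb)
    exact ⟨Γ', by simp, h'⟩

/-! ### Moving a rule to the end of a skeleton -/

namespace Skeleton

/-- Every source of an edge into `F` is a vertex of the conclusion, by `mem_vertices_of_leap`, and
it is not `F` itself; so it lies in the premise, as the rule requires. -/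
lemma unary_of_skeleton (h : Skeleton D E w d (F ::ₘ Δ)) (hr : Introduces w r F P)
    (hE : ∀ b ∈ vertices (F ::ₘ Δ), ¬ E F.vertex b) (he : Skeleton D E w e (P + Δ)) :
    Skeleton D E w (.unary r e) (F ::ₘ Δ) := by
  have hF := hr.mem_vertices_cons (Γ := Δ) (u := F.vertex).2 (.inl rfl)
  refine .unary r F P Δ e hr (fun a ha => ?_) he
  refine (hr.mem_vertices_cons.1 (h.mem_vertices_of_leap ha hF)).resolve_left ?_
  rintro rfl
  exact hE _ hF ha

lemma convertible_unary {d₁ d₂ : Deriv L} (h : Skeleton D E w d Γ) (hΓ : Γ = F ::ₘ Δ)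
    (hr : Introduces w r F P) (hE : ∀ b ∈ vertices Γ, ¬ E F.vertex b)
    (hc : Convertible D E w Γ d d₁) (h₂ : Skeleton D E w d₂ (P + Δ))
    (h₁₂ : Commutes d₁ (.unary r d₂) ∨ Commutes (.unary r d₂) d₁) :
    Convertible D E w Γ d (.unary r d₂) := by
  subst hΓ
  have h₁ := hc.skeleton_iff.1 h
  have h₂ := h.unary_of_skeleton hr hE h₂
  refine hc.trans ?_
  rcases h₁₂ with h' | h'
  exacts [.of_commutes h₁ h₂ h', (Convertible.of_commutes h₂ h₁ h').symm]

/-- A one-premise rule can be moved to the end of a skeleton. -/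
lemma exists_convertible_unary (h : Skeleton D E w d Γ) (hr : Introduces w r F P)
    (hΓ : Γ = F ::ₘ Δ) (hE : ∀ b ∈ vertices Γ, ¬ E F.vertex b) :
    ∃ d', Skeleton D E w d' (P + Δ) ∧ Convertible D E w Γ d (.unary r d') := by
  have hΓ' := h
  induction h generalizing Δ with
  | ax l₁ l₂ Q ts ts' =>
    have : F ∈ F ::ₘ Δ := Multiset.mem_cons_self _ _
    rw [← hΓ] at this
    simp only [Multiset.insert_eq_cons, Multiset.mem_cons, Multiset.mem_singleton] at this
    exact (this.elim hr.ne_atom hr.ne_atom).elim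
  | tensor v A B Γ₁ Γ₂ d e hv hd he ihd ihe =>
    rcases Multiset.cons_eq_cons.1 hΓ with ⟨h, -⟩ | ⟨-, Θ, h, rfl⟩
    · exact (hr.ne_tensor h.symm).elim
    · have hmem : F ∈ Γ₁ + Γ₂ := h ▸ Multiset.mem_cons_self _ _
      rcases Multiset.mem_add.1 hmem with hF | hF
      · obtain ⟨Γ₁, rfl⟩ := Multiset.exists_cons_of_mem hF
        rw [Multiset.cons_add, Multiset.cons_inj_right] at h
        subst h
        -- The rule of `F` is brought to the end of the left premise, where `A` counts as context,
        -- and then passes the tensor.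
        obtain ⟨d', h', hc⟩ := ihd (Δ := A ::ₘ Γ₁) (Multiset.cons_swap _ _ _)
          (fun b hb => hE b (by
            simp only [mem_vertices_cons, mem_vertices_add, mem_vertexSet_tensor] at hb ⊢
            tauto)) hd
        rw [Multiset.add_cons] at h'
        have h₁ : Skeleton D E w (.tensor v d' e) (P + .tensor v A B ::ₘ (Γ₁ + Γ₂)) :=
          tensor_of_eq (by rw [Multiset.add_cons, add_assoc]) hv h' he
        exact ⟨_, h₁, hΓ'.convertible_unary hΓ hr hE
          (hc.map (f := fun d => .tensor v d e) (fun d h => .tensor v A B _ Γ₂ d e hv h he)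
            (fun _ _ h => .congr_tensor_left v e h)) h₁ (.inr (.unary_tensor_left r v d' e))⟩
      · obtain ⟨Γ₂, rfl⟩ := Multiset.exists_cons_of_mem hF
        rw [Multiset.add_cons, Multiset.cons_inj_right] at h
        subst h
        obtain ⟨e', h', hc⟩ := ihe (Δ := B ::ₘ Γ₂) (Multiset.cons_swap _ _ _)
          (fun b hb => hE b (by
            simp only [mem_vertices_cons, mem_vertices_add, mem_vertexSet_tensor] at hb ⊢
            tauto)) he
        rw [Multiset.add_cons] at h'
        have h₁ : Skeleton D E w (.tensor v d e') (P + .tensor v A B ::ₘ (Γ₁ + Γ₂)) :=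
          tensor_of_eq (by rw [Multiset.add_cons, add_left_comm]) hv hd h'
        exact ⟨_, h₁, hΓ'.convertible_unary hΓ hr hE
          (hc.map (f := fun e => .tensor v d e) (fun e h => .tensor v A B Γ₁ _ d e hv hd h)
            (fun _ _ h => .congr_tensor_right v d h)) h₁ (.inr (.unary_tensor_right r v d e'))⟩
  | unary r₀ F₀ P₀ Γ₀ d hr₀ hv hd ih =>
    rcases Multiset.cons_eq_cons.1 hΓ with ⟨rfl, rfl⟩ | ⟨-, Θ, rfl, rfl⟩
    · obtain ⟨rfl, rfl⟩ := hr.unique hr₀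
      exact ⟨d, hd, .refl _⟩
    · obtain ⟨d', h', hc⟩ := ih (Δ := P₀ + Θ) (Multiset.add_cons _ _ _)
        (fun b hb => hE b (hr₀.mem_vertices_cons.2 (.inr hb))) hd
      have h₁ : Skeleton D E w (.unary r₀ d') (P + F₀ ::ₘ Θ) := by
        rw [Multiset.add_cons]
        refine .unary r₀ F₀ P₀ _ d' hr₀ (fun a ha => ?_) (by rwa [add_left_comm])
        -- This is where `hE` matters: no edge leads from `F` to `F₀`, so the sources of edges into
        -- `F₀` stay above its rule when the rule of `F` moves below it.
        have hne : a ≠ F.vertex := by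
          rintro rfl
          exact hE _ (hr₀.mem_vertices_cons.2 (.inl rfl)) ha
        have := hv a ha
        simp only [mem_vertices_add, mem_vertices_cons, hr.mem_vertexSet, hne, false_or] at this ⊢
        exact this
      exact ⟨_, h₁, hΓ'.convertible_unary hΓ hr hE
        (hc.map (f := fun d => .unary r₀ d) (fun d h => .unary r₀ F₀ P₀ _ d hr₀ hv h)
          (fun _ _ h => .congr_unary r₀ h)) h₁ (.inl (.unary_unary r₀ r d'))⟩

/-- A tensor rule can be moved to the end of a skeleton, if the other formulas, the links and
`E` can be split accordingly. -/
lemma exists_convertible_tensor (h : Skeleton D E w d Γ) (hΓ : Γ = .tensor v A B ::ₘ Δ)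
    (hST : ∀ u ∈ S, u ∉ T) (hA : A.vertexSet ⊆ S) (hB : B.vertexSet ⊆ T) (hvS : v ∉ S) (hvT : v ∉ T)
    (hΔ : ∀ F ∈ Δ, F.vertexSet ⊆ S ∨ F.vertexSet ⊆ T)
    (hlinks : ∀ s ∈ d.links, (∀ l ∈ s, l ∈ S) ∨ ∀ l ∈ s, l ∈ T)
    (hE : ∀ a b, E a b → b ≠ v ∧ (b ∈ S → a ∈ S) ∧ (b ∈ T → a ∈ T)) :
    ∃ Γ₁ Γ₂ d₁ d₂, Δ = Γ₁ + Γ₂ ∧ Skeleton D E w d₁ (A ::ₘ Γ₁) ∧ Skeleton D E w d₂ (B ::ₘ Γ₂) ∧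
      (∀ F ∈ Γ₁, F.vertexSet ⊆ S) ∧ (∀ F ∈ Γ₂, F.vertexSet ⊆ T) ∧
      Convertible D E w Γ d (.tensor v d₁ d₂) := by
  have hv : ∀ a, ¬ E a v := fun a ha => (hE a v ha).1 rfl
  have hne : ∀ {F : Formula L}, F.vertexSet ⊆ S → F.vertexSet ⊆ T → False :=
    fun h h' => hST _ (h (Formula.vertex_mem _)) (h' (Formula.vertex_mem _))
  have hΓ' := h
  induction h generalizing Δ with
  | ax l₁ l₂ Q ts ts' =>
    have : Formula.tensor v A B ∈ Formula.tensor v A B ::ₘ Δ := Multiset.mem_cons_self _ _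
    rw [← hΓ] at this
    simp at this
  | tensor u C G Γ₁ Γ₂ d e hu hd he ihd ihe =>
    have hlinksd : ∀ s ∈ d.links, _ := fun s hs => hlinks s (.inl hs)
    have hlinkse : ∀ s ∈ e.links, _ := fun s hs => hlinks s (.inr hs)
    rcases Multiset.cons_eq_cons.1 hΓ with ⟨h, rfl⟩ | ⟨-, Θ, h, rfl⟩
    · obtain ⟨rfl, rfl, rfl⟩ := Formula.tensor.inj h
      refine ⟨Γ₁, Γ₂, d, e, rfl, hd, he, ?_, ?_, .refl _⟩
      -- The tensor rule is already last. Connectedness through the links forces the context of each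
      -- premise to the side of `A` or of `B`.
      · have := hd.forall_subset_or hST hlinksd (by
          rintro F hF
          rcases Multiset.mem_cons.1 hF with rfl | hF
          exacts [.inl hA, hΔ F (Multiset.mem_add.2 (.inl hF))])
        rcases this with h | h
        · exact fun F hF => h F (Multiset.mem_cons_of_mem hF)
        · exact (hne hA (h _ (Multiset.mem_cons_self _ _))).elim
      · have := he.forall_subset_or hST hlinkse (by
          rintro F hF
          rcases Multiset.mem_cons.1 hF with rfl | hF
          exacts [.inr hB, hΔ F (Multiset.mem_add.2 (.inr hF))])
        rcases this with h | h
        · exact (hne (h _ (Multiset.mem_cons_self _ _)) hB).elim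
        · exact fun F hF => h F (Multiset.mem_cons_of_mem hF)
    · have hmem : Formula.tensor v A B ∈ Γ₁ + Γ₂ := h ▸ Multiset.mem_cons_self _ _
      have hF₀ := hΔ _ (Multiset.mem_cons_self _ _)
      have hCF : C.vertexSet ⊆ (Formula.tensor u C G).vertexSet := fun u hu => by simp [hu]
      have hGF : G.vertexSet ⊆ (Formula.tensor u C G).vertexSet := fun u hu => by simp [hu]
      rcases Multiset.mem_add.1 hmem with hF | hF
      · obtain ⟨Γ₁, rfl⟩ := Multiset.exists_cons_of_mem hF
        rw [Multiset.cons_add, Multiset.cons_inj_right] at h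
        subst h
        obtain ⟨Γa, Γb, da, db, h, h₁, h₂, hS, hT, hc⟩ := ihd (Δ := C ::ₘ Γ₁)
          (Multiset.cons_swap _ _ _) (by
            intro F hF
            rcases Multiset.mem_cons.1 hF with rfl | hF
            exacts [hF₀.imp hCF.trans hCF.trans, hΔ F (by simp [hF])]) hlinksd hd
        replace hc := hc.map (f := fun d => .tensor u d e)
          (fun d h => .tensor u C G _ Γ₂ d e hu h he) (fun _ _ h => .congr_tensor_left u e h)
        rcases hF₀ with hF₀ | hF₀
        -- The premise of `G` is not touched by the splitting, so by connectedness it lies entirely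
        -- on the side of the tensor at `u`.
        · have hO : ∀ F ∈ Γ₂, F.vertexSet ⊆ S := by
            have := he.forall_subset_or hST hlinkse (by
              intro F hF
              rcases Multiset.mem_cons.1 hF with rfl | hF
              exacts [.inl (hGF.trans hF₀), hΔ F (by simp [hF])])
            rcases this with h | h
            · exact fun F hF => h F (Multiset.mem_cons_of_mem hF)
            · exact (hne (hGF.trans hF₀) (h _ (Multiset.mem_cons_self _ _))).elim
          -- `C` must have gone to the premise of `A`, since the other premise consists of formulas
          -- with vertices in `T`.
          obtain ⟨Γa, rfl, rfl⟩ := exists_of_add_eq_add (P := {C}) (Θ := Γ₁)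
            (by rw [← h, Multiset.singleton_add])
            (by
              rintro F hF hF'
              rw [Multiset.mem_singleton.1 hF] at hF'
              exact hne (hCF.trans hF₀) (hT _ hF'))
          rw [Multiset.singleton_add, Multiset.cons_swap] at h₁
          have h₁' : Skeleton D E w (.tensor u da e) (A ::ₘ .tensor u C G ::ₘ (Γa + Γ₂)) :=
            tensor_of_eq (by rw [Multiset.cons_swap, Multiset.cons_add]) hu h₁ he
          refine ⟨_, Γb, _, db, ?_, h₁', h₂, ?_, hT, hc.trans (.of_commutes (hc.skeleton_iff.1 hΓ')
            (tensor_of_eq ?_ hv h₁' h₂) (.tensor_left_left ..))⟩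
          · simp only [Multiset.cons_add]
            congr 1
            abel
          · intro F hF
            rcases Multiset.mem_cons.1 hF with rfl | hF
            · exact hF₀
            · rcases Multiset.mem_add.1 hF with hF | hF
              exacts [hS F (by simp [hF]), hO F hF]
          · rw [hΓ]
            simp only [Multiset.cons_add]
            congr 2
            abel
        · have hO : ∀ F ∈ Γ₂, F.vertexSet ⊆ T := by
            have := he.forall_subset_or hST hlinkse (by
              intro F hF
              rcases Multiset.mem_cons.1 hF with rfl | hF
              exacts [.inr (hGF.trans hF₀), hΔ F (by simp [hF])])
            rcases this with h | h
            · exact (hne (h _ (Multiset.mem_cons_self _ _)) (hGF.trans hF₀)).elim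
            · exact fun F hF => h F (Multiset.mem_cons_of_mem hF)
          obtain ⟨Γc, rfl, rfl⟩ := exists_of_add_eq_add (P := {C}) (Θ := Γ₁) (Γ := Γb) (Δ := Γa)
            (by rw [add_comm Γb, ← h, Multiset.singleton_add])
            (by
              rintro F hF hF'
              rw [Multiset.mem_singleton.1 hF] at hF'
              exact hne (hS _ hF') (hCF.trans hF₀))
          rw [Multiset.singleton_add, Multiset.cons_swap] at h₂
          have h₂' : Skeleton D E w (.tensor u db e) (B ::ₘ .tensor u C G ::ₘ (Γc + Γ₂)) :=
            tensor_of_eq (by rw [Multiset.cons_swap, Multiset.cons_add]) hu h₂ he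
          refine ⟨Γa, _, da, _, ?_, h₁, h₂', hS, ?_, hc.trans (.of_commutes (hc.skeleton_iff.1 hΓ')
            (tensor_of_eq ?_ hv h₁ h₂') (.tensor_left_right ..))⟩
          · simp only [Multiset.add_cons]
            congr 1
            abel
          · intro F hF
            rcases Multiset.mem_cons.1 hF with rfl | hF
            · exact hF₀
            · rcases Multiset.mem_add.1 hF with hF | hF
              exacts [hT F (by simp [hF]), hO F hF]
          · rw [hΓ]
            simp only [Multiset.add_cons]
            congr 2
            abel
      · obtain ⟨Γ₂, rfl⟩ := Multiset.exists_cons_of_mem hF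
        rw [Multiset.add_cons, Multiset.cons_inj_right] at h
        subst h
        obtain ⟨Γa, Γb, da, db, h, h₁, h₂, hS, hT, hc⟩ := ihe (Δ := G ::ₘ Γ₂)
          (Multiset.cons_swap _ _ _) (by
            intro F hF
            rcases Multiset.mem_cons.1 hF with rfl | hF
            exacts [hF₀.imp hGF.trans hGF.trans, hΔ F (by simp [hF])]) hlinkse he
        replace hc := hc.map (f := fun e => .tensor u d e)
          (fun e h => .tensor u C G Γ₁ _ d e hu hd h) (fun _ _ h => .congr_tensor_right u d h)
        rcases hF₀ with hF₀ | hF₀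
        · have hO : ∀ F ∈ Γ₁, F.vertexSet ⊆ S := by
            have := hd.forall_subset_or hST hlinksd (by
              intro F hF
              rcases Multiset.mem_cons.1 hF with rfl | hF
              exacts [.inl (hCF.trans hF₀), hΔ F (by simp [hF])])
            rcases this with h | h
            · exact fun F hF => h F (Multiset.mem_cons_of_mem hF)
            · exact (hne (hCF.trans hF₀) (h _ (Multiset.mem_cons_self _ _))).elim
          obtain ⟨Γa, rfl, rfl⟩ := exists_of_add_eq_add (P := {G}) (Θ := Γ₂)
            (by rw [← h, Multiset.singleton_add])
            (by
              rintro F hF hF'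
              rw [Multiset.mem_singleton.1 hF] at hF'
              exact hne (hGF.trans hF₀) (hT _ hF'))
          rw [Multiset.singleton_add, Multiset.cons_swap] at h₁
          have h₁' : Skeleton D E w (.tensor u d da) (A ::ₘ .tensor u C G ::ₘ (Γ₁ + Γa)) :=
            tensor_of_eq (by rw [Multiset.cons_swap, Multiset.add_cons]) hu hd h₁
          -- This exchange is the associativity rewrite `tensor_left_right` read backwards, hence
          -- the `symm`.
          refine ⟨_, Γb, _, db, ?_, h₁', h₂, ?_, hT, hc.trans (Convertible.of_commutes
            (tensor_of_eq ?_ hv h₁' h₂) (hc.skeleton_iff.1 hΓ') (.tensor_left_right ..)).symm⟩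
          · simp only [Multiset.cons_add]
            congr 1
            abel
          · intro F hF
            rcases Multiset.mem_cons.1 hF with rfl | hF
            · exact hF₀
            · rcases Multiset.mem_add.1 hF with hF | hF
              exacts [hO F hF, hS F (by simp [hF])]
          · rw [hΓ]
            simp only [Multiset.cons_add]
            congr 2
            abel
        · have hO : ∀ F ∈ Γ₁, F.vertexSet ⊆ T := by
            have := hd.forall_subset_or hST hlinksd (by
              intro F hF
              rcases Multiset.mem_cons.1 hF with rfl | hF
              exacts [.inr (hCF.trans hF₀), hΔ F (by simp [hF])])
            rcases this with h | h
            · exact (hne (h _ (Multiset.mem_cons_self _ _)) (hCF.trans hF₀)).elim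
            · exact fun F hF => h F (Multiset.mem_cons_of_mem hF)
          obtain ⟨Γc, rfl, rfl⟩ := exists_of_add_eq_add (P := {G}) (Θ := Γ₂) (Γ := Γb) (Δ := Γa)
            (by rw [add_comm Γb, ← h, Multiset.singleton_add])
            (by
              rintro F hF hF'
              rw [Multiset.mem_singleton.1 hF] at hF'
              exact hne (hS _ hF') (hGF.trans hF₀))
          rw [Multiset.singleton_add, Multiset.cons_swap] at h₂
          have h₂' : Skeleton D E w (.tensor u d db) (B ::ₘ .tensor u C G ::ₘ (Γ₁ + Γc)) :=
            tensor_of_eq (by rw [Multiset.cons_swap, Multiset.add_cons]) hu hd h₂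
          refine ⟨Γa, _, da, _, ?_, h₁, h₂', hS, ?_, hc.trans (.of_commutes (hc.skeleton_iff.1 hΓ')
            (tensor_of_eq ?_ hv h₁ h₂') (.tensor_right_right ..))⟩
          · simp only [Multiset.add_cons]
            congr 1
            abel
          · intro F hF
            rcases Multiset.mem_cons.1 hF with rfl | hF
            · exact hF₀
            · rcases Multiset.mem_add.1 hF with hF | hF
              exacts [hO F hF, hT F (by simp [hF])]
          · rw [hΓ]
            simp only [Multiset.add_cons]
            congr 2
            abel
  | unary r₀ F₀ P₀ Γ₀ d hr₀ hu hd ih =>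
    rcases Multiset.cons_eq_cons.1 hΓ with ⟨h, -⟩ | ⟨-, Θ, rfl, rfl⟩
    · exact (hr₀.ne_tensor h).elim
    · have hF₀ := hΔ F₀ (Multiset.mem_cons_self _ _)
      obtain ⟨Γ₁, Γ₂, d₁, d₂, h, h₁, h₂, hS, hT, hc⟩ := ih (Δ := P₀ + Θ) (Multiset.add_cons _ _ _)
        (by
          intro F hF
          rcases Multiset.mem_add.1 hF with hF | hF
          · exact hF₀.imp (hr₀.vertexSet_subset hF).trans (hr₀.vertexSet_subset hF).trans
          · exact hΔ F (Multiset.mem_cons_of_mem hF)) hlinks hd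
      have hc' := hc.map (f := fun d => .unary r₀ d) (fun d h => .unary r₀ F₀ P₀ _ d hr₀ hu h)
        (fun _ _ h => .congr_unary r₀ h)
      rcases hF₀ with hF₀ | hF₀
      · obtain ⟨Γ₁, rfl, rfl⟩ := exists_of_add_eq_add h fun F hF hF' =>
          hne ((hr₀.vertexSet_subset hF).trans hF₀) (hT F hF')
        have hT' : ∀ u, u ∈ vertices Γ₂ → u ∈ T := fun u hu => by
          obtain ⟨F, hF, hu⟩ := mem_vertices_iff.1 hu
          exact hT F hF hu
        have h₁' : Skeleton D E w (.unary r₀ d₁) (A ::ₘ F₀ ::ₘ Γ₁) := by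
          rw [Multiset.cons_swap]
          refine .unary r₀ F₀ P₀ _ d₁ hr₀ (fun a ha => ?_) (by rwa [Multiset.add_cons])
          -- Edges respect the two sides, so the sources needed by the rule of `F₀` are not lost to
          -- the other premise of the tensor.
          have hS' : a ∈ S := (hE a _ ha).2.1 (hF₀ F₀.vertex_mem)
          have ha' := hu a ha
          simp only [mem_vertices_add, mem_vertices_cons, mem_vertexSet_tensor] at ha' ⊢
          have h1 : a ≠ v := fun e => hvS (e ▸ hS')
          have h2 : a ∉ B.vertexSet := fun h => hST a hS' (hB h)
          have h3 : a ∉ vertices Γ₂ := fun h => hST a hS' (hT' a h)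
          tauto
        refine ⟨F₀ ::ₘ Γ₁, Γ₂, _, d₂, by simp, h₁', h₂, ?_, hT, ?_⟩
        · intro F hF
          rcases Multiset.mem_cons.1 hF with rfl | hF
          exacts [hF₀, hS F (Multiset.mem_add.2 (.inr hF))]
        · exact hc'.trans (.of_commutes (hc'.skeleton_iff.1 hΓ')
            (tensor_of_eq (by rw [hΓ]; simp) hv h₁' h₂) (.unary_tensor_left ..))
      · obtain ⟨Γ₂, rfl, rfl⟩ := exists_of_add_eq_add (h.trans (add_comm _ _)) fun F hF hF' =>
          hne (hS F hF') ((hr₀.vertexSet_subset hF).trans hF₀)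
        have hS' : ∀ u, u ∈ vertices Γ₁ → u ∈ S := fun u hu => by
          obtain ⟨F, hF, hu⟩ := mem_vertices_iff.1 hu
          exact hS F hF hu
        have h₂' : Skeleton D E w (.unary r₀ d₂) (B ::ₘ F₀ ::ₘ Γ₂) := by
          rw [Multiset.cons_swap]
          refine .unary r₀ F₀ P₀ _ d₂ hr₀ (fun a ha => ?_) (by rwa [Multiset.add_cons])
          have hT' : a ∈ T := (hE a _ ha).2.2 (hF₀ F₀.vertex_mem)
          have ha' := hu a ha
          simp only [mem_vertices_add, mem_vertices_cons, mem_vertexSet_tensor] at ha' ⊢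
          have h1 : a ≠ v := fun e => hvT (e ▸ hT')
          have h2 : a ∉ A.vertexSet := fun h => hST a (hA h) hT'
          have h3 : a ∉ vertices Γ₁ := fun h => hST a (hS' a h) hT'
          tauto
        refine ⟨Γ₁, F₀ ::ₘ Γ₂, d₁, _, by simp [add_comm], h₁, h₂', hS, ?_, ?_⟩
        · intro F hF
          rcases Multiset.mem_cons.1 hF with rfl | hF
          exacts [hF₀, hT F (Multiset.mem_add.2 (.inr hF))]
        · exact hc'.trans (.of_commutes (hc'.skeleton_iff.1 hΓ')
            (tensor_of_eq (by rw [hΓ]; simp [add_comm]) hv h₁ h₂') (.unary_tensor_right ..))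

/-- Skeletons over a forest with the same links are convertible. -/
theorem convertible (he : Skeleton D E w e Γ) (hΓ : IsForest Γ) (hd : Skeleton D E w d Γ)
    (h : d.links = e.links) : Convertible D E w Γ d e := by
  induction he generalizing d with
  | ax l l' Q ts ts' =>
    generalize hΔ : ({.atom l Q ts, .atom l' (D.dual Q) ts'} : Sequent L) = Δ at hd ⊢
    have hne : ∀ F ∈ Δ, ∃ (k m : ℕ) (R : L.Relations m) (us : Fin m → L.Term ℕ),
        F = .atom k R us := by
      subst hΔ
      simp only [Multiset.insert_eq_cons, Multiset.mem_cons, Multiset.mem_singleton]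
      rintro F (rfl | rfl)
      exacts [⟨_, _, _, _, rfl⟩, ⟨_, _, _, _, rfl⟩]
    cases hd with
    | ax k k' R us us' =>
      simp only [Deriv.links, Set.singleton_eq_singleton_iff] at h
      rw [h]
      exact .refl _
    | tensor v A B =>
      obtain ⟨_, _, _, _, h⟩ := hne _ (Multiset.mem_cons_self _ _)
      cases h
    | unary r F P Γ d hr =>
      obtain ⟨_, _, _, _, h⟩ := hne _ (Multiset.mem_cons_self _ _)
      exact (hr.ne_atom h).elim
  | tensor v A B Γ Δ e₁ e₂ hv he₁ he₂ ih₁ ih₂ =>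
    have hF := hΓ.of_tensor
    -- The two sides are read off from the target derivation `e`: its premises separate the links,
    -- which `d` shares, and the edges.
    obtain ⟨Γ₁, Γ₂, d₁, d₂, hΓΔ, h₁, h₂, hS, hT, hc⟩ := hd.exists_convertible_tensor rfl
      (S := vertices (A ::ₘ Γ)) (T := vertices (B ::ₘ Δ)) hF.disjoint
      (fun u hu => by simp [hu]) (fun u hu => by simp [hu]) hF.notMem_left hF.notMem_right
      (by
        intro F hF
        rcases Multiset.mem_add.1 hF with hF | hF
        · exact .inl fun u hu => mem_vertices_of_mem (Multiset.mem_cons_of_mem hF) hu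
        · exact .inr fun u hu => mem_vertices_of_mem (Multiset.mem_cons_of_mem hF) hu)
      (by
        rw [h]
        rintro s (hs | hs)
        exacts [.inl fun l hl => he₁.mem_vertices_of_links hs hl,
          .inr fun l hl => he₂.mem_vertices_of_links hs hl])
      (fun a b hab => ⟨fun e => hv a (e ▸ hab), he₁.mem_vertices_of_leap hab,
        he₂.mem_vertices_of_leap hab⟩)
    have hΓS : ∀ F ∈ Γ, F.vertexSet ⊆ vertices (A ::ₘ Γ) :=
      fun F hF u hu => mem_vertices_of_mem (Multiset.mem_cons_of_mem hF) hu
    have hΔT : ∀ F ∈ Δ, F.vertexSet ⊆ vertices (B ::ₘ Δ) :=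
      fun F hF u hu => mem_vertices_of_mem (Multiset.mem_cons_of_mem hF) hu
    have hne : ∀ {F : Formula L}, F.vertexSet ⊆ vertices (A ::ₘ Γ) →
        F.vertexSet ⊆ vertices (B ::ₘ Δ) → False :=
      fun h h' => hF.disjoint _ (h (Formula.vertex_mem _)) (h' (Formula.vertex_mem _))
    -- Both divisions of the context follow the same two disjoint vertex sets, so the discrepancy
    -- `Θ` between them is empty.
    obtain ⟨Θ, rfl, rfl⟩ := exists_of_add_eq_add hΓΔ fun F hF hF' => hne (hΓS F hF) (hT F hF')
    obtain rfl : Θ = 0 := Multiset.eq_zero_of_forall_notMem fun F hF =>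
      hne (hS F (by simp [hF])) (hΔT F (by simp [hF]))
    simp only [add_zero, zero_add] at *
    have hlinks := hc.links_eq.symm.trans h
    -- The ends of a link show to which premise it belongs, so equality of the unions gives equality
    -- for each premise; `out_fst_mem` picks an arbitrary end.
    have hd₁ : ∀ s ∈ d₁.links, s ∉ e₂.links := fun s hs hs' =>
      hF.disjoint _ (h₁.mem_vertices_of_links hs s.out_fst_mem)
        (he₂.mem_vertices_of_links hs' s.out_fst_mem)
    have hd₂ : ∀ s ∈ e₁.links, s ∉ d₂.links := fun s hs hs' =>
      hF.disjoint _ (he₁.mem_vertices_of_links hs s.out_fst_mem)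
        (h₂.mem_vertices_of_links hs' s.out_fst_mem)
    have hmem : ∀ s, (s ∈ d₁.links ∨ s ∈ d₂.links) ↔ (s ∈ e₁.links ∨ s ∈ e₂.links) :=
      fun s => Set.ext_iff.1 hlinks s
    have hl₁ : d₁.links = e₁.links := by
      ext s
      have := hmem s; have := hd₁ s; have := hd₂ s
      tauto
    have hd₃ : ∀ s ∈ d₂.links, s ∉ e₁.links := fun s hs hs' => hd₂ s hs' hs
    have hd₄ : ∀ s ∈ e₂.links, s ∉ d₁.links := fun s hs hs' => hd₁ s hs' hs
    have hl₂ : d₂.links = e₂.links := by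
      ext s
      have := hmem s; have := hd₃ s; have := hd₄ s
      tauto
    refine hc.trans (.trans ((ih₁ hF.left h₁ hl₁).map (f := fun d => .tensor v d d₂)
      (fun d h => .tensor v A B _ _ d d₂ hv h h₂) (fun _ _ h => .congr_tensor_left v d₂ h)) ?_)
    exact (ih₂ hF.right h₂ hl₂).map (f := fun d => .tensor v e₁ d)
      (fun d h => .tensor v A B _ _ e₁ d hv he₁ h) (fun _ _ h => .congr_tensor_right v e₁ h)
  | unary r F P Γ e hr hF he ih =>
    -- No edge starts at the vertex of `F`: in the skeleton ending with its rule, such an edge would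
    -- put this vertex among those of the premise, against the forest condition.
    obtain ⟨hv, hΓ'⟩ := hr.isForest hΓ
    obtain ⟨d', h', hc⟩ := hd.exists_convertible_unary hr rfl (fun b hb hE => by
      rcases hr.mem_vertices_cons.1 hb with rfl | hb
      · exact hv (hF _ hE)
      · exact hv (he.mem_vertices_of_leap hE hb))
    exact hc.trans ((ih hΓ' h' (hc.links_eq.symm.trans h)).map (f := fun d => .unary r d)
      (fun d h => .unary r F P Γ d hr hF h) (fun _ _ h => .congr_unary r h))

end Skeleton

end Skeleton

/-! ### Linkings of skeletons -/

section Linking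

variable {D : Duality L} {E : ℕ → ℕ → Prop} {w : ℕ → L.Term ℕ} {r : UnaryRule L}
  {F A B C : Formula L} {P Γ Δ : Sequent L} {d : Deriv L} {v : ℕ}

lemma Introduces.nodes_subset (h : Introduces w r F P) : nodes (P + Γ) ⊆ nodes (F ::ₘ Γ) := by
  rw [h.nodes_cons]
  exact Multiset.subset_cons _ _

lemma nodes_subset_tensor_left : nodes (A ::ₘ Γ) ⊆ nodes (.tensor v A B ::ₘ (Γ + Δ)) := by
  rw [nodes_tensor_cons]
  exact fun C hC => Multiset.mem_cons_of_mem (Multiset.mem_add.2 (.inl hC))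

lemma nodes_subset_tensor_right : nodes (B ::ₘ Δ) ⊆ nodes (.tensor v A B ::ₘ (Γ + Δ)) := by
  rw [nodes_tensor_cons]
  exact fun C hC => Multiset.mem_cons_of_mem (Multiset.mem_add.2 (.inr hC))

theorem Skeleton.isLinking (h : Skeleton D E w d Γ) (hΓ : IsForest Γ) :
    IsLinking D Γ d.links := by
  induction h with
  | ax l l' Q ts ts' =>
    have hn : nodes ({.atom l Q ts, .atom l' (D.dual Q) ts'} : Sequent L) =
        {.atom l Q ts, .atom l' (D.dual Q) ts'} := by
      simp [nodes, Formula.nodes]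
    simp only [IsLinking, leaves, hn]
    refine ⟨?_, ?_, ?_⟩
    · rintro s rfl
      exact ⟨l, l', _, Q, ts, ts', rfl, by simp, by simp⟩
    · rintro s rfl s' rfl h
      exact (h rfl).elim
    · rintro k ⟨n, R, us, h⟩
      refine ⟨_, rfl, ?_⟩
      simp only [Multiset.insert_eq_cons, Multiset.mem_cons, Multiset.mem_singleton,
        Formula.atom.injEq] at h
      rw [Sym2.mem_iff]
      exact h.imp And.left And.left
  | tensor v A B Γ Δ d e hv hd he ihd ihe =>
    have hF := hΓ.of_tensor
    obtain ⟨hd₁, hd₂, hd₃⟩ := ihd hF.left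
    obtain ⟨he₁, he₂, he₃⟩ := ihe hF.right
    refine ⟨?_, ?_, ?_⟩
    · rintro s (hs | hs)
      · obtain ⟨l, l', n, P, ts, ts', h, h₁, h₂⟩ := hd₁ s hs
        exact ⟨l, l', n, P, ts, ts', h, nodes_subset_tensor_left h₁, nodes_subset_tensor_left h₂⟩
      · obtain ⟨l, l', n, P, ts, ts', h, h₁, h₂⟩ := he₁ s hs
        exact ⟨l, l', n, P, ts, ts', h, nodes_subset_tensor_right h₁, nodes_subset_tensor_right h₂⟩
    · rintro s (hs | hs) s' (hs' | hs') hne l hl hl'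
      · exact hd₂ s hs s' hs' hne l hl hl'
      · exact hF.disjoint l (hd.mem_vertices_of_links hs hl) (he.mem_vertices_of_links hs' hl')
      · exact hF.disjoint l (hd.mem_vertices_of_links hs' hl') (he.mem_vertices_of_links hs hl)
      · exact he₂ s hs s' hs' hne l hl hl'
    · rintro l ⟨n, P, ts, h⟩
      simp only [nodes_tensor_cons, Multiset.mem_cons, reduceCtorEq, false_or,
        Multiset.mem_add] at h
      rcases h with h | h
      · obtain ⟨s, hs, hl⟩ := hd₃ l ⟨n, P, ts, h⟩
        exact ⟨s, .inl hs, hl⟩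
      · obtain ⟨s, hs, hl⟩ := he₃ l ⟨n, P, ts, h⟩
        exact ⟨s, .inr hs, hl⟩
  | unary r F P Γ d hr hF hd ih =>
    obtain ⟨h₁, h₂, h₃⟩ := ih (hr.isForest hΓ).2
    refine ⟨fun s hs => ?_, h₂, ?_⟩
    · obtain ⟨l, l', n, P, ts, ts', h, h₁, h₂⟩ := h₁ s hs
      exact ⟨l, l', n, P, ts, ts', h, hr.nodes_subset h₁, hr.nodes_subset h₂⟩
    · rintro l ⟨n, P, ts, h⟩
      rw [hr.nodes_cons, Multiset.mem_cons] at h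
      exact h₃ l ⟨n, P, ts, h.resolve_left fun h => hr.ne_atom h.symm⟩

end Linking

/-! ### Trees -/

/-- The relation `r` restricted to `S`, with the directions forgotten, is a tree. -/
structure IsTreeOn (r : ℕ → ℕ → Prop) (S : Set ℕ) : Prop where
  nonempty : S.Nonempty
  connected : ∀ C : Set ℕ, (∃ a ∈ S, a ∈ C) → (∀ a ∈ S, ∀ b ∈ S, r a b → (a ∈ C ↔ b ∈ C)) → S ⊆ C
  bridge : ∀ a ∈ S, ∀ b ∈ S, a ≠ b → r a b → ∃ C : Set ℕ, a ∈ C ∧ b ∉ C ∧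
    ∀ a' ∈ S, ∀ b' ∈ S, r a' b' → (a' ∈ C ↔ b' ∈ C) ∨ s(a', b') = s(a, b)

namespace IsTreeOn

variable {r r' : ℕ → ℕ → Prop} {S T : Set ℕ} {u v : ℕ}

lemma singleton (r : ℕ → ℕ → Prop) (v : ℕ) : IsTreeOn r {v} := by
  refine ⟨⟨v, rfl⟩, ?_, ?_⟩
  · rintro C ⟨a, rfl, ha⟩ - b rfl
    exact ha
  · rintro a rfl b rfl h
    exact (h rfl).elim

lemma congr (h : IsTreeOn r S) (hr : ∀ a ∈ S, ∀ b ∈ S, (r' a b ↔ r a b)) : IsTreeOn r' S := by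
  refine ⟨h.nonempty, fun C hC hC' => h.connected C hC fun a ha b hb hab =>
    hC' a ha b hb ((hr a ha b hb).2 hab), fun a ha b hb hne hab => ?_⟩
  obtain ⟨C, h₁, h₂, h₃⟩ := h.bridge a ha b hb hne ((hr a ha b hb).1 hab)
  exact ⟨C, h₁, h₂, fun a' ha' b' hb' h => h₃ a' ha' b' hb' ((hr a' ha' b' hb').1 h)⟩

/-- Two disjoint trees joined by a single edge form a tree. -/
lemma union (hS : IsTreeOn r S) (hT : IsTreeOn r T) (hST : ∀ a ∈ S, a ∉ T) (hu : u ∈ S)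
    (hv : v ∈ T) (huv : r u v ∨ r v u) (h : ∀ a ∈ S, ∀ b ∈ T, r a b ∨ r b a → a = u ∧ b = v) :
    IsTreeOn r (S ∪ T) := by
  refine ⟨⟨u, .inl hu⟩, ?_, ?_⟩
  · intro C hC hr
    have hS' : (∃ a ∈ S, a ∈ C) → S ⊆ C := fun hC => hS.connected C hC fun a ha b hb =>
      hr a (.inl ha) b (.inl hb)
    have hT' : (∃ a ∈ T, a ∈ C) → T ⊆ C := fun hC => hT.connected C hC fun a ha b hb =>
      hr a (.inr ha) b (.inr hb)
    have huv' : u ∈ C ↔ v ∈ C := by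
      rcases huv with huv | huv
      exacts [hr u (.inl hu) v (.inr hv) huv, (hr v (.inr hv) u (.inl hu) huv).symm]
    obtain ⟨a, ha | ha, haC⟩ := hC
    · have h₁ := hS' ⟨a, ha, haC⟩
      exact Set.union_subset h₁ (hT' ⟨v, hv, huv'.1 (h₁ hu)⟩)
    · have h₁ := hT' ⟨a, ha, haC⟩
      exact Set.union_subset (hS' ⟨u, hu, huv'.2 (h₁ hv)⟩) h₁
  · rintro a ha b hb hne hab
    have hcross : ∀ a' ∈ S, ∀ b' ∈ T, r a' b' ∨ r b' a' → s(a', b') = s(u, v) := by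
      intro a' ha' b' hb' h'
      obtain ⟨rfl, rfl⟩ := h a' ha' b' hb' h'
      rfl
    rcases ha with ha | ha <;> rcases hb with hb | hb
    · obtain ⟨C, h₁, h₂, h₃⟩ := hS.bridge a ha b hb hne hab
      -- The cut of `S` is extended by placing all of `T` on the side of `u`, so that the joining
      -- edge does not cross it.
      refine ⟨{x | (x ∈ S ∧ x ∈ C) ∨ (x ∈ T ∧ u ∈ C)}, .inl ⟨ha, h₁⟩, ?_, ?_⟩
      · rintro (h | h)
        exacts [h₂ h.2, hST b hb h.1]
      · rintro a' (ha' | ha') b' (hb' | hb') h'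
        · have := h₃ a' ha' b' hb' h'
          have := hST a' ha'; have := hST b' hb'
          simp_all
        · obtain ⟨rfl, rfl⟩ := h a' ha' b' hb' (.inl h')
          have := hST a' ha'
          left
          simp only [Set.mem_ofPred_eq]
          tauto
        · obtain ⟨rfl, rfl⟩ := h b' hb' a' ha' (.inr h')
          have := hST b' hb'
          left
          simp only [Set.mem_ofPred_eq]
          tauto
        · have := fun h => hST a' h ha'; have := fun h => hST b' h hb'
          left
          simp only [Set.mem_ofPred_eq]
          tauto
    · refine ⟨S, ha, fun h => hST b h hb, ?_⟩
      rintro a' (ha' | ha') b' (hb' | hb') h'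
      · exact .inl (iff_of_true ha' hb')
      · exact .inr ((hcross a' ha' b' hb' (.inl h')).trans (hcross a ha b hb (.inl hab)).symm)
      · exact .inr (Sym2.eq_swap.trans
          ((hcross b' hb' a' ha' (.inr h')).trans (hcross a ha b hb (.inl hab)).symm))
      · exact .inl (iff_of_false (fun h => hST a' h ha') fun h => hST b' h hb')
    · refine ⟨T, ha, hST b hb, ?_⟩
      have hab' := (hcross b hb a ha (.inr hab)).symm.trans Sym2.eq_swap
      rintro a' (ha' | ha') b' (hb' | hb') h'
      · exact .inl (iff_of_false (hST a' ha') (hST b' hb'))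
      · exact .inr ((hcross a' ha' b' hb' (.inl h')).trans hab')
      · exact .inr (Sym2.eq_swap.trans ((hcross b' hb' a' ha' (.inr h')).trans hab'))
      · exact .inl (iff_of_true ha' hb')
    · obtain ⟨C, h₁, h₂, h₃⟩ := hT.bridge a ha b hb hne hab
      refine ⟨{x | (x ∈ T ∧ x ∈ C) ∨ (x ∈ S ∧ v ∈ C)}, .inl ⟨ha, h₁⟩, ?_, ?_⟩
      · rintro (h | h)
        exacts [h₂ h.2, hST b h.1 hb]
      · rintro a' (ha' | ha') b' (hb' | hb') h'
        · have := hST a' ha'; have := hST b' hb'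
          left
          simp only [Set.mem_ofPred_eq]
          tauto
        · obtain ⟨rfl, rfl⟩ := h a' ha' b' hb' (.inl h')
          have := hST a' ha'
          left
          simp only [Set.mem_ofPred_eq]
          tauto
        · obtain ⟨rfl, rfl⟩ := h b' hb' a' ha' (.inr h')
          have := hST b' hb'
          left
          simp only [Set.mem_ofPred_eq]
          tauto
        · have := h₃ a' ha' b' hb' h'
          have := fun h => hST a' h ha'; have := fun h => hST b' h hb'
          simp_all

/-- The set of vertices reachable from a given one is closed under edges, which gives connectedness.
Every edge is a bridge because a walk avoiding it never crosses the cut supplied for it, which gives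
acyclicity. -/
lemma isTree (h : IsTreeOn r S) : (SimpleGraph.fromRel fun a b : S => r a.1 b.1).IsTree := by
  constructor
  · have : Nonempty S := h.nonempty.to_subtype
    refine ⟨fun a b => ?_⟩
    have := h.connected {x | ∃ hx : x ∈ S,
      (SimpleGraph.fromRel fun a b : S => r a.1 b.1).Reachable a ⟨x, hx⟩}
      ⟨a, a.2, a.2, .refl _⟩ (fun x hx y hy hxy => by
        by_cases e : x = y
        · rw [e]
        have hadj : (SimpleGraph.fromRel fun a b : S => r a.1 b.1).Adj ⟨x, hx⟩ ⟨y, hy⟩ := by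
          simp [SimpleGraph.fromRel_adj, e, hxy]
        exact ⟨fun ⟨_, h⟩ => ⟨hy, h.trans hadj.reachable⟩,
          fun ⟨_, h⟩ => ⟨hx, h.trans hadj.symm.reachable⟩⟩) b.2
    exact this.2
  · have key : ∀ a b : S, a ≠ b → r a.1 b.1 →
        ¬ ((SimpleGraph.fromRel fun a b : S => r a.1 b.1).deleteEdges {s(a, b)}).Reachable a b := by
      rintro a b hne hab ⟨p⟩
      obtain ⟨C, h₁, h₂, h₃⟩ := h.bridge a a.2 b b.2 (fun e => hne (Subtype.ext e)) hab
      have hC : ∀ x y : S, ((SimpleGraph.fromRel fun a b : S => r a.1 b.1).deleteEdges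
          {s(a, b)}).Walk x y → (x.1 ∈ C ↔ y.1 ∈ C) := by
        intro x y p
        induction p with
        | nil => rfl
        | cons hadj _ ih =>
          rename_i x y z _
          refine Iff.trans ?_ ih
          rw [SimpleGraph.deleteEdges_adj, SimpleGraph.fromRel_adj, Set.mem_singleton_iff] at hadj
          obtain ⟨⟨-, hadj⟩, hne⟩ := hadj
          have hne' : s(x.1, y.1) ≠ s(a.1, b.1) := fun e =>
            hne (Sym2.map.injective Subtype.val_injective (by simpa using e))
          rcases hadj with hadj | hadj
          · exact (h₃ x x.2 y y.2 hadj).resolve_right hne'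
          · exact ((h₃ y y.2 x x.2 hadj).resolve_right fun e => hne' (Sym2.eq_swap.trans e)).symm
      exact h₂ ((hC a b p).1 h₁)
    rw [SimpleGraph.isAcyclic_iff_forall_adj_isBridge]
    intro a b hadj
    rw [SimpleGraph.isBridge_iff]
    obtain ⟨hne, hab | hab⟩ := (SimpleGraph.fromRel_adj _ _ _).1 hadj
    · exact key a b hne hab
    · rw [Sym2.eq_swap]
      exact fun h => key b a hne.symm hab h.symm

end IsTreeOn

/-! ### Switchings of skeletons -/

/-- The edges of a forest, from a vertex to its parent. -/
def TreeEdge (Γ : Sequent L) (a b : ℕ) : Prop :=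
  ∃ C ∈ nodes Γ, ∃ B ∈ C.children, B.vertex = a ∧ C.vertex = b

/-- The edges of the switching `c` of the forest `Γ` with links `θ` and leaps `E`. -/
def SwitchEdge (Γ : Sequent L) (θ : Set (Sym2 ℕ)) (E : ℕ → ℕ → Prop) (c : ℕ → ℕ) (a b : ℕ) : Prop :=
  s(a, b) ∈ θ ∨ ((TreeEdge Γ a b ∨ E a b) ∧ (Switched Γ b → c b = a))

section Switching

variable {D : Duality L} {E : ℕ → ℕ → Prop} {w : ℕ → L.Term ℕ} {r : UnaryRule L}
  {F A B C : Formula L} {P Γ Δ : Sequent L} {d : Deriv L} {v a b : ℕ} {c : ℕ → ℕ}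

lemma Formula.mem_nodes_of_child (hC : C ∈ A.nodes) (hB : B ∈ C.children) : B ∈ A.nodes := by
  induction A with
  | atom v Q ts =>
    rw [Formula.nodes, Multiset.mem_singleton] at hC
    subst hC
    simp [Formula.children] at hB
  | tensor v A₁ A₂ h₁ h₂ | par v A₁ A₂ h₁ h₂ =>
    simp only [Formula.nodes, Multiset.mem_cons, Multiset.mem_add] at hC ⊢
    rcases hC with rfl | hC | hC
    · simp only [Formula.children, List.mem_cons, List.not_mem_nil, or_false] at hB
      rcases hB with rfl | rfl
      exacts [.inr (.inl (self_mem_nodes _)), .inr (.inr (self_mem_nodes _))]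
    · exact .inr (.inl (h₁ hC))
    · exact .inr (.inr (h₂ hC))
  | all v x A₁ h₁ | ex v x A₁ h₁ =>
    simp only [Formula.nodes, Multiset.mem_cons] at hC ⊢
    rcases hC with rfl | hC
    · simp only [Formula.children, List.mem_cons, List.not_mem_nil, or_false] at hB
      subst hB
      exact .inr (self_mem_nodes _)
    · exact .inr (h₁ hC)

namespace TreeEdge

lemma mem_left (h : TreeEdge Γ a b) : a ∈ vertices Γ := by
  obtain ⟨C, hC, B, hB, rfl, rfl⟩ := h
  obtain ⟨A, hA, hC⟩ := Multiset.mem_bind.1 hC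
  exact ⟨B, Multiset.mem_bind.2 ⟨A, hA, Formula.mem_nodes_of_child hC hB⟩, rfl⟩

lemma mem_right (h : TreeEdge Γ a b) : b ∈ vertices Γ := by
  obtain ⟨C, hC, B, hB, rfl, rfl⟩ := h
  exact ⟨C, hC, rfl⟩

end TreeEdge

lemma Introduces.treeEdge_iff (h : Introduces w r F P) : TreeEdge (F ::ₘ Γ) a b ↔
    (b = F.vertex ∧ ∃ B ∈ F.children, B.vertex = a) ∨ TreeEdge (P + Γ) a b := by
  simp only [TreeEdge, h.nodes_cons, Multiset.mem_cons, exists_eq_or_imp]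
  grind

lemma treeEdge_tensor_iff : TreeEdge (.tensor v A B ::ₘ (Γ + Δ)) a b ↔
    (b = v ∧ (a = A.vertex ∨ a = B.vertex)) ∨ TreeEdge (A ::ₘ Γ) a b ∨ TreeEdge (B ::ₘ Δ) a b := by
  simp only [TreeEdge, nodes_tensor_cons, Multiset.mem_cons, Multiset.mem_add, exists_eq_or_imp,
    Formula.children, Formula.vertex, List.mem_cons, List.not_mem_nil, or_false, exists_eq_left]
  grind

lemma mem_vertices_tensor_cons {u : ℕ} : u ∈ vertices (.tensor v A B ::ₘ (Γ + Δ)) ↔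
    u = v ∨ u ∈ vertices (A ::ₘ Γ) ∨ u ∈ vertices (B ::ₘ Δ) := by
  simp only [mem_vertices_cons, mem_vertices_add, mem_vertexSet_tensor]
  tauto

lemma Switched.mem (h : Switched Γ b) : b ∈ vertices Γ := by
  rcases h with ⟨A, B, h⟩ | ⟨y, A, h⟩
  exacts [⟨_, h, rfl⟩, ⟨_, h, rfl⟩]

lemma Introduces.switched_iff (h : Introduces w r F P) (hb : b ≠ F.vertex) :
    Switched (F ::ₘ Γ) b ↔ Switched (P + Γ) b := by
  simp only [Switched, h.nodes_cons, Multiset.mem_cons]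
  have h₁ : ∀ A B, Formula.par b A B ≠ F := by rintro A B rfl; exact hb rfl
  have h₂ : ∀ y A, Formula.all b y A ≠ F := by rintro y A rfl; exact hb rfl
  simp [h₁, h₂]

lemma switched_tensor_iff : Switched (.tensor v A B ::ₘ (Γ + Δ)) b ↔
    Switched (A ::ₘ Γ) b ∨ Switched (B ::ₘ Δ) b := by
  simp only [Switched, nodes_tensor_cons, Multiset.mem_cons, Multiset.mem_add, reduceCtorEq,
    false_or, exists_or]
  exact or_or_or_comm

/-- Induction on the rules: an axiom is a single edge, and a tensor joins two trees through the new
vertex. A one-premise rule hangs its vertex on the premise by exactly one edge: the one chosen by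
the switching for a par or ∀, or the edge from the only child for ∃. A chosen leap also starts in
the premise, by the condition on `E`. -/
theorem Skeleton.isTreeOn (h : Skeleton D E w d Γ) (hΓ : IsForest Γ)
    (hE : ∀ a b, E a b → b ∈ vertices Γ → Switched Γ b)
    (hc : ∀ b, Switched Γ b → TreeEdge Γ (c b) b ∨ E (c b) b) :
    IsTreeOn (SwitchEdge Γ d.links E c) (vertices Γ) := by
  induction h with
  | ax l l' Q ts ts' h h' =>
    have hn : nodes ({.atom l Q ts, .atom l' (D.dual Q) ts'} : Sequent L) =
        {.atom l Q ts, .atom l' (D.dual Q) ts'} := by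
      simp [nodes, Formula.nodes]
    have hv : vertices ({.atom l Q ts, .atom l' (D.dual Q) ts'} : Sequent L) = {l} ∪ {l'} := by
      ext u
      simp [or_comm]
    have hne : l ≠ l' := by
      have := hΓ
      rw [IsForest, hn] at this
      simpa [Formula.vertex] using this
    rw [hv]
    exact (IsTreeOn.singleton _ _).union (.singleton _ _) (by simpa using hne) rfl rfl
      (.inl (.inl rfl)) (by rintro a rfl b rfl -; exact ⟨rfl, rfl⟩)
  | tensor v A B Γ Δ d e hv hd he ihd ihe =>
    have hF := hΓ.of_tensor
    have hS : ∀ {u}, u ∈ vertices (A ::ₘ Γ) → u ≠ v := fun hu e => hF.notMem_left (e ▸ hu)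
    have hT : ∀ {u}, u ∈ vertices (B ::ₘ Δ) → u ≠ v := fun hu e => hF.notMem_right (e ▸ hu)
    have hST : ∀ {u}, u ∈ vertices (A ::ₘ Γ) → u ∈ vertices (B ::ₘ Δ) → False :=
      fun h h' => hF.disjoint _ h h'
    have hsv : ¬ Switched (.tensor v A B ::ₘ (Γ + Δ)) v := by
      rw [switched_tensor_iff]
      exact fun h => h.elim (fun h => hS h.mem rfl) fun h => hT h.mem rfl
    have hswS : ∀ {u}, u ∈ vertices (A ::ₘ Γ) →
        (Switched (.tensor v A B ::ₘ (Γ + Δ)) u ↔ Switched (A ::ₘ Γ) u) := fun hu => by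
      rw [switched_tensor_iff, or_iff_left fun h => hST hu h.mem]
    have hswT : ∀ {u}, u ∈ vertices (B ::ₘ Δ) →
        (Switched (.tensor v A B ::ₘ (Γ + Δ)) u ↔ Switched (B ::ₘ Δ) u) := fun hu => by
      rw [switched_tensor_iff, or_iff_right fun h => hST h.mem hu]
    have htrS : ∀ {a b}, b ∈ vertices (A ::ₘ Γ) →
        (TreeEdge (.tensor v A B ::ₘ (Γ + Δ)) a b ↔ TreeEdge (A ::ₘ Γ) a b) := fun hu => by
      rw [treeEdge_tensor_iff, or_iff_right fun h => hS hu h.1,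
        or_iff_left fun h => hST hu h.mem_right]
    have htrT : ∀ {a b}, b ∈ vertices (B ::ₘ Δ) →
        (TreeEdge (.tensor v A B ::ₘ (Γ + Δ)) a b ↔ TreeEdge (B ::ₘ Δ) a b) := fun hu => by
      rw [treeEdge_tensor_iff, or_iff_right fun h => hT hu h.1,
        or_iff_right fun h => hST h.mem_right hu]
    have htrv : ∀ {a}, TreeEdge (.tensor v A B ::ₘ (Γ + Δ)) a v ↔
        a = A.vertex ∨ a = B.vertex := by
      intro a
      rw [treeEdge_tensor_iff]
      have h₁ : ¬ TreeEdge (A ::ₘ Γ) a v := fun h => hS h.mem_right rfl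
      have h₂ : ¬ TreeEdge (B ::ₘ Δ) a v := fun h => hT h.mem_right rfl
      tauto
    have hlS : ∀ {a b}, s(a, b) ∈ d.links → a ∈ vertices (A ::ₘ Γ) ∧ b ∈ vertices (A ::ₘ Γ) :=
      fun h => ⟨hd.mem_vertices_of_links h (Sym2.mem_mk_left _ _),
        hd.mem_vertices_of_links h (Sym2.mem_mk_right _ _)⟩
    have hlT : ∀ {a b}, s(a, b) ∈ e.links → a ∈ vertices (B ::ₘ Δ) ∧ b ∈ vertices (B ::ₘ Δ) :=
      fun h => ⟨he.mem_vertices_of_links h (Sym2.mem_mk_left _ _),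
        he.mem_vertices_of_links h (Sym2.mem_mk_right _ _)⟩
    have hAv : A.vertex ∈ vertices (A ::ₘ Γ) := mem_vertices_cons.2 (.inl A.vertex_mem)
    have hBv : B.vertex ∈ vertices (B ::ₘ Δ) := mem_vertices_cons.2 (.inl B.vertex_mem)
    set r := SwitchEdge (.tensor v A B ::ₘ (Γ + Δ)) (d.links ∪ e.links) E c with hr
    have hrS : ∀ {a b}, b ∈ vertices (A ::ₘ Γ) → r a b → a ∈ vertices (A ::ₘ Γ) := by
      rintro a b hb ((h | h) | ⟨h | h, -⟩)
      · exact (hlS h).1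
      · exact (hST hb (hlT h).2).elim
      · exact ((htrS hb).1 h).mem_left
      · exact hd.mem_vertices_of_leap h hb
    have hrT : ∀ {a b}, b ∈ vertices (B ::ₘ Δ) → r a b → a ∈ vertices (B ::ₘ Δ) := by
      rintro a b hb ((h | h) | ⟨h | h, -⟩)
      · exact (hST (hlS h).2 hb).elim
      · exact (hlT h).1
      · exact ((htrT hb).1 h).mem_left
      · exact he.mem_vertices_of_leap h hb
    have hrv : ∀ {a}, r a v ↔ a = A.vertex ∨ a = B.vertex := by
      intro a
      constructor
      · rintro ((h | h) | ⟨h | h, -⟩)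
        · exact (hS (hlS h).2 rfl).elim
        · exact (hT (hlT h).2 rfl).elim
        · exact htrv.1 h
        · exact (hv a h).elim
      · exact fun h => .inr ⟨.inl (htrv.2 h), fun h => (hsv h).elim⟩
    have h₁ : IsTreeOn r (vertices (A ::ₘ Γ)) := by
      refine (ihd hF.left (fun a b hab hb => (hswS hb).1
        (hE a b hab (mem_vertices_tensor_cons.2 (.inr (.inl hb))))) (fun b hb => ?_)).congr ?_
      · exact (hc b ((hswS hb.mem).2 hb)).imp (htrS hb.mem).1 id
      · intro a ha b hb
        have : s(a, b) ∉ e.links := fun h => hST ha (hlT h).1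
        simp only [hr, SwitchEdge, htrS hb, hswS hb, Set.mem_union, this, or_false]
    have h₂ : IsTreeOn r (vertices (B ::ₘ Δ)) := by
      refine (ihe hF.right (fun a b hab hb => (hswT hb).1
        (hE a b hab (mem_vertices_tensor_cons.2 (.inr (.inr hb))))) (fun b hb => ?_)).congr ?_
      · exact (hc b ((hswT hb.mem).2 hb)).imp (htrT hb.mem).1 id
      · intro a ha b hb
        have : s(a, b) ∉ d.links := fun h => hST (hlS h).1 ha
        simp only [hr, SwitchEdge, htrT hb, hswT hb, Set.mem_union, this, false_or]
    have hV : vertices (.tensor v A B ::ₘ (Γ + Δ)) =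
        (vertices (A ::ₘ Γ) ∪ {v}) ∪ vertices (B ::ₘ Δ) := by
      ext u
      rw [mem_vertices_tensor_cons, Set.mem_union, Set.mem_union, Set.mem_singleton_iff,
        or_left_comm, or_assoc]
    change IsTreeOn r _
    rw [hV]
    -- The vertex `v` is first attached to the tree of the left premise through the root of `A`; the
    -- right tree is then attached to `v` through the root of `B`.
    refine (h₁.union (.singleton r v) (fun a ha => hS ha) hAv rfl
      (.inl (hrv.2 (.inl rfl))) ?_).union
      h₂ ?_ (.inr rfl) hBv (.inr (hrv.2 (.inr rfl))) ?_
    · rintro a ha b rfl (h | h)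
      · refine ⟨(hrv.1 h).resolve_right ?_, rfl⟩
        rintro rfl
        exact hST ha hBv
      · exact (hS (hrS ha h) rfl).elim
    · rintro a (ha | rfl) h
      exacts [hST ha h, hT h rfl]
    · rintro a (ha | rfl) b hb h
      · exact (h.elim (fun h => hST ha (hrT hb h)) fun h => hST (hrS ha h) hb).elim
      · rcases h with h | h
        · exact (hT (hrT hb h) rfl).elim
        · refine ⟨rfl, (hrv.1 h).resolve_left ?_⟩
          rintro rfl
          exact hST hAv hb
  | unary r₀ F P Γ d hr₀ hF hd ih =>
    obtain ⟨hv, hΓ'⟩ := hr₀.isForest hΓ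
    have hS : ∀ {u}, u ∈ vertices (P + Γ) → u ≠ F.vertex := fun hu e => hv (e ▸ hu)
    have hl : ∀ {a b}, s(a, b) ∈ d.links → a ∈ vertices (P + Γ) ∧ b ∈ vertices (P + Γ) :=
      fun h => ⟨hd.mem_vertices_of_links h (Sym2.mem_mk_left _ _),
        hd.mem_vertices_of_links h (Sym2.mem_mk_right _ _)⟩
    have htr : ∀ {a b}, b ∈ vertices (P + Γ) →
        (TreeEdge (F ::ₘ Γ) a b ↔ TreeEdge (P + Γ) a b) := fun hb => by
      rw [hr₀.treeEdge_iff, or_iff_right fun h => hS hb h.1]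
    have htrv : ∀ {a}, TreeEdge (F ::ₘ Γ) a F.vertex ↔ ∃ B ∈ F.children, B.vertex = a := by
      intro a
      rw [hr₀.treeEdge_iff, or_iff_left fun h => hv h.mem_right]
      simp
    have hsw : ∀ {u}, u ∈ vertices (P + Γ) → (Switched (F ::ₘ Γ) u ↔ Switched (P + Γ) u) :=
      fun hu => hr₀.switched_iff (hS hu)
    have hmem : ∀ {u}, u ∈ vertices (P + Γ) → u ∈ vertices (F ::ₘ Γ) :=
      fun hu => hr₀.mem_vertices_cons.2 (.inr hu)
    have hch : ∀ {B}, B ∈ F.children → B.vertex ∈ vertices (P + Γ) := by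
      intro B hB
      refine mem_vertices_of_mem (A := B) (Multiset.mem_add.2 (.inl ?_)) B.vertex_mem
      cases hr₀ <;> simpa [Formula.children] using hB
    set r := SwitchEdge (F ::ₘ Γ) d.links E c with hr
    have h₁ : IsTreeOn r (vertices (P + Γ)) := by
      refine (ih hΓ' (fun a b hab hb => (hsw hb).1 (hE a b hab (hmem hb)))
        fun b hb => ?_).congr ?_
      · exact (hc b ((hsw hb.mem).2 hb)).imp (htr hb.mem).1 id
      · intro a ha b hb
        simp only [hr, SwitchEdge, htr hb, hsw hb]
    have hrS : ∀ {a b}, b ∈ vertices (P + Γ) → r a b → a ∈ vertices (P + Γ) := by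
      rintro a b hb (h | ⟨h | h, -⟩)
      · exact (hl h).1
      · exact ((htr hb).1 h).mem_left
      · exact hd.mem_vertices_of_leap h hb
    have hrv : ∀ {a}, r a F.vertex ↔ ((∃ B ∈ F.children, B.vertex = a) ∨ E a F.vertex) ∧
        (Switched (F ::ₘ Γ) F.vertex → c F.vertex = a) := by
      intro a
      have : s(a, F.vertex) ∉ d.links := fun h => hv (hl h).2
      simp only [hr, SwitchEdge, htrv, this, false_or]
    -- All of the switching is used here: precisely one edge enters the new vertex.
    have hw : ∃ u ∈ vertices (P + Γ), ∀ a, r a F.vertex ↔ a = u := by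
      by_cases hs : Switched (F ::ₘ Γ) F.vertex
      · have hcF := (hc _ hs).imp htrv.1 id
        refine ⟨c F.vertex, ?_, fun a => ?_⟩
        · rcases hcF with ⟨B, hB, h⟩ | h
          exacts [h ▸ hch hB, hF _ h]
        · rw [hrv]
          constructor
          · exact fun h => (h.2 hs).symm
          · rintro rfl
            exact ⟨hcF, fun _ => rfl⟩
      · have hE' : ∀ a, ¬ E a F.vertex := fun a h =>
          hs (hE a _ h (hr₀.mem_vertices_cons.2 (.inl rfl)))
        simp only [hrv, hs, hE', or_false, false_imp_iff, and_true]
        have hn : F ∈ nodes (F ::ₘ Γ) := by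
          rw [hr₀.nodes_cons]
          exact Multiset.mem_cons_self _ _
        cases hr₀ with
        | par v A B => exact (hs (.inl ⟨A, B, hn⟩)).elim
        | all v x A => exact (hs (.inr ⟨x, A, hn⟩)).elim
        | ex v x A =>
          exact ⟨A.vertex, hch (by simp [Formula.children]), fun a => by
            simp [Formula.children, eq_comm]⟩
    obtain ⟨u, hu, hur⟩ := hw
    have hV : vertices (F ::ₘ Γ) = vertices (P + Γ) ∪ {F.vertex} := by
      ext x
      rw [hr₀.mem_vertices_cons, Set.mem_union, Set.mem_singleton_iff, or_comm]
    rw [hV]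
    refine h₁.union (.singleton r _) (fun a ha => hS ha) hu rfl (.inl ((hur u).2 rfl)) ?_
    rintro a ha b rfl (h | h)
    · exact ⟨(hur a).1 h, rfl⟩
    · exact (hS (hrS ha h) rfl).elim

end Switching

/-! ### Changing the witnesses -/

namespace Deriv

/-- Apply `f` to the witnesses of all `∃` rules. -/
def mapWitness (f : ℕ → L.Term ℕ → L.Term ℕ) : Deriv L → Deriv L
  | .ax s => .ax s
  | .unary (.par w) d => .unary (.par w) (d.mapWitness f)
  | .unary (.all w) d => .unary (.all w) (d.mapWitness f)
  | .unary (.ex w u) d => .unary (.ex w (f w u)) (d.mapWitness f)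
  | .tensor w d e => .tensor w (d.mapWitness f) (e.mapWitness f)

/-- Use the witness `w v` for the `∃` rule of every vertex `v`. -/
def withWitnesses (w : ℕ → L.Term ℕ) (d : Deriv L) : Deriv L := d.mapWitness fun v _ => w v

variable {f g : ℕ → L.Term ℕ → L.Term ℕ} {d : Deriv L}

lemma links_mapWitness : (d.mapWitness f).links = d.links := by
  fun_induction mapWitness f d <;> simp_all [links]

lemma mapWitness_mapWitness :
    (d.mapWitness f).mapWitness g = d.mapWitness fun v u => g v (f v u) := by
  fun_induction mapWitness f d <;> simp_all [mapWitness]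

lemma mapWitness_id : d.mapWitness (fun _ u => u) = d := by
  fun_induction mapWitness (fun _ u => u) d <;> simp_all

lemma replaceWitness_eq (v : ℕ) (t : L.Term ℕ) :
    d.replaceWitness v t = d.mapWitness fun w u => if w = v then t else u := by
  fun_induction replaceWitness v t d <;> simp_all [mapWitness]

/-- A derivation contains finitely many ∃ rules, so for large `M` the bound `v < M` holds at each of
them. It is needed because a re-witnessing consists of finitely many replacements. -/
lemma exists_mapWitness_eq (w : ℕ → L.Term ℕ) (d : Deriv L) : ∃ N, ∀ M ≥ N,
    d.mapWitness (fun v u => if v < M then w v else u) = d.withWitnesses w := by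
  unfold withWitnesses
  induction d with
  | ax s => exact ⟨0, fun _ _ => rfl⟩
  | unary r d ih =>
    obtain ⟨N, hN⟩ := ih
    cases r with
    | par v | all v => exact ⟨N, fun M hM => by simp [mapWitness, hN M hM]⟩
    | ex v t =>
      refine ⟨max N (v + 1), fun M hM => ?_⟩
      have h : v < M := by omega
      simp [mapWitness, hN M (by omega), h]
  | tensor v d e hd he =>
    obtain ⟨N, hN⟩ := hd
    obtain ⟨N', hN'⟩ := he
    exact ⟨max N N', fun M hM => by simp [mapWitness, hN M (by omega), hN' M (by omega)]⟩

lemma reflTransGen_withWitnesses (w : ℕ → L.Term ℕ) (d : Deriv L) :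
    Relation.ReflTransGen (fun d d' : Deriv L => ∃ v t, d' = d.replaceWitness v t) d
      (d.withWitnesses w) := by
  -- The vertices are treated in the order 0, 1, 2, …, with one replacement for each.
  have h : ∀ M, Relation.ReflTransGen (fun d d' : Deriv L => ∃ v t, d' = d.replaceWitness v t) d
      (d.mapWitness fun v u => if v < M then w v else u) := by
    intro M
    induction M with
    | zero => simpa [mapWitness_id] using Relation.ReflTransGen.refl
    | succ M ih =>
      refine ih.tail ⟨M, w M, ?_⟩
      rw [replaceWitness_eq, mapWitness_mapWitness]
      congr 1
      funext v u
      by_cases h : v = M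
      · simp [h]
      · have : v < M + 1 ↔ v < M := by omega
        simp [h, this]
  obtain ⟨N, hN⟩ := exists_mapWitness_eq w d
  exact hN N le_rfl ▸ h N

end Deriv

lemma CutFreeProof.Equivalent.linking_eq {D : Duality L} {Γ : Sequent L} {p q : CutFreeProof D Γ}
    (h : p.Equivalent q) : p.linking = q.linking := by
  induction h with
  | rel p q h =>
    rcases h with h | h
    · exact Commutes.links_eq h
    · have : ∀ d : Deriv L, Relation.ReflTransGen
          (fun d d' : Deriv L => ∃ v t, d' = d.replaceWitness v t) p.1 d → p.1.links = d.links := by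
        intro d hd
        induction hd with
        | refl => rfl
        | tail _ h ih =>
          obtain ⟨v, t, rfl⟩ := h
          rw [ih, Deriv.replaceWitness_eq, Deriv.links_mapWitness]
      exact this _ h
  | refl => rfl
  | symm _ _ _ ih => exact ih.symm
  | trans _ _ _ _ _ ih ih' => exact ih.trans ih'

/-! ### The unifier of a proof -/

/-- `τ` equalizes the term sequences at the two ends of every link. -/
def Unifies (D : Duality L) (Γ : Sequent L) (θ : Set (Sym2 ℕ)) (τ : ℕ → L.Term ℕ) : Prop :=
  ∀ (l l' n : ℕ) (P : L.Relations n) (ts ts' : Fin n → L.Term ℕ), s(l, l') ∈ θ →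
    Formula.atom l P ts ∈ nodes Γ → Formula.atom l' (D.dual P) ts' ∈ nodes Γ →
    ∀ i, (ts i).subst τ = (ts' i).subst τ

/-- `a` and `b` are quantifiers `∃ x` and `∀ y` of `Γ` such that `y` occurs in `τ x`. -/
def TermLeap (Γ : Sequent L) (τ : ℕ → L.Term ℕ) (a b : ℕ) : Prop :=
  ∃ x y A B, Formula.ex a x A ∈ nodes Γ ∧ Formula.all b y B ∈ nodes Γ ∧ x ∈ existVars Γ ∧
    y ∈ (τ x).varFinset

/-- `τ` collects the witnesses of the derivation `d` of the instance of `Γ` by `τ₁`, with the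
variables of `U` that are not bound below replaced by `z₀`. -/
structure IsSolution (D : Duality L) (z₀ : ℕ) (d : Deriv L) (Γ : Sequent L) (τ₁ : ℕ → L.Term ℕ)
    (U : Set ℕ) (τ : ℕ → L.Term ℕ) : Prop where
  free : ∀ z ∈ freeVars Γ, τ z = blank z₀ U (τ₁ z)
  -- Restricted to variables that occur in leaves: for a vacuous `∀ y` nothing determines `τ y`.
  univ : ∀ (l n : ℕ) (P : L.Relations n) (ts : Fin n → L.Term ℕ) (i : Fin n),
    Formula.atom l P ts ∈ nodes Γ → ∀ y ∈ (ts i).varFinset, y ∈ univVars Γ → τ y = Term.var y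
  -- A blankable variable survives in a witness only if its ∀ rule is inside the derivation at hand.
  -- This confines leaps to one premise of a tensor.
  strict : ∀ x ∈ existVars Γ, ∀ y ∈ (τ x).varFinset, y ∈ U → y ∈ univVars Γ
  unifies : Unifies D Γ d.links τ
  -- Edges of `E` are constrained only at targets in `Γ`, so that one relation serves both premises
  -- of a tensor.
  skeleton : ∀ (E : ℕ → ℕ → Prop) (w : ℕ → L.Term ℕ),
    (∀ a b, E a b → b ∈ vertices Γ → TermLeap Γ τ a b) → Skeleton D E w (d.withWitnesses w) Γ

section Solution

variable {D : Duality L} {z₀ : ℕ} {d e : Deriv L} {Γ Δ : Sequent L} {τ₁ τ τ' : ℕ → L.Term ℕ}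
  {U : Set ℕ} {A B : Formula L} {v x y : ℕ} {t : L.Term ℕ}

lemma univVars_subset_boundVars (h : y ∈ univVars Γ) : y ∈ boundVars Γ := by
  obtain ⟨v, A, h⟩ := h
  exact mem_boundVars_of_all h

/-- Both leaves have the same instance under `τ₁`, and blanking preserves equality. The absence of
quantifiers rules out leaps. -/
lemma IsSolution.ax {l l' n : ℕ} {P : L.Relations n} {ts us us' : Fin n → L.Term ℕ}
    (h : ∀ i, (us i).subst τ₁ = ts i) (h' : ∀ i, (us' i).subst τ₁ = ts i) :
    IsSolution D z₀ (.ax s(l, l')) {.atom l P us, .atom l' (D.dual P) us'} τ₁ U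
      fun z => blank z₀ U (τ₁ z) := by
  have hn : ∀ C, C ∈ nodes ({.atom l P us, .atom l' (D.dual P) us'} : Sequent L) →
      C = .atom l P us ∨ C = .atom l' (D.dual P) us' := by
    simp [nodes, Formula.nodes]
  have hterm : ∀ (k m : ℕ) (Q : L.Relations m) (rs : Fin m → L.Term ℕ),
      Formula.atom k Q rs ∈ nodes ({.atom l P us, .atom l' (D.dual P) us'} : Sequent L) →
      m = n ∧ ∀ (i : Fin m) (j : Fin n), i.1 = j.1 → (rs i).subst τ₁ = ts j := by
    intro k m Q rs hk
    rcases (hn _ hk).imp (Formula.atom.injEq .. ▸ ·) (Formula.atom.injEq .. ▸ ·)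
      with ⟨-, rfl, -, hk⟩ | ⟨-, rfl, -, hk⟩
    · refine ⟨rfl, fun i j hij => ?_⟩
      rw [eq_of_heq hk, Fin.ext hij, h]
    · refine ⟨rfl, fun i j hij => ?_⟩
      rw [eq_of_heq hk, Fin.ext hij, h']
  refine ⟨fun _ _ => rfl, ?_, ?_, ?_, ?_⟩
  · rintro _ _ _ _ _ - y - ⟨b, B, hB⟩
    simpa using hn _ hB
  · rintro x ⟨a, A, hA, -⟩
    simpa using hn _ hA
  · intro k k' m Q rs rs' _ hk hk' i
    obtain ⟨rfl, hr⟩ := hterm k m Q rs hk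
    obtain ⟨-, hr'⟩ := hterm k' m _ rs' hk'
    rw [← blank_subst, ← blank_subst, hr i i rfl, hr' i i rfl]
  · intro E w hE
    have hE' : ∀ a, ∀ b ∈ vertices ({.atom l P us, .atom l' (D.dual P) us'} : Sequent L),
        ¬ E a b := by
      intro a b hb h
      obtain ⟨x, y, A, B, h, -⟩ := hE a b h hb
      simpa using hn _ h
    exact .ax l l' P us us' (fun a => hE' a l (by simp)) (fun a => hE' a l' (by simp))

lemma IsSolution.par (h : IsSolution D z₀ d (A ::ₘ B ::ₘ Γ) τ₁ U τ) :
    IsSolution D z₀ (.unary (.par v) d) (.par v A B ::ₘ Γ) τ₁ U τ := by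
  have hex : existVars (.par v A B ::ₘ Γ) = existVars (A ::ₘ B ::ₘ Γ) := by
    simp [existVars, nodes_par_cons]
  have hun : univVars (.par v A B ::ₘ Γ) = univVars (A ::ₘ B ::ₘ Γ) := by
    simp [univVars, nodes_par_cons]
  refine ⟨fun z hz => h.free z ?_, ?_, ?_, ?_, fun E w hE => ?_⟩
  · simpa only [mem_freeVars_cons, Formula.freeVars, Finset.mem_union, or_assoc] using hz
  · intro l n P ts i hl
    rw [nodes_par_cons, Multiset.mem_cons] at hl
    rw [hun]
    exact h.univ l n P ts i (hl.resolve_left (by simp))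
  · rw [hex, hun]
    exact h.strict
  · intro l l' n P ts ts' hl hn hn'
    rw [nodes_par_cons, Multiset.mem_cons] at hn hn'
    exact h.unifies l l' n P ts ts' hl (hn.resolve_left (by simp)) (hn'.resolve_left (by simp))
  · have hr := Introduces.par (w := w) v A B
    have hleap : ∀ {a b}, TermLeap (.par v A B ::ₘ Γ) τ a b → TermLeap (A ::ₘ B ::ₘ Γ) τ a b := by
      intro a b h
      simpa only [TermLeap, hex, nodes_par_cons, Multiset.mem_cons, reduceCtorEq, false_or] using h
    refine .unary _ _ _ _ _ hr (fun a ha => ?_) ?_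
    · obtain ⟨x, y, C, B, h, -⟩ :=
        hleap (hE a _ ha (mem_vertices_cons.2 (.inl (Formula.vertex_mem _))))
      exact ⟨_, by simpa using h, rfl⟩
    · simp only [Multiset.cons_add, zero_add]
      exact h.skeleton E w fun a b hab hb => hleap (hE a b hab (by
        simp only [mem_vertices_cons, mem_vertexSet_par] at hb ⊢
        tauto))

/-- Above the rule, `y` is a genuine eigenvariable and is no longer blanked, hence `U \ {y}`. Terms
for variables free in the conclusion do not contain `y`, so this change does not affect them. -/
lemma IsSolution.all
    (h : IsSolution D z₀ d (A ::ₘ Γ) (Function.update τ₁ y (Term.var y)) (U \ {y}) τ)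
    (hF : IsForest (.all v y A ::ₘ Γ)) (hΓ : IsClean (.all v y A ::ₘ Γ))
    (hA : ∀ z ∈ A.freeVars, z ≠ y → y ∉ (τ₁ z).varFinset)
    (hy : ∀ z ∈ freeVars Γ, y ∉ (τ₁ z).varFinset) :
    IsSolution D z₀ (.unary (.all v) d) (.all v y A ::ₘ Γ) τ₁ U τ := by
  obtain ⟨-, hy₁, hy₂⟩ := hΓ.of_all
  have hex : existVars (.all v y A ::ₘ Γ) = existVars (A ::ₘ Γ) := by
    simp [existVars, nodes_all_cons]
  have hun : ∀ z, z ∈ univVars (.all v y A ::ₘ Γ) ↔ z = y ∨ z ∈ univVars (A ::ₘ Γ) := by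
    intro z
    simp [univVars, nodes_all_cons, exists_or]
  refine ⟨fun z hz => ?_, ?_, ?_, ?_, fun E w hE => ?_⟩
  · simp only [mem_freeVars_cons, Formula.freeVars, Finset.mem_erase] at hz
    have hne : z ≠ y := by
      rintro rfl
      rcases hz with hz | hz
      exacts [hz.1 rfl, hy₂ hz]
    rw [h.free z (mem_freeVars_cons.2 (hz.imp And.right id)), Function.update_of_ne hne]
    refine blank_diff ?_
    rcases hz with hz | hz
    exacts [hA z hz.2 hne, hy z hz]
  · intro l n P ts i hl z hz hzu
    rw [nodes_all_cons, Multiset.mem_cons] at hl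
    replace hl := hl.resolve_left (by simp)
    rcases (hun z).1 hzu with rfl | hzu
    · have hf : z ∈ freeVars (A ::ₘ Γ) := by
        rcases mem_vars_of_atom hl hz with h | h | h
        exacts [h, absurd (mem_boundVars_of_existVars h) hy₁,
          absurd (univVars_subset_boundVars h) hy₁]
      rw [h.free z hf, Function.update_self, blank_var (by simp)]
    · exact h.univ l n P ts i hl z hz hzu
  · intro x hx z hz hzU
    rw [hun]
    by_cases e : z = y
    · exact .inl e
    · exact .inr (h.strict x (hex ▸ hx) z hz ⟨hzU, e⟩)
  · intro l l' n P ts ts' hl hn hn'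
    rw [nodes_all_cons, Multiset.mem_cons] at hn hn'
    exact h.unifies l l' n P ts ts' hl (hn.resolve_left (by simp)) (hn'.resolve_left (by simp))
  · have hv := hF.of_all.1
    refine .unary _ _ _ _ _ (Introduces.all (w := w) v y A) (fun a ha => ?_) ?_
    -- A leap starts at an ∃ vertex, so its source is not the new ∀ vertex and lies above the rule.
    · obtain ⟨x, z, C, B, h, -⟩ := hE a _ ha (mem_vertices_cons.2 (.inl (Formula.vertex_mem _)))
      rw [nodes_all_cons, Multiset.mem_cons] at h
      exact ⟨_, h.resolve_left (by simp), rfl⟩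
    · refine h.skeleton E w fun a b hab hb => ?_
      obtain ⟨x, z, C, B, hC, hB, hx, hz⟩ := hE a b hab (by
        rw [mem_vertices_cons, mem_vertexSet_all, or_assoc, ← mem_vertices_cons]
        exact .inr hb)
      rw [nodes_all_cons, Multiset.mem_cons] at hC hB
      refine ⟨x, z, C, B, hC.resolve_left (by simp), hB.resolve_left ?_, hex ▸ hx, hz⟩
      intro e
      cases e
      exact hv hb

/-- The value at `x` is the witness with all variables of `U` blanked, and `U` contains every
variable bound in the sequent. So no leap from the new vertex stays within this sequent, and the
remaining leaps come from the premise. -/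
lemma IsSolution.ex (h : IsSolution D z₀ d (A ::ₘ Γ) (Function.update τ₁ x t) U τ)
    (hF : IsForest (.ex v x A ::ₘ Γ)) (hΓ : IsClean (.ex v x A ::ₘ Γ))
    (hU : ∀ y ∈ boundVars (.ex v x A ::ₘ Γ), y ∈ U) (hz₀ : z₀ ∉ U) (u : L.Term ℕ) :
    IsSolution D z₀ (.unary (.ex v u) d) (.ex v x A ::ₘ Γ) τ₁ U τ := by
  obtain ⟨-, hx₁, hx₂⟩ := hΓ.of_ex
  have hex : ∀ z, z ∈ existVars (.ex v x A ::ₘ Γ) →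
      (z = x ∧ x ∈ A.freeVars) ∨ z ∈ existVars (A ::ₘ Γ) := by
    rintro z ⟨a, C, hC, hz⟩
    rw [nodes_ex_cons, Multiset.mem_cons, Formula.ex.injEq] at hC
    rcases hC with ⟨-, rfl, rfl⟩ | hC
    exacts [.inl ⟨rfl, hz⟩, .inr ⟨a, C, hC, hz⟩]
  have hun : univVars (.ex v x A ::ₘ Γ) = univVars (A ::ₘ Γ) := by
    simp [univVars, nodes_ex_cons]
  have hτx : x ∈ A.freeVars → ∀ y ∈ (τ x).varFinset, y ∉ U := fun hxA y hy hyU => by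
    rw [h.free x (mem_freeVars_cons.2 (.inl hxA))] at hy
    exact notMem_blank hz₀ hyU hy
  refine ⟨fun z hz => ?_, ?_, ?_, ?_, fun E w hE => ?_⟩
  · have hne : z ≠ x := by
      rintro rfl
      simp only [mem_freeVars_cons, Formula.freeVars, Finset.mem_erase] at hz
      rcases hz with hz | hz
      exacts [hz.1 rfl, hx₂ hz]
    simp only [mem_freeVars_cons, Formula.freeVars, Finset.mem_erase] at hz
    rw [h.free z (mem_freeVars_cons.2 (hz.imp And.right id)), Function.update_of_ne hne]
  · intro l n P ts i hl
    rw [nodes_ex_cons, Multiset.mem_cons] at hl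
    rw [hun]
    exact h.univ l n P ts i (hl.resolve_left (by simp))
  · intro z hz y hy hyU
    rw [hun]
    rcases hex z hz with ⟨rfl, hxA⟩ | hz
    exacts [absurd hyU (hτx hxA y hy), h.strict z hz y hy hyU]
  · intro l l' n P ts ts' hl hn hn'
    rw [nodes_ex_cons, Multiset.mem_cons] at hn hn'
    exact h.unifies l l' n P ts ts' hl (hn.resolve_left (by simp)) (hn'.resolve_left (by simp))
  · have hv := hF.of_ex.1
    refine .unary _ _ _ _ _ (Introduces.ex (w := w) v x A) (fun a ha => ?_) ?_
    · obtain ⟨_, z, _, B, -, h, -⟩ := hE a _ ha (mem_vertices_cons.2 (.inl (Formula.vertex_mem _)))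
      rw [nodes_ex_cons, Multiset.mem_cons] at h
      exact absurd (mem_vertices_of_mem_nodes (h.resolve_left (by simp))) hv
    · refine h.skeleton E w fun a b hab hb => ?_
      obtain ⟨z, y, C, B, hC, hB, hz, hy⟩ := hE a b hab (by
        rw [mem_vertices_cons, mem_vertexSet_ex, or_assoc, ← mem_vertices_cons]
        exact .inr hb)
      have hyU := hU y (mem_boundVars_of_all hB)
      have hz' : z ∈ existVars (A ::ₘ Γ) := (hex z hz).resolve_left (by
        rintro ⟨rfl, hzA⟩
        exact hτx hzA y hy hyU)
      rw [nodes_ex_cons, Multiset.mem_cons] at hC hB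
      refine ⟨z, y, C, B, hC.resolve_left ?_, hB.resolve_left (by simp), hz', hy⟩
      intro e
      cases e
      exact hx₁ (mem_boundVars_of_existVars hz')

lemma IsSolution.tensor {A B : Formula L} (h : IsSolution D z₀ d (A ::ₘ Γ) τ₁ U τ)
    (h' : IsSolution D z₀ e (B ::ₘ Δ) τ₁ U τ')
    (hF : IsForest (.tensor v A B ::ₘ (Γ + Δ))) (hΓ : IsClean (.tensor v A B ::ₘ (Γ + Δ)))
    (hU : ∀ y ∈ boundVars (.tensor v A B ::ₘ (Γ + Δ)), y ∈ U) :
    ∃ τ'', IsSolution D z₀ (.tensor v d e) (.tensor v A B ::ₘ (Γ + Δ)) τ₁ U τ'' := by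
  classical
  have hT := hF.of_tensor
  have hC := hΓ.of_tensor
  set Δ₁ := A ::ₘ Γ
  set Δ₂ := B ::ₘ Δ
  set Θ : Sequent L := .tensor v A B ::ₘ (Γ + Δ)
  have hnodes : ∀ C, C ∈ nodes Θ ↔ C = .tensor v A B ∨ C ∈ nodes Δ₁ ∨ C ∈ nodes Δ₂ := fun C => by
    rw [nodes_tensor_cons, Multiset.mem_cons, Multiset.mem_add]
  have hex : ∀ z, z ∈ existVars Θ ↔ z ∈ existVars Δ₁ ∨ z ∈ existVars Δ₂ := fun z => by
    simp only [existVars, hnodes, reduceCtorEq, false_or, or_and_right, exists_or,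
      Set.mem_ofPred_eq]
  have hun : ∀ z, z ∈ univVars Θ ↔ z ∈ univVars Δ₁ ∨ z ∈ univVars Δ₂ := fun z => by
    simp only [univVars, hnodes, reduceCtorEq, false_or, exists_or, Set.mem_ofPred_eq]
  have hbU₁ : ∀ y ∈ boundVars Δ₁, y ∈ U := fun y hy => hU y (by
    rw [boundVars_tensor_cons]
    exact Multiset.mem_add.2 (.inl hy))
  have hbU₂ : ∀ y ∈ boundVars Δ₂, y ∈ U := fun y hy => hU y (by
    rw [boundVars_tensor_cons]
    exact Multiset.mem_add.2 (.inr hy))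
  -- The two solutions are glued. By cleanliness, a variable belonging to both premises is free in
  -- both, and there each solution is the blanked `τ₁`.
  let σ : ℕ → L.Term ℕ := fun z => if z ∈ freeVars Δ₁ ∨ z ∈ boundVars Δ₁ then τ z else τ' z
  have hσ₁ : ∀ z, z ∈ freeVars Δ₁ ∨ z ∈ boundVars Δ₁ → σ z = τ z := fun z hz => if_pos hz
  have hσ₂ : ∀ z, z ∈ freeVars Δ₂ ∨ z ∈ boundVars Δ₂ → σ z = τ' z := by
    intro z hz
    by_cases hz' : z ∈ freeVars Δ₁ ∨ z ∈ boundVars Δ₁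
    · rw [hσ₁ z hz']
      rcases hz with hz | hz <;> rcases hz' with hz' | hz'
      · rw [h.free z hz', h'.free z hz]
      · exact absurd hz (hC.left_free z hz')
      · exact absurd hz' (hC.right_free z hz)
      · exact absurd hz (hC.boundVars z hz')
    · exact if_neg hz'
  have hat₁ : ∀ {l n : ℕ} {P : L.Relations n} {ts : Fin n → L.Term ℕ} {i : Fin n},
      Formula.atom l P ts ∈ nodes Δ₁ → ∀ z ∈ (ts i).varFinset, σ z = τ z := by
    intro l n P ts i hl z hz
    rcases mem_vars_of_atom hl hz with hz | hz | hz
    exacts [hσ₁ z (.inl hz), hσ₁ z (.inr (mem_boundVars_of_existVars hz)),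
      hσ₁ z (.inr (univVars_subset_boundVars hz))]
  have hat₂ : ∀ {l n : ℕ} {P : L.Relations n} {ts : Fin n → L.Term ℕ} {i : Fin n},
      Formula.atom l P ts ∈ nodes Δ₂ → ∀ z ∈ (ts i).varFinset, σ z = τ' z := by
    intro l n P ts i hl z hz
    rcases mem_vars_of_atom hl hz with hz | hz | hz
    exacts [hσ₂ z (.inl hz), hσ₂ z (.inr (mem_boundVars_of_existVars hz)),
      hσ₂ z (.inr (univVars_subset_boundVars hz))]
  have hocc : ∀ {Δ : Sequent L} {l n : ℕ} {P : L.Relations n} {ts : Fin n → L.Term ℕ} {i : Fin n}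
      {z : ℕ}, Formula.atom l P ts ∈ nodes Δ → z ∈ (ts i).varFinset →
      z ∈ freeVars Δ ∨ z ∈ boundVars Δ := by
    intro Δ l n P ts i z hl hz
    rcases mem_vars_of_atom hl hz with hz | hz | hz
    exacts [.inl hz, .inr (mem_boundVars_of_existVars hz), .inr (univVars_subset_boundVars hz)]
  refine ⟨σ, ?_, ?_, ?_, ?_, fun E w hE => ?_⟩
  · intro z hz
    rcases mem_freeVars_tensor_cons.1 hz with hz | hz
    · rw [hσ₁ z (.inl hz), h.free z hz]
    · rw [hσ₂ z (.inl hz), h'.free z hz]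
  · intro l n P ts i hl z hz hzu
    rw [hnodes] at hl
    rcases hl.resolve_left (by simp) with hl | hl
    · rw [hat₁ hl z hz]
      refine h.univ l n P ts i hl z hz (((hun z).1 hzu).resolve_right fun hzu => ?_)
      have hb := univVars_subset_boundVars hzu
      rcases hocc hl hz with h | h
      exacts [hC.right_free z hb h, hC.boundVars z h hb]
    · rw [hat₂ hl z hz]
      refine h'.univ l n P ts i hl z hz (((hun z).1 hzu).resolve_left fun hzu => ?_)
      have hb := univVars_subset_boundVars hzu
      rcases hocc hl hz with h | h
      exacts [hC.left_free z hb h, hC.boundVars z hb h]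
  · intro x hx y hy hyU
    rw [hun]
    rcases (hex x).1 hx with hx | hx
    · rw [hσ₁ x (.inr (mem_boundVars_of_existVars hx))] at hy
      exact .inl (h.strict x hx y hy hyU)
    · rw [hσ₂ x (.inr (mem_boundVars_of_existVars hx))] at hy
      exact .inr (h'.strict x hx y hy hyU)
  -- The skeletons for the empty relation serve only to locate the ends of each link in one premise.
  · have hd := h.skeleton (fun _ _ => False) Term.var (fun _ _ h => h.elim)
    have he := h'.skeleton (fun _ _ => False) Term.var (fun _ _ h => h.elim)
    have hnode₁ : ∀ {C}, C ∈ nodes Θ → C.vertex ∈ vertices Δ₁ → C ∈ nodes Δ₁ := by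
      intro C hC h
      rcases (hnodes C).1 hC with rfl | hC | hC
      exacts [absurd h hT.notMem_left, hC, absurd (mem_vertices_of_mem_nodes hC) (hT.disjoint _ h)]
    have hnode₂ : ∀ {C}, C ∈ nodes Θ → C.vertex ∈ vertices Δ₂ → C ∈ nodes Δ₂ := by
      intro C hC h
      rcases (hnodes C).1 hC with rfl | hC | hC
      exacts [absurd h hT.notMem_right, absurd h (hT.disjoint _ (mem_vertices_of_mem_nodes hC)), hC]
    intro l l' n P ts ts' hl hn hn' i
    rcases hl with hl | hl
    · have hl₁ := hl
      rw [← Deriv.links_mapWitness (f := fun v _ => Term.var v)] at hl₁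
      replace hn := hnode₁ hn (hd.mem_vertices_of_links hl₁ (Sym2.mem_mk_left _ _))
      replace hn' := hnode₁ hn' (hd.mem_vertices_of_links hl₁ (Sym2.mem_mk_right _ _))
      rw [subst_congr (hat₁ hn), subst_congr (hat₁ hn'), h.unifies l l' n P ts ts' hl hn hn' i]
    · have hl₁ := hl
      rw [← Deriv.links_mapWitness (f := fun v _ => Term.var v)] at hl₁
      replace hn := hnode₂ hn (he.mem_vertices_of_links hl₁ (Sym2.mem_mk_left _ _))
      replace hn' := hnode₂ hn' (he.mem_vertices_of_links hl₁ (Sym2.mem_mk_right _ _))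
      rw [subst_congr (hat₂ hn), subst_congr (hat₂ hn'), h'.unifies l l' n P ts ts' hl hn hn' i]
  · have hleap : ∀ a b, E a b → ((b ∈ vertices Δ₁ → TermLeap Δ₁ τ a b) ∧
        (b ∈ vertices Δ₂ → TermLeap Δ₂ τ' a b)) ∧ b ≠ v := by
      intro a b hab
      -- A leap of the glued assignment stays on one side: by `strict`, a universal variable in a
      -- term chosen on the left is bound on the left, and likewise on the right.
      have hboth : ∀ b, b ∈ vertices Θ → E a b → (TermLeap Δ₁ τ a b ∨ TermLeap Δ₂ τ' a b) := by
        intro b hb hab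
        obtain ⟨x, y, C, B', hCn, hBn, hx, hy⟩ := hE a b hab hb
        rw [hnodes] at hCn hBn
        have hbv : y ∈ U := by
          rcases hBn.resolve_left (by simp) with h | h
          exacts [hbU₁ y (mem_boundVars_of_all h), hbU₂ y (mem_boundVars_of_all h)]
        rcases hCn.resolve_left (by simp) with hCn | hCn
        · have hxb := mem_boundVars_of_ex hCn
          rw [hσ₁ x (.inr hxb)] at hy
          replace hx := ((hex x).1 hx).resolve_right fun h =>
            hC.boundVars x hxb (mem_boundVars_of_existVars h)
          have hyb := univVars_subset_boundVars (h.strict x hx y hy hbv)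
          exact .inl ⟨x, y, C, B', hCn, (hBn.resolve_left (by simp)).resolve_right fun h =>
            hC.boundVars y hyb (mem_boundVars_of_all h), hx, hy⟩
        · have hxb := mem_boundVars_of_ex hCn
          rw [hσ₂ x (.inr hxb)] at hy
          replace hx := ((hex x).1 hx).resolve_left fun h =>
            hC.boundVars x (mem_boundVars_of_existVars h) hxb
          have hyb := univVars_subset_boundVars (h'.strict x hx y hy hbv)
          exact .inr ⟨x, y, C, B', hCn, (hBn.resolve_left (by simp)).resolve_left fun h =>
            hC.boundVars y (mem_boundVars_of_all h) hyb, hx, hy⟩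
      have hmem₁ : ∀ {b}, TermLeap Δ₁ τ a b → b ∈ vertices Δ₁ :=
        fun ⟨_, _, _, _, _, h, _⟩ => mem_vertices_of_mem_nodes h
      have hmem₂ : ∀ {b}, TermLeap Δ₂ τ' a b → b ∈ vertices Δ₂ :=
        fun ⟨_, _, _, _, _, h, _⟩ => mem_vertices_of_mem_nodes h
      refine ⟨⟨fun hb => ?_, fun hb => ?_⟩, ?_⟩
      · exact (hboth b (mem_vertices_tensor_cons.2 (.inr (.inl hb))) hab).resolve_right
          fun h => hT.disjoint b hb (hmem₂ h)
      · exact (hboth b (mem_vertices_tensor_cons.2 (.inr (.inr hb))) hab).resolve_left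
          fun h => hT.disjoint b (hmem₁ h) hb
      · rintro rfl
        rcases hboth b (mem_vertices_tensor_cons.2 (.inl rfl)) hab with h | h
        exacts [hT.notMem_left (hmem₁ h), hT.notMem_right (hmem₂ h)]
    exact .tensor v A B Γ Δ _ _ (fun a ha => (hleap a v ha).2 rfl)
      (h.skeleton E w fun a b hab => (hleap a b hab).1.1)
      (h'.skeleton E w fun a b hab => (hleap a b hab).1.2)

end Solution

/-! ### From proofs to solutions, and from skeletons to proofs -/

section Proofs

variable {D : Duality L} {z₀ : ℕ} {d e : Deriv L} {Γ Γ' Δ : Sequent L} {τ₁ σ τ τ' : ℕ → L.Term ℕ}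
  {U : Set ℕ} {A B F : Formula L} {v x y : ℕ} {t : L.Term ℕ}

lemma exists_of_map_eq_cons {α β : Type*} {f : α → β} {s : Multiset α} {b : β} {t : Multiset β}
    (h : s.map f = b ::ₘ t) : ∃ a s', s = a ::ₘ s' ∧ f a = b ∧ s'.map f = t := by
  obtain ⟨a, ha, rfl⟩ := Multiset.mem_map.1 (h ▸ Multiset.mem_cons_self b t)
  obtain ⟨s', rfl⟩ := Multiset.exists_cons_of_mem ha
  rw [Multiset.map_cons, Multiset.cons_inj_right] at h
  exact ⟨a, s', rfl, rfl, h⟩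

lemma exists_of_map_eq_add {α β : Type*} {f : α → β} {s : Multiset α} {t u : Multiset β}
    (h : s.map f = t + u) : ∃ s₁ s₂, s = s₁ + s₂ ∧ s₁.map f = t ∧ s₂.map f = u := by
  induction t using Multiset.induction generalizing s with
  | empty => exact ⟨0, s, by simp, rfl, by simpa using h⟩
  | cons b t ih =>
    rw [Multiset.cons_add] at h
    obtain ⟨a, s, rfl, rfl, h'⟩ := exists_of_map_eq_cons h
    obtain ⟨s₁, s₂, rfl, rfl, rfl⟩ := ih h'
    exact ⟨a ::ₘ s₁, s₂, by simp, by simp, rfl⟩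

lemma map_inst_congr (h : ∀ z ∈ freeVars Γ, σ z = τ z) :
    Γ.map (Formula.inst σ) = Γ.map (Formula.inst τ) :=
  Multiset.map_congr rfl fun F hF => Formula.inst_congr fun z hz => h z ⟨F, hF, hz⟩

/-- The sequents inside a proof carry substituted witnesses, whereas those of a skeleton do not. The
induction therefore treats a proof of an instance of `Γ`, with `τ₁` recording the witnesses of the
rules below and `U` the bound variables without a ∀ rule below. -/
lemma exists_isSolution (h : Proves D d Γ') (hmap : Γ.map (Formula.inst τ₁) = Γ') (hF : IsForest Γ)
    (hΓ : IsClean Γ) (hN : ∀ F ∈ Γ, F.NoCapture τ₁) (hU : ∀ y ∈ boundVars Γ, y ∈ U) (hz₀ : z₀ ∉ U) :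
    ∃ τ, IsSolution D z₀ d Γ τ₁ U τ := by
  induction h generalizing Γ τ₁ U with
  | ax l l' P ts =>
    obtain ⟨F, Γ, rfl, hF₁, h⟩ := exists_of_map_eq_cons hmap
    obtain ⟨F', rfl, hF₂⟩ := Multiset.map_eq_singleton.1 h
    cases F <;> simp only [Formula.inst, reduceCtorEq, Formula.atom.injEq] at hF₁
    cases F' <;> simp only [Formula.inst, reduceCtorEq, Formula.atom.injEq] at hF₂
    obtain ⟨rfl, rfl, h₁, h₂⟩ := hF₁
    obtain ⟨rfl, rfl, h₃, h₄⟩ := hF₂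
    obtain rfl := eq_of_heq h₁
    obtain rfl := eq_of_heq h₃
    exact ⟨_, .ax (congrFun (eq_of_heq h₂)) (congrFun (eq_of_heq h₄))⟩
  | tensor v A B Γ₁ Γ₂ d e hd he ihd ihe =>
    obtain ⟨F, Γ, rfl, hF₁, h⟩ := exists_of_map_eq_cons hmap
    obtain ⟨Γ₁, Γ₂, rfl, rfl, rfl⟩ := exists_of_map_eq_add h
    cases F <;> simp only [Formula.inst, reduceCtorEq, Formula.tensor.injEq] at hF₁
    rename_i A B
    obtain ⟨rfl, rfl, rfl⟩ := hF₁
    have hT := hF.of_tensor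
    have hC := hΓ.of_tensor
    have hNF := hN _ (Multiset.mem_cons_self _ _)
    obtain ⟨τ, h₁⟩ := ihd (Γ := A ::ₘ Γ₁) (τ₁ := τ₁) (by simp) hT.left hC.left (by
      intro F hF
      rcases Multiset.mem_cons.1 hF with rfl | hF
      exacts [hNF.1, hN F (by simp [hF])]) (fun y hy => hU y (by
        rw [boundVars_tensor_cons]
        exact Multiset.mem_add.2 (.inl hy))) hz₀
    obtain ⟨τ', h₂⟩ := ihe (Γ := B ::ₘ Γ₂) (τ₁ := τ₁) (by simp) hT.right hC.right (by
      intro F hF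
      rcases Multiset.mem_cons.1 hF with rfl | hF
      exacts [hNF.2, hN F (by simp [hF])]) (fun y hy => hU y (by
        rw [boundVars_tensor_cons]
        exact Multiset.mem_add.2 (.inr hy))) hz₀
    exact h₁.tensor h₂ hF hΓ hU
  | par v A B Γ₁ d hd ih =>
    obtain ⟨F, Γ, rfl, hF₁, rfl⟩ := exists_of_map_eq_cons hmap
    cases F <;> simp only [Formula.inst, reduceCtorEq, Formula.par.injEq] at hF₁
    rename_i A B
    obtain ⟨rfl, rfl, rfl⟩ := hF₁
    have hNF := hN _ (Multiset.mem_cons_self _ _)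
    obtain ⟨τ, h⟩ := ih (Γ := A ::ₘ B ::ₘ Γ) (τ₁ := τ₁) (by simp) hF.of_par.2 hΓ.of_par (by
      intro F hF
      rcases Multiset.mem_cons.1 hF with rfl | hF
      · exact hNF.1
      rcases Multiset.mem_cons.1 hF with rfl | hF
      exacts [hNF.2, hN F (by simp [hF])]) (fun y hy => hU y (by rwa [boundVars_par_cons])) hz₀
    exact ⟨τ, h.par⟩
  | all v y A Γ₁ d hy hd ih =>
    obtain ⟨F, Γ, rfl, hF₁, rfl⟩ := exists_of_map_eq_cons hmap
    cases F <;> simp only [Formula.inst, reduceCtorEq, Formula.all.injEq] at hF₁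
    rename_i A
    obtain ⟨rfl, rfl, rfl⟩ := hF₁
    obtain ⟨hC, hy₁, hy₂⟩ := hΓ.of_all
    have hNF := hN _ (Multiset.mem_cons_self _ _)
    rename_i y
    have hupd : ∀ z ∈ freeVars Γ, Function.update τ₁ y (Term.var y) z = τ₁ z := fun z hz =>
      Function.update_of_ne (fun e : z = y => hy₂ (e ▸ hz)) _ _
    obtain ⟨τ, h⟩ := ih (Γ := A ::ₘ Γ) (τ₁ := Function.update τ₁ y (Term.var y)) (U := U \ {y})
      (by rw [Multiset.map_cons, map_inst_congr hupd]) hF.of_all.2 hC (by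
        intro F hF
        rcases Multiset.mem_cons.1 hF with rfl | hF
        · exact hNF.2
        · exact Formula.noCapture_congr (fun z hz => (hupd z ⟨F, hF, hz⟩).symm)
            (hN F (by simp [hF])))
      (fun z hz => ⟨hU z (by
        rw [boundVars_all_cons]
        exact Multiset.mem_cons_of_mem hz), fun e => hy₁ (e ▸ hz)⟩) (fun h => hz₀ h.1)
    refine ⟨τ, h.all hF hΓ hNF.1 ?_⟩
    rintro z ⟨F, hF, hz⟩ hyz
    -- As nothing is captured, an occurrence of `y` in `τ₁ z` would be free in the context of the ∀
    -- rule, against its side condition.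
    exact hy ⟨F.inst τ₁, Multiset.mem_map_of_mem _ hF,
      Formula.mem_freeVars_inst (hN F (by simp [hF])) hz hyz⟩
  | ex v x t A Γ₁ d ht hd ih =>
    obtain ⟨F, Γ, rfl, hF₁, rfl⟩ := exists_of_map_eq_cons hmap
    cases F <;> simp only [Formula.inst, reduceCtorEq, Formula.ex.injEq] at hF₁
    rename_i A
    obtain ⟨rfl, rfl, rfl⟩ := hF₁
    obtain ⟨hC, hx₁, hx₂⟩ := hΓ.of_ex
    have hNF := hN _ (Multiset.mem_cons_self _ _)
    rename_i x
    have hxA : x ∉ A.boundVars := fun h => hx₁ (by simp [boundVars_cons, h])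
    have hupd : ∀ z ∈ freeVars Γ, Function.update τ₁ x t z = τ₁ z := fun z hz =>
      Function.update_of_ne (fun e : z = x => hx₂ (e ▸ hz)) _ _
    obtain ⟨τ, h⟩ := ih (Γ := A ::ₘ Γ) (τ₁ := Function.update τ₁ x t) (U := U)
      (by
        rw [Multiset.map_cons, map_inst_congr hupd, Formula.subst_inst hxA]
        intro z hz
        by_cases e : z = x
        · simp [e, Term.subst, single]
        · rw [Function.update_of_ne e, Function.update_of_ne e,
            subst_single_of_notMem (hNF.1 z hz e)]) hF.of_ex.2 hC (by
        intro F hF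
        rcases Multiset.mem_cons.1 hF with rfl | hF
        · have := Formula.noCapture_update hxA (Function.update_self ..) hNF.2 ht
          rwa [Function.update_idem] at this
        · exact Formula.noCapture_congr (fun z hz => (hupd z ⟨F, hF, hz⟩).symm)
            (hN F (by simp [hF])))
      (fun z hz => hU z (by
        rw [boundVars_ex_cons]
        exact Multiset.mem_cons_of_mem hz)) hz₀
    exact ⟨τ, h.ex hF hΓ hU hz₀ t⟩

/-- The data of a unifier `σ` of `θ` that makes every skeleton over `Γ₀` with links
in `θ` a proof. -/
structure IsWitnessing (D : Duality L) (Γ₀ : Sequent L) (θ : Set (Sym2 ℕ)) (σ : ℕ → L.Term ℕ)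
    (w : ℕ → L.Term ℕ) : Prop where
  isForest : IsForest Γ₀
  isClean : IsClean Γ₀
  eq_var : ∀ z ∉ existVars Γ₀, σ z = Term.var z
  notMem : ∀ x ∈ existVars Γ₀, ∀ y ∈ (σ x).varFinset, ∀ v A, Formula.ex v y A ∉ nodes Γ₀
  witness : ∀ v x A, Formula.ex v x A ∈ nodes Γ₀ → w v = σ x
  unifies : Unifies D Γ₀ θ σ

/-- Leaps encode exactly the side conditions. A violation at a ∀ rule would need an ∃ variable free
in the context whose term contains the eigenvariable, but the leap places that quantifier above the
rule. A capture at an ∃ rule would be a leap to a ∀ further above, which the skeleton excludes. -/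
theorem Skeleton.proves {Γ₀ : Sequent L} {θ : Set (Sym2 ℕ)} {w : ℕ → L.Term ℕ}
    (hσ : IsWitnessing D Γ₀ θ σ w) (h : Skeleton D (TermLeap Γ₀ σ) w d Δ) (hF : IsForest Δ)
    (hC : IsClean Δ) (hn : nodes Δ ⊆ nodes Γ₀) (hθ : d.links ⊆ θ) :
    Proves D d (Δ.map (Formula.inst σ)) := by
  induction h with
  | ax l l' P ts ts' =>
    simp only [Multiset.insert_eq_cons, Multiset.map_cons, Multiset.map_singleton, Formula.inst]
    have : (fun i => (ts' i).subst σ) = fun i => (ts i).subst σ := funext fun i =>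
      (hσ.unifies l l' _ P ts ts' (hθ rfl) (hn (by simp [nodes, Formula.nodes]))
        (hn (by simp [nodes, Formula.nodes])) i).symm
    rw [this]
    exact .ax l l' P _
  | tensor v A B Γ Δ d e hv hd he ihd ihe =>
    have hT := hF.of_tensor
    have hC := hC.of_tensor
    rw [Multiset.map_cons, Multiset.map_add]
    refine .tensor v _ _ _ _ d e ?_ ?_
    · simpa using ihd hT.left hC.left
        (Multiset.Subset.trans nodes_subset_tensor_left hn) (Set.subset_union_left.trans hθ)
    · simpa using ihe hT.right hC.right
        (Multiset.Subset.trans nodes_subset_tensor_right hn) (Set.subset_union_right.trans hθ)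
  | unary r F P Γ d hr hE hd ih =>
    have hv := (hr.isForest hF).1
    have hn' := Multiset.Subset.trans hr.nodes_subset hn
    have ih := fun hC => ih (hr.isForest hF).2 hC hn' hθ
    have hFn : F ∈ nodes Γ₀ := hn (by
      rw [hr.nodes_cons]
      exact Multiset.mem_cons_self _ _)
    rw [Multiset.map_cons]
    cases hr with
    | par v A B =>
      exact .par v _ _ _ d (by simpa using ih (by simpa using hC.of_par))
    | all v y A =>
      obtain ⟨hC', hy₁, hy₂⟩ := hC.of_all
      simp only [Multiset.cons_add, zero_add, Multiset.map_cons] at ih hn' hE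
      -- A universal variable is not existential in a clean sequent, so `σ` fixes `y` and resetting
      -- it under the quantifier changes nothing.
      have hσy : σ y = Term.var y := hσ.eq_var y fun ⟨a, C, h, _⟩ =>
        hσ.isClean.ex_ne_all h hFn rfl
      have hupd : Function.update σ y (Term.var y) = σ := by
        rw [← hσy, Function.update_eq_self]
      rw [Formula.inst, hupd]
      refine .all v y _ _ d ?_ (ih hC')
      rintro ⟨G, hG, hyG⟩
      obtain ⟨G, hGΓ, rfl⟩ := Multiset.mem_map.1 hG
      obtain ⟨z, hz, hyz⟩ := Formula.exists_of_mem_freeVars_inst hyG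
      by_cases hze : z ∈ existVars Γ₀
      · obtain ⟨a, C, hCn, hzC⟩ := id hze
        obtain ⟨C', hC'n, e⟩ := hE a ⟨z, y, C, A, hCn, hFn, hze, hyz⟩
        obtain rfl := hσ.isForest.eq_of_vertex_eq (hn' hC'n) hCn e
        -- The quantifier of `z` lies in the premise, where `z` would be both bound and free.
        exact hC'.2 z (mem_boundVars_of_ex hC'n) ⟨G, Multiset.mem_cons_of_mem hGΓ, hz⟩
      · rw [hσ.eq_var z hze, Term.varFinset, Finset.mem_singleton] at hyz
        subst hyz
        exact hy₂ ⟨G, hGΓ, hz⟩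
    | ex v x A =>
      obtain ⟨hC', hx₁, hx₂⟩ := hC.of_ex
      simp only [Multiset.cons_add, zero_add, Multiset.map_cons] at ih hn' hE hd hv
      have hxA : x ∉ A.boundVars := fun h => hx₁ (by simp [boundVars_cons, h])
      have hσx : ∀ z, z ≠ x → x ∉ (σ z).varFinset := by
        intro z hz hx
        by_cases hze : z ∈ existVars Γ₀
        · exact hσ.notMem z hze x hx v A hFn
        · rw [hσ.eq_var z hze, Term.varFinset, Finset.mem_singleton] at hx
          exact hz hx.symm
      rw [Formula.inst, hσ.witness v x A hFn]
      refine .ex v x _ _ _ d ?_ ?_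
      · by_cases hxf : x ∈ A.freeVars
        · have hxe : x ∈ existVars Γ₀ := ⟨v, A, hFn, hxf⟩
          refine Formula.freeFor_of_disjoint fun y hy hyx => ?_
          rw [Formula.boundVars_inst] at hy
          have hy' : y ∈ boundVars (A ::ₘ Γ) := by simp [boundVars_cons, hy]
          rcases mem_boundVars_iff.1 hy' with ⟨a, C, h⟩ | ⟨b, C, h⟩
          · exact hσ.notMem x hxe y hyx a C (hn' h)
          -- The captured variable is universal, so there is a leap from `v` into the premise, and
          -- its source `v` would have to be a vertex of the premise.
          · exact hv (hd.mem_vertices_of_leap (a := v) ⟨x, y, A, C, hFn, hn' h, hxe, hyx⟩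
              (mem_vertices_of_mem_nodes h))
        · refine Formula.freeFor_of_notMem (fun h => ?_) (by rwa [Formula.boundVars_inst])
          obtain ⟨z, hz, h⟩ := Formula.exists_of_mem_freeVars_inst h
          have hne : z ≠ x := fun e => hxf (e ▸ hz)
          rw [Function.update_of_ne hne] at h
          exact hσx z hne h
      · rw [Formula.subst_inst (τ := σ) hxA]
        · exact ih hC'
        · intro z hz
          by_cases e : z = x
          · simp [e, Term.subst, single]
          · rw [Function.update_of_ne e, subst_single_of_notMem (hσx z e)]

/-! ### From solutions to unification nets and equivalences -/

lemma IsSolution.subst_eq_assign (h : IsSolution D z₀ d Γ Term.var U τ)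
    (hU : ∀ z ∈ freeVars Γ, z ∉ U) {l n : ℕ} {P : L.Relations n} {ts : Fin n → L.Term ℕ} {i : Fin n}
    (hl : Formula.atom l P ts ∈ nodes Γ) : assign Γ τ (ts i) = (ts i).subst τ := by
  -- On leaves, `τ` fixes the remaining variables as `assign` does: free variables are outside `U`,
  -- and universal ones are covered by `univ`.
  refine subst_congr fun z hz => ?_
  split_ifs with hze
  · rfl
  · rcases mem_vars_of_atom hl hz with hzf | hze' | hzu
    · rw [h.free z hzf, blank_var (hU z hzf)]
    · exact absurd hze' hze
    · exact (h.univ l n P ts i hl z hz hzu).symm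

lemma IsSolution.isUnifier (h : IsSolution D z₀ d Γ Term.var U τ)
    (hU : ∀ z ∈ freeVars Γ, z ∉ U) : IsUnifier D Γ d.links τ := by
  intro l l' n P ts ts' hl hn hn' i
  rw [h.subst_eq_assign hU hn, h.subst_eq_assign hU hn', h.unifies l l' n P ts ts' hl hn hn' i]

lemma IsSolution.skeleton_of_le {E : ℕ → ℕ → Prop} (h : IsSolution D z₀ d Γ Term.var U τ)
    (hE : ∀ a b, E a b → TermLeap Γ τ a b) (w : ℕ → L.Term ℕ) :
    Skeleton D E w (d.withWitnesses w) Γ := h.skeleton E w fun a b hab _ => hE a b hab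

lemma CutFreeProof.exists_isSolution (p : CutFreeProof D Γ) (hF : IsForest Γ) (hC : IsClean Γ)
    (hz₀ : z₀ ∉ boundVars Γ) :
    ∃ τ, IsSolution D z₀ p.1 Γ Term.var {y | y ∈ boundVars Γ} τ :=
  MLL1.exists_isSolution p.2 (by simp [funext Formula.inst_var]) hF hC
    (fun F _ => F.noCapture_var) (fun _ hy => hy) hz₀

lemma exists_notMem_boundVars (Γ : Sequent L) : ∃ z₀, z₀ ∉ boundVars Γ := by
  obtain ⟨z₀, h⟩ := Infinite.exists_notMem_finset (boundVars Γ).toFinset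
  exact ⟨z₀, fun h' => h (Multiset.mem_toFinset.2 h')⟩

/-- The linking of a proof is a unification net. -/
theorem CutFreeProof.exists_translatesTo (p : CutFreeProof D Γ) (hF : IsForest Γ) (hC : IsClean Γ) :
    ∃ θ : UnificationNet D Γ, p.TranslatesTo θ := by
  obtain ⟨z₀, hz₀⟩ := exists_notMem_boundVars Γ
  obtain ⟨τ, h⟩ := p.exists_isSolution hF hC hz₀
  have hU : ∀ z ∈ freeVars Γ, z ∉ {y | y ∈ boundVars Γ} := fun z hz h => hC.2 z h hz
  have hτ := h.isUnifier hU
  have hleap : ∀ a b, Leap D Γ p.linking a b → TermLeap Γ τ a b := by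
    rintro a b ⟨x, y, A, B, hA, hB, hx, σ, hσ, hy⟩
    obtain ⟨ρ, hρ, hρτ⟩ := hσ.2 τ hτ
    refine ⟨x, y, A, B, hA, hB, hx, ?_⟩
    -- `ρ` fixes the universal variable `y`, so `y` survives in the less general term `τ x`.
    rw [hρτ x hx, mem_varFinset_subst]
    exact ⟨y, hy, by simp [hρ y (.inr ⟨b, B, hB⟩)]⟩
  -- The choice of witnesses is immaterial: links and switchings do not depend on them.
  have hs := h.skeleton_of_le hleap Term.var
  have hlinks : (p.1.withWitnesses Term.var).links = p.linking := Deriv.links_mapWitness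
  refine ⟨⟨p.linking, hlinks ▸ hs.isLinking hF, ⟨τ, hτ⟩, fun c hc => ?_⟩, rfl⟩
  have := (hs.isTreeOn (c := c) hF (fun a b ⟨_, y, _, B, _, hB, _⟩ _ => .inr ⟨y, B, hB⟩) hc).isTree
  rwa [hlinks] at this

/-- Conversion preserves being a skeleton and the links, so by `hp` each intermediate derivation is
a proof and each step is a commutation of proofs. -/
lemma CutFreeProof.equivalent_of_convertible {E : ℕ → ℕ → Prop} {w : ℕ → L.Term ℕ}
    {θ : Set (Sym2 ℕ)} (hp : ∀ d, Skeleton D E w d Γ → d.links = θ → Proves D d Γ)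
    (h : Convertible D E w Γ d e) (hs : Skeleton D E w d Γ) (hθ : d.links = θ)
    (hd : Proves D d Γ) (he : Proves D e Γ) :
    CutFreeProof.Equivalent (⟨d, hd⟩ : CutFreeProof D Γ) ⟨e, he⟩ := by
  induction h with
  | rel _ _ h => exact .rel _ _ (.inl h.2.2)
  | refl => exact .refl _
  | symm d e h ih =>
    have h' : Convertible D E w Γ d e := h
    exact .symm _ _ (ih (h'.skeleton_iff.2 hs) (h'.links_eq.trans hθ) he hd)
  | trans d₁ d₂ d₃ h₁ h₂ ih₁ ih₂ =>
    have h₁' : Convertible D E w Γ d₁ d₂ := h₁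
    have hs₂ := h₁'.skeleton_iff.1 hs
    have hθ₂ := h₁'.links_eq.symm.trans hθ
    exact .trans _ _ _ (ih₁ hs hθ hd (hp _ hs₂ hθ₂)) (ih₂ hs₂ hθ₂ (hp _ hs₂ hθ₂) he)

/-- Proofs with the same linking are equivalent. -/
theorem CutFreeProof.equivalent_of_linking_eq (p q : CutFreeProof D Γ) (hF : IsForest Γ)
    (hC : IsClean Γ) (h : p.linking = q.linking) : p.Equivalent q := by
  classical
  obtain ⟨z₀, hz₀⟩ := exists_notMem_boundVars Γ
  obtain ⟨τ, hp⟩ := p.exists_isSolution hF hC hz₀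
  obtain ⟨τ', hq⟩ := q.exists_isSolution hF hC hz₀
  have hU : ∀ z ∈ freeVars Γ, z ∉ {y | y ∈ boundVars Γ} := fun z hz h => hC.2 z h hz
  -- The dummy `z₀` is not bound in `Γ`, so placing it at disagreements creates no leaps.
  let σ : ℕ → L.Term ℕ := fun z =>
    if z ∈ existVars Γ then antiUnify z₀ (τ z) (τ' z) else Term.var z
  have hσ : ∀ z ∈ existVars Γ, σ z = antiUnify z₀ (τ z) (τ' z) := fun z hz => if_pos hz
  have hne : ∀ {y}, y ∈ boundVars Γ → y ≠ z₀ := fun hy e => hz₀ (e ▸ hy)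
  have hσle : ∀ x ∈ existVars Γ, ∀ y ∈ boundVars Γ, y ∈ (σ x).varFinset →
      y ∈ (τ x).varFinset ∧ y ∈ (τ' x).varFinset := fun x hx y hy h =>
    mem_of_mem_antiUnify (hne hy) _ _ (hσ x hx ▸ h)
  have hterm : ∀ {l n : ℕ} {P : L.Relations n} {ts : Fin n → L.Term ℕ} {i : Fin n},
      Formula.atom l P ts ∈ nodes Γ →
      (ts i).subst σ = antiUnify z₀ ((ts i).subst τ) ((ts i).subst τ') := by
    intro l n P ts i hl
    rw [← hp.subst_eq_assign hU hl, ← hq.subst_eq_assign hU hl, assign, assign, antiUnify_subst]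
    refine subst_congr fun z _ => ?_
    by_cases hz : z ∈ existVars Γ
    · simp [hz, σ]
    · simp [hz, σ, antiUnify]
  -- In a forest a vertex determines its formula, so the chosen variable is the one bound at `v`.
  let w : ℕ → L.Term ℕ := fun v =>
    if h : ∃ x A, Formula.ex v x A ∈ nodes Γ then σ h.choose else Term.var v
  have hw : IsWitnessing D Γ p.linking σ w := by
    refine ⟨hF, hC, fun z hz => if_neg hz, fun x hx y hy v A hA => ?_, fun v x A hA => ?_, ?_⟩
    · have hyb := mem_boundVars_of_ex hA
      obtain ⟨b, B, hB⟩ := hp.strict x hx y (hσle x hx y hyb hy).1 hyb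
      exact hC.ex_ne_all hA hB rfl
    · have hex : ∃ x A, Formula.ex v x A ∈ nodes Γ := ⟨x, A, hA⟩
      have hwv : w v = σ hex.choose := dif_pos hex
      obtain ⟨B, hB⟩ := hex.choose_spec
      have := hF.eq_of_vertex_eq hB hA rfl
      rw [Formula.ex.injEq] at this
      rw [hwv, this.2.1]
    · intro l l' n P ts ts' hl hn hn' i
      rw [hterm hn, hterm hn', hp.unifies l l' n P ts ts' hl hn hn' i,
        hq.unifies l l' n P ts ts' (h.subset hl) hn hn' i]
  have hprov : ∀ d, Skeleton D (TermLeap Γ σ) w d Γ → d.links = p.linking → Proves D d Γ := by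
    intro d hd hl
    have := hd.proves hw hF hC (Multiset.Subset.refl _) hl.le
    have hid : Γ.map (Formula.inst σ) = Γ := by
      rw [map_inst_congr (τ := Term.var)]
      · simp [funext Formula.inst_var]
      · exact fun z hz => if_neg fun h => hC.2 z (mem_boundVars_of_existVars h) hz
    rwa [hid] at this
  have hsp := hp.skeleton_of_le (E := TermLeap Γ σ) (fun a b ⟨x, y, A, B, hA, hB, hx, hy⟩ =>
    ⟨x, y, A, B, hA, hB, hx, (hσle x hx y (mem_boundVars_of_all hB) hy).1⟩) w
  have hsq := hq.skeleton_of_le (E := TermLeap Γ σ) (fun a b ⟨x, y, A, B, hA, hB, hx, hy⟩ =>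
    ⟨x, y, A, B, hA, hB, hx, (hσle x hx y (mem_boundVars_of_all hB) hy).2⟩) w
  have hlp : (p.1.withWitnesses w).links = p.linking := Deriv.links_mapWitness
  have hlq : (q.1.withWitnesses w).links = p.linking := Deriv.links_mapWitness.trans h.symm
  have hc := equivalent_of_convertible hprov (hsq.convertible hF hsp (hlp.trans hlq.symm)) hsp hlp
    (hprov _ hsp hlp) (hprov _ hsq hlq)
  -- Both proofs are re-witnessed to the common `σ`, where commutations connect them; the second
  -- re-witnessing is used backwards.
  refine .trans _ _ _ (.rel _ _ (.inr ?_)) (.trans _ _ _ hc (.symm _ _ (.rel _ _ (.inr ?_))))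
  · exact Deriv.reflTransGen_withWitnesses w p.1
  · exact Deriv.reflTransGen_withWitnesses w q.1

end Proofs

end MLL1

theorem mainTheorem1 {L : FirstOrder.Language.{u, v}} (D : MLL1.Duality L) (Γ : MLL1.Sequent L)
    (hforest : MLL1.IsForest Γ) (hclean : MLL1.IsClean Γ) (p q : MLL1.CutFreeProof D Γ) :
    p.Equivalent q ↔
      ∃ θ : MLL1.UnificationNet D Γ, p.TranslatesTo θ ∧ q.TranslatesTo θ := by
  constructor
  · intro h
    obtain ⟨θ, hθ⟩ := p.exists_translatesTo hforest hclean
    exact ⟨θ, hθ, h.linking_eq.symm.trans hθ⟩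
  · rintro ⟨θ, hp, hq⟩
    exact p.equivalent_of_linking_eq q hforest hclean (hp.trans hq.symm)
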